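/- **Conventions.** Functions take values in $\mathbb{R}\cup\{\infty\}$; $f$ is $\ell$-weakly convex if $f+\frac{\ell}{2}\|\cdot\|^2$ is convex, and closed if it is lower semicontinuous. $v\in\partial f(x)$ means that $f(x)$ is finite and $f(y)\ge f(x)+\langle v,y-x\rangle+o(\|y-x\|)$ as $y\to x$; $x$ is critical if $0\in\partial f(x)$. For $\lambda>0$, $f_\lambda(x)=\min_y\{f(y)+\frac1{2\lambda}\|y-x\|^2\}$ and $\mathrm{prox}_{\lambda f}(x)=\operatorname{argmin}_y\{f(y)+\frac1{2\lambda}\|y-x\|^2\}$. For a linear operator $A$, $\lambda_{\max}(A)$ is its largest real eigenvalue. A set $\mathcal M\ni x$ is an *active $C^2$ manifold* of $f$ at $x$ if for some open neighbourhood $\mathcal U$ of $x$: $\mathcal M\cap\mathcal U$ is a $C^2$ submanifold on which $f$ is finite and $C^2$; and $\inf\{\|v\|: v\in\partial f(y),\ y\in\mathcal U\setminus\mathcal M\}>0$. Let $f_{\mathcal M}$ be $f$ on $\mathcal M$ and $+\infty$ elsewhere, and put $df(x)(u)=\liminf_{t\downarrow0,\,u'\to u}\frac{f(x+tu')-f(x)}{t}$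 and $$d^2f(x)(u)=\inf_w\ \liminf_{t\downarrow0,\,w'\to w}\frac{f(x+tu+\frac12t^2w')-f(x)-t\,df(x)(u)}{\frac12t^2}.$$ A critical point $x$ of $f$ is a *strict saddle* if $f$ has an active $C^2$ manifold $\mathcal M$ at $x$ with $d^2f_{\mathcal M}(x)(u)<0$ for some tangent vector $u\in T_{\mathcal M}(x)$. $f$ has the *strict saddle property* if each of its critical points is a local minimizer or a strict saddle. For $f=h\circ F+m$, the problem admits a *composite active $C^2$ manifold* at $x$ if there are sets $\mathcal M\ni x$, $\mathcal K\ni F(x)$ and open neighbourhoods $U$ of $x$, $V$ of $F(x)$ such that: $\mathcal M\cap U$ and $\mathcal K\cap V$ are $C^2$ submanifolds on which $m$, respectively $h$, is finite and $C^2$; $\nabla F(x)\,T_{\mathcal M}(x)+T_{\mathcal K}(F(x))$ is the whole space; and $\inf\{\|\nabla F(x)^{\top}z+w\| : z\in\partial h(u),\ w\in\partial m(y),\ (y,u)\in (U\times V)\setminus(\mathcal M\times\mathcal K)\}>0$. **Statement.** Let $\ell>0$, $\lambda\in(0,1/\ell)$, $\eta>0$ and $\bar x\in\mathbb{R}^d$.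 In each of the following settings assume that $f$ is $\ell$-weakly convex and has the strict saddle property, and that $\nabla f_\lambda(\bar x)=0$ and $\lambda_{\max}(\nabla S(\bar x))\le1$. Then $\bar x$ is a local minimizer of $f$. 1. (Proximal point.) $f:\mathbb{R}^d\to\mathbb{R}\cup\{\infty\}$ is closed and has an active $C^2$ manifold at $\bar x$; $\eta\ell<1$; $S=\mathrm{prox}_{\eta f}$. 2. (Proximal gradient.) $f=g+m$ with $g:\mathbb{R}^d\to\mathbb{R}$ of class $C^2$ with Lipschitz gradient and $m:\mathbb{R}^d\to\mathbb{R}\cup\{\infty\}$ closed and $\mu$-weakly convex, $\mu\ge0$; $f$ has an active $C^2$ manifold at $\bar x$; $\eta\mu<1$; $S(x)=\mathrm{prox}_{\eta m}(x-\eta\nabla g(x))$. 3. (Proximal linear.) $f=h\circ F+m$ with $F:\mathbb{R}^d\to\mathbb{R}^n$ of class $C^2$, $h:\mathbb{R}^n\to\mathbb{R}\cup\{\infty\}$ closed and convex, and $m:\mathbb{R}^d\to\mathbb{R}\cup\{\infty\}$ closed and $\mu$-weakly convex, $\mu\ge0$; the problem admits a composite active $C^2$ manifold at $\bar x$; $\eta\mu<1$;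 $S(x)=\operatorname{argmin}_y\{h(F(x)+\nabla F(x)(y-x))+m(y)+\frac1{2\eta}\|y-x\|^2\}$. -/

import Mathlib

open Filter Topology

noncomputable section

/-! Functions with values in `ℝ ∪ {∞}` are maps `f : E → EReal` with `f x ≠ ⊥` for all `x`;
closedness of `f` is `LowerSemicontinuous f`. -/

section General

variable {E : Type*} [NormedAddCommGroup E] [InnerProductSpace ℝ E]

/-- Convexity of an extended-real-valued function (in `EReal`, `0 * ⊤ = 0`). -/
def ExtConvex (f : E → EReal) : Prop :=
  ∀ x y : E, ∀ a b : ℝ, 0 ≤ a → 0 ≤ b → a + b = 1 →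
    f (a • x + b • y) ≤ (a : EReal) * f x + (b : EReal) * f y

/-- `f` is `ℓ`-weakly convex: `f + (ℓ/2) ‖·‖²` is convex. -/
def WeaklyConvex (ℓ : ℝ) (f : E → EReal) : Prop :=
  ExtConvex fun x => f x + ((ℓ / 2 * ‖x‖ ^ 2 : ℝ) : EReal)

/-- The (Fréchet) subdifferential: `v ∈ ∂f(x)` iff `f(x)` is finite and
`f(y) ≥ f(x) + ⟪v, y - x⟫ + o(‖y - x‖)` as `y → x`. -/
def subdiff (f : E → EReal) (x : E) : Set E :=
  {v | f x ≠ ⊥ ∧ f x ≠ ⊤ ∧ ∀ ε : ℝ, 0 < ε → ∀ᶠ y in 𝓝 x,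
    f x + ((inner ℝ v (y - x) - ε * ‖y - x‖ : ℝ) : EReal) ≤ f y}

/-- Critical points: `0 ∈ ∂f(x)`. -/
def IsCriticalPoint (f : E → EReal) (x : E) : Prop := (0 : E) ∈ subdiff f x

/-- The subderivative `df(x)(u) = liminf_{t ↓ 0, u' → u} (f(x + t u') - f(x)) / t`. -/
def subderiv (f : E → EReal) (x u : E) : EReal :=
  liminf (fun q : ℝ × E => ((q.1⁻¹ : ℝ) : EReal) * (f (x + q.1 • q.2) - f x))
    (𝓝[>] (0 : ℝ) ×ˢ 𝓝 u)

/-- The parabolic subderivative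
`d²f(x)(u|w) = liminf_{t ↓ 0, w' → w} (f(x + t u + t²/2 w') - f(x) - t df(x)(u)) / (t²/2)`. -/
def parabolicSubderiv (f : E → EReal) (x u w : E) : EReal :=
  liminf (fun q : ℝ × E => ((2 / q.1 ^ 2 : ℝ) : EReal) *
      (f (x + q.1 • u + (q.1 ^ 2 / 2) • q.2) - f x - (q.1 : EReal) * subderiv f x u))
    (𝓝[>] (0 : ℝ) ×ˢ 𝓝 w)

/-- `d²f(x)(u) = inf_w d²f(x)(u|w)`. For the restriction of a function to a manifold `M` along
which it is `C²`, at a critical point and for `u ∈ T_M(x)`, the quantity `d²f_M(x)(u|w)` has one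
and the same finite value for all second order tangents `w` to `M` at `x` along `u`, and is `+∞`
for all other `w`; so this infimum is that common value. -/
def secondSubderiv (f : E → EReal) (x u : E) : EReal := ⨅ w : E, parabolicSubderiv f x u w

open Classical in
/-- `f_M`: equal to `f` on `M` and to `+∞` off `M`. -/
def restrictTo (f : E → EReal) (M : Set E) : E → EReal := fun x => if x ∈ M then f x else ⊤

/-- `N` is a `C^p` (embedded) submanifold: near each of its points it is the zero set of a
`C^p` map with surjective derivative. -/
def IsSmoothManifold (p : WithTop ℕ∞) (N : Set E) : Prop :=
  ∀ x ∈ N, ∃ (k : ℕ) (W : Set E) (G : E → EuclideanSpace ℝ (Fin k)),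
    IsOpen W ∧ x ∈ W ∧ ContDiffOn ℝ p G W ∧ Function.Surjective (fderiv ℝ G x) ∧
      N ∩ W = {y | y ∈ W ∧ G y = 0}

/-- The restriction of `f` to `N` is (finite and) `C^p`: near each point of `N` it agrees on `N`
with a real-valued `C^p` function. -/
def IsSmoothAlong (p : WithTop ℕ∞) (f : E → EReal) (N : Set E) : Prop :=
  ∀ x ∈ N, ∃ (W : Set E) (φ : E → ℝ), IsOpen W ∧ x ∈ W ∧ ContDiffOn ℝ p φ W ∧
    ∀ y ∈ N ∩ W, f y = (φ y : EReal)

/-- `M` is an active `C^p` manifold of `f` around its point `x` (that `x` is critical is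
always required separately). -/
def IsActiveManifold (p : WithTop ℕ∞) (f : E → EReal) (M : Set E) (x : E) : Prop :=
  x ∈ M ∧ ∃ U : Set E, IsOpen U ∧ x ∈ U ∧
    IsSmoothManifold p (M ∩ U) ∧ IsSmoothAlong p f (M ∩ U) ∧
    ∃ c : ℝ, 0 < c ∧ ∀ y ∈ U, y ∉ M → ∀ v ∈ subdiff f y, c ≤ ‖v‖

/-- Strict saddles: critical points with a `C²` active manifold `M` and a tangent direction
`u ∈ T_M(x)` along which `d²f_M(x)(u) < 0`. -/
def IsStrictSaddle (f : E → EReal) (x : E) : Prop :=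
  IsCriticalPoint f x ∧ ∃ M : Set E, IsActiveManifold 2 f M x ∧
    ∃ u ∈ tangentConeAt ℝ M x, secondSubderiv (restrictTo f M) x u < 0

/-- Every critical point is a local minimizer or a strict saddle. -/
def StrictSaddleProperty (f : E → EReal) : Prop :=
  ∀ x : E, IsCriticalPoint f x → IsLocalMin f x ∨ IsStrictSaddle f x

/-- The Moreau envelope `f_r(x) = min_y f(y) + ‖y - x‖² / (2 r)`, as a real-valued function
(for closed `ℓ`-weakly convex `f`, not identically `+∞`, and `0 < r < 1/ℓ`, it is finite). -/
def moreauEnvelope (r : ℝ) (f : E → EReal) (x : E) : ℝ :=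
  (⨅ y : E, f y + ((1 / (2 * r) * ‖y - x‖ ^ 2 : ℝ) : EReal)).toReal

/-- A minimizer of `φ` (arbitrary if there is none). -/
def argmin (φ : E → EReal) : E := Classical.epsilon fun y => ∀ z : E, φ y ≤ φ z

/-- The proximal map `prox_{η f}(x) = argmin_y f(y) + ‖y - x‖² / (2 η)`. -/
def prox (η : ℝ) (f : E → EReal) (x : E) : E :=
  argmin fun y => f y + ((1 / (2 * η) * ‖y - x‖ ^ 2 : ℝ) : EReal)

/-- The largest (real) eigenvalue of an operator on a finite-dimensional space. -/
def lambdaMax (A : E →L[ℝ] E) : ℝ :=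
  sSup {r : ℝ | Module.End.HasEigenvalue (A : E →ₗ[ℝ] E) r}

end General

section Maps

variable {E : Type*} [NormedAddCommGroup E] [InnerProductSpace ℝ E] [CompleteSpace E]
variable {E₂ : Type*} [NormedAddCommGroup E₂] [InnerProductSpace ℝ E₂] [CompleteSpace E₂]

/-- The update map of the proximal gradient method for `g + m`. -/
def proxGradMap (η : ℝ) (g : E → ℝ) (m : E → EReal) (x : E) : E :=
  prox η m (x - η • gradient g x)

/-- The update map of the proximal linear method for `h ∘ F + m`. -/
def proxLinMap (η : ℝ) (h : E₂ → EReal) (F : E → E₂) (m : E → EReal) (x : E) : E :=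
  argmin fun y => h (F x + fderiv ℝ F x (y - x)) + m y
    + ((1 / (2 * η) * ‖y - x‖ ^ 2 : ℝ) : EReal)

/-- The problem `min h(F(x)) + m(x)` admits a composite `C^p` active manifold at `x`, namely
`M ∩ F⁻¹(K)`: `M` and `K` are `C^p` manifolds around `x` and `F x` along which `m` and `h` are
`C^p`; `F` restricted to `M` is transverse to `K` at `x`; and the vectors `∇F(x)ᵀ z + w` with
`z ∈ ∂h(u)`, `w ∈ ∂m(y)`, `(y, u)` near `(x, F x)` but not in `M × K`, are bounded away from
zero. (That `x` is critical is required separately.) -/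
def AdmitsCompositeActiveManifold (p : WithTop ℕ∞) (h : E₂ → EReal) (F : E → E₂)
    (m : E → EReal) (x : E) : Prop :=
  ∃ (M : Set E) (K : Set E₂), x ∈ M ∧ F x ∈ K ∧
    ∃ (U : Set E) (V : Set E₂), IsOpen U ∧ x ∈ U ∧ IsOpen V ∧ F x ∈ V ∧
      (IsSmoothManifold p (M ∩ U) ∧ IsSmoothAlong p m (M ∩ U)) ∧
      (IsSmoothManifold p (K ∩ V) ∧ IsSmoothAlong p h (K ∩ V)) ∧
      (∀ v : E₂, ∃ a ∈ tangentConeAt ℝ M x, ∃ b ∈ tangentConeAt ℝ K (F x),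
        fderiv ℝ F x a + b = v) ∧
      ∃ c : ℝ, 0 < c ∧ ∀ y ∈ U, ∀ u ∈ V, ¬ (y ∈ M ∧ u ∈ K) →
        ∀ z ∈ subdiff h u, ∀ w ∈ subdiff m y,
          c ≤ ‖ContinuousLinearMap.adjoint (fderiv ℝ F x) z + w‖

end Maps

end

/-!
A point with `∇f_λ = 0` is critical, so it suffices that at a strict saddle `x₀` the derivative of
the iteration map has an eigenvalue above `1`. The proximal point method is the proximal gradient
method with `g = 0`, and the latter is the proximal linear method with `h = id`, by completing the
square; so only proximal linear maps matter.

Near `(x₀, x₀)` consider the subproblem `min_y h(F(x) + ∇F(x)(y - x)) + m(y) + ‖y - c‖² / (2η)` with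
a free centre `c`. Sharpness forces its solutions and their linearized images onto `M × K`, where
`m` and `h` are `C²`, so its first-order conditions give a Lipschitz solution map. Expanding the
objective to second order shows that the derivative of this map at `(x₀, x₀)` is the operator `D`
determined on the tangent space `T` of `M ∩ F⁻¹(K)` by `Q(D p, b) = W(p, b)`, where `Q` is the
(positive definite) Hessian on `T` of the subproblem's Lagrangian. On the diagonal,
`W((u, u), ·) - Q(u, ·)` is minus the Hessian of the Lagrangian of `f`. A direction `u` of quadratic
decrease of `f` lies in `T` and has `Q(u, u) < W((u, u), u)`; maximizing the Rayleigh quotient of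
the pencil `(W, Q)` over `T` then produces an eigenvalue of `p ↦ D (p, p)` exceeding `1`.
-/

open Asymptotics


section RealBounds

lemma coe_le_of_forall_le_coe {x : EReal} {c : ℝ} (h : ∀ α : ℝ, x ≤ α → c ≤ α) :
    (c : EReal) ≤ x :=
  EReal.le_of_forall_lt_iff_le.1 fun α hα => EReal.coe_le_coe (h α hα.le)

lemma exists_coe_eq_add_le_of_add_le_coe {x y : EReal} {a : ℝ} (hx : x ≠ ⊥) (hy : y ≠ ⊥)
    (h : x + y ≤ a) : ∃ α β : ℝ, x = α ∧ y = β ∧ α + β ≤ a := by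
  obtain ⟨hx', hy'⟩ := (EReal.add_ne_top_iff_ne_top₂ hx hy).1
    (ne_top_of_le_ne_top (EReal.coe_ne_top a) h)
  lift x to ℝ using ⟨hx', hx⟩
  lift y to ℝ using ⟨hy', hy⟩
  exact ⟨x, y, rfl, rfl, by exact_mod_cast h⟩

lemma le_coe_sub_of_add_coe_le {x : EReal} {q r : ℝ} (h : x + (r : EReal) ≤ (q : EReal)) :
    x ≤ ((q - r : ℝ) : EReal) := by
  rw [EReal.coe_sub]
  exact (EReal.le_sub_iff_add_le (.inl (EReal.coe_ne_bot r)) (.inl (EReal.coe_ne_top r))).2 h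

lemma le_of_forall_Ioo_le_add_mul {X Y β : ℝ} (h : ∀ t ∈ Set.Ioo (0 : ℝ) 1, X ≤ β + t * Y) :
    X ≤ β := by
  have hlim : Tendsto (fun t : ℝ => β + t * Y) (𝓝[>] 0) (𝓝 (β + 0 * Y)) :=
    (Continuous.tendsto (by fun_prop) 0).mono_left nhdsWithin_le_nhds
  simpa using ge_of_tendsto hlim
    (mem_of_superset (Ioo_mem_nhdsGT zero_lt_one) h)

lemma neg_sq_div_le_mul_sq_sub_mul {κ : ℝ} (hκ : 0 < κ) (b D : ℝ) :
    -(b ^ 2 / (2 * κ)) ≤ κ / 2 * D ^ 2 - b * D := by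
  have hsq : 0 ≤ (κ * D - b) ^ 2 / (2 * κ) := by positivity
  have hexp : (κ * D - b) ^ 2 / (2 * κ) = κ / 2 * D ^ 2 - b * D + b ^ 2 / (2 * κ) := by
    field_simp; ring
  linarith

end RealBounds

section WeakConvexity

variable {E : Type*} [NormedAddCommGroup E] [InnerProductSpace ℝ E]

lemma norm_convex_combo_sq (x y : E) {s t : ℝ} (hst : s + t = 1) :
    ‖s • x + t • y‖ ^ 2 = s * ‖x‖ ^ 2 + t * ‖y‖ ^ 2 - s * t * ‖x - y‖ ^ 2 := by
  obtain rfl : t = 1 - s := by linarith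
  rw [norm_add_sq_real, norm_sub_sq_real, norm_smul, norm_smul, mul_pow, mul_pow,
    real_inner_smul_left, real_inner_smul_right, Real.norm_eq_abs, Real.norm_eq_abs, sq_abs,
    sq_abs]
  ring

/-- `f + (ℓ/2) ‖·‖²` is convex, where `ℓ` may have any sign. This is expressed through real upper
bounds of the values of `f`, which keeps the arithmetic of `EReal` out of the arguments. -/
def ConvexUpTo (ℓ : ℝ) (f : E → EReal) : Prop :=
  ∀ ⦃x y : E⦄ ⦃a b s t : ℝ⦄, f x ≤ a → f y ≤ b → 0 ≤ s → 0 ≤ t → s + t = 1 →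
    f (s • x + t • y) ≤ ((s * a + t * b + ℓ / 2 * (s * t) * ‖x - y‖ ^ 2 : ℝ) : EReal)

lemma ExtConvex.le_combo {f : E → EReal} (hf : ExtConvex f) {x y : E} {a b s t : ℝ}
    (hx : f x ≤ a) (hy : f y ≤ b) (hs : 0 ≤ s) (ht : 0 ≤ t) (hst : s + t = 1) :
    f (s • x + t • y) ≤ ((s * a + t * b : ℝ) : EReal) := by
  refine (hf x y s t hs ht hst).trans ?_
  rw [EReal.coe_add, EReal.coe_mul, EReal.coe_mul]
  exact add_le_add (mul_le_mul_of_nonneg_left hx (by exact_mod_cast hs))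
    (mul_le_mul_of_nonneg_left hy (by exact_mod_cast ht))

lemma ExtConvex.convexUpTo {f : E → EReal} (hf : ExtConvex f) : ConvexUpTo 0 f := by
  intro x y a b s t hx hy hs ht hst
  simpa using hf.le_combo hx hy hs ht hst

lemma WeaklyConvex.convexUpTo {f : E → EReal} {ℓ : ℝ} (hf : WeaklyConvex ℓ f) :
    ConvexUpTo ℓ f := by
  intro x y a b s t hx hy hs ht hst
  have h := ExtConvex.le_combo hf (x := x) (y := y) (a := a + ℓ / 2 * ‖x‖ ^ 2)
    (b := b + ℓ / 2 * ‖y‖ ^ 2) (by rw [EReal.coe_add]; gcongr) (by rw [EReal.coe_add]; gcongr)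
    hs ht hst
  refine (le_coe_sub_of_add_coe_le h).trans (EReal.coe_le_coe (le_of_eq ?_))
  rw [norm_convex_combo_sq x y hst]; ring

namespace ConvexUpTo

lemma add {f g : E → EReal} {ℓ ℓ' : ℝ} (hf : ConvexUpTo ℓ f) (hg : ConvexUpTo ℓ' g)
    (hf' : ∀ x, f x ≠ ⊥) (hg' : ∀ x, g x ≠ ⊥) : ConvexUpTo (ℓ + ℓ') fun x => f x + g x := by
  intro x y a b s t hx hy hs ht hst
  obtain ⟨α, α', hα, hα', hle⟩ := exists_coe_eq_add_le_of_add_le_coe (hf' x) (hg' x) hx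
  obtain ⟨β, β', hβ, hβ', hle'⟩ := exists_coe_eq_add_le_of_add_le_coe (hf' y) (hg' y) hy
  refine (add_le_add (hf hα.le hβ.le hs ht hst) (hg hα'.le hβ'.le hs ht hst)).trans ?_
  rw [← EReal.coe_add]
  refine EReal.coe_le_coe ?_
  linarith [mul_le_mul_of_nonneg_left hle hs, mul_le_mul_of_nonneg_left hle' ht]

lemma quadratic (r : ℝ) (c : E) :
    ConvexUpTo (-(2 * r)) fun y => ((r * ‖y - c‖ ^ 2 : ℝ) : EReal) := by
  intro x y a b s t hx hy hs ht hst
  have hcombo : s • x + t • y - c = s • (x - c) + t • (y - c) := by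
    rw [smul_sub, smul_sub, sub_add_sub_comm, ← add_smul, hst, one_smul]
  have hsq := norm_convex_combo_sq (x - c) (y - c) hst
  rw [sub_sub_sub_cancel_right] at hsq
  refine EReal.coe_le_coe ?_
  rw [hcombo, hsq]
  linarith [mul_le_mul_of_nonneg_left (EReal.coe_le_coe_iff.1 hx) hs,
    mul_le_mul_of_nonneg_left (EReal.coe_le_coe_iff.1 hy) ht]

lemma comp_affine {E₂ : Type*} [NormedAddCommGroup E₂] [InnerProductSpace ℝ E₂]
    {h : E₂ → EReal} (hh : ConvexUpTo 0 h) (A : E →L[ℝ] E₂) (a : E₂) :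
    ConvexUpTo 0 fun y => h (a + A y) := by
  intro x y α β s t hx hy hs ht hst
  have hcombo : a + A (s • x + t • y) = s • (a + A x) + t • (a + A y) := by
    rw [map_add, map_smul, map_smul, smul_add, smul_add, add_add_add_comm, ← add_smul, hst,
      one_smul]
  beta_reduce
  rw [hcombo]
  simpa using hh hx hy hs ht hst

/-- The value at `x₀` drops by less than `1` on the ball of radius `r`, while strong convexity
makes it drop at least linearly on the way to a far away point of the sublevel set. -/
lemma norm_sub_le_of_le {ψ : E → EReal} {κ : ℝ} (hκ : 0 < κ) (hψ : ConvexUpTo (-κ) ψ)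
    {x₀ y : E} {v₀ r : ℝ} (hr : 0 < r) (hx₀ : ψ x₀ ≤ v₀)
    (hball : ∀ z, ‖z - x₀‖ < r → ((v₀ - 1 : ℝ) : EReal) < ψ z) (hy : ψ y ≤ v₀) :
    ‖y - x₀‖ ≤ max r (8 / (κ * r)) := by
  set D := ‖y - x₀‖ with hD
  by_contra! hlt
  obtain ⟨hrD, hκD⟩ := max_lt_iff.1 hlt
  have hD0 : 0 < D := hr.trans hrD
  set s := r / (2 * D) with hs
  have hs0 : 0 < s := by positivity
  have hs1 : s ≤ 1 / 2 := by
    rw [hs, div_le_div_iff₀ (by positivity) (by norm_num)]; linarith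
  have hsD : s * D = r / 2 := by rw [hs]; field_simp
  have hnear : ‖(1 - s) • x₀ + s • y - x₀‖ < r := by
    rw [show (1 - s) • x₀ + s • y - x₀ = s • (y - x₀) by module, norm_smul, Real.norm_eq_abs,
      abs_of_pos hs0, ← hD, hsD]
    linarith
  have hdrop := EReal.coe_lt_coe_iff.1 ((hball _ hnear).trans_le
    (hψ hx₀ hy (show 0 ≤ 1 - s by linarith) hs0.le (by ring)))
  rw [norm_sub_rev, ← hD] at hdrop
  have hquad : κ / 2 * ((1 - s) * s) * D ^ 2 = κ / 2 * (r / 2) * (1 - s) * D := by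
    rw [← hsD]; ring
  have hhalf : κ / 2 * (r / 2) * (1 / 2) * D ≤ κ / 2 * (r / 2) * (1 - s) * D := by
    gcongr; linarith
  rw [div_lt_iff₀ (by positivity)] at hκD
  linarith

lemma add_mul_sq_le_of_forall_le {ψ : E → EReal} {κ v : ℝ} {p : E} (hψ : ConvexUpTo (-κ) ψ)
    (hp : ψ p = v) (hmin : ∀ y, ψ p ≤ ψ y) (y : E) :
    ((v + κ / 2 * ‖y - p‖ ^ 2 : ℝ) : EReal) ≤ ψ y := by
  refine coe_le_of_forall_le_coe fun β hβ => ?_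
  refine le_of_forall_Ioo_le_add_mul (Y := κ / 2 * ‖y - p‖ ^ 2) fun t ht => ?_
  have hcombo := (hmin _).trans (hψ hp.le hβ (sub_nonneg.2 ht.2.le) ht.1.le (by ring))
  rw [hp, norm_sub_rev] at hcombo
  refine le_of_mul_le_mul_left ?_ ht.1
  linarith [EReal.coe_le_coe_iff.1 hcombo]

lemma exists_forall_add_mul_sq_le [FiniteDimensional ℝ E] {ψ : E → EReal} {κ : ℝ}
    (hκ : 0 < κ) (hψ : ConvexUpTo (-κ) ψ) (hlsc : LowerSemicontinuous ψ) (hbot : ∀ x, ψ x ≠ ⊥)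
    {x₀ : E} (hx₀ : ψ x₀ ≠ ⊤) :
    ∃ (p : E) (v : ℝ), ψ p = v ∧ ∀ y, ((v + κ / 2 * ‖y - p‖ ^ 2 : ℝ) : EReal) ≤ ψ y := by
  obtain ⟨v₀, hv₀⟩ : ∃ v₀ : ℝ, ψ x₀ = v₀ := ⟨_, (EReal.coe_toReal hx₀ (hbot x₀)).symm⟩
  obtain ⟨r, hr, hball⟩ : ∃ r > 0, ∀ y, ‖y - x₀‖ < r → ((v₀ - 1 : ℝ) : EReal) < ψ y := by
    have hlt : ((v₀ - 1 : ℝ) : EReal) < ψ x₀ := by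
      rw [hv₀]; exact_mod_cast sub_one_lt v₀
    obtain ⟨r, hr, h⟩ := Metric.eventually_nhds_iff.1 (hlsc x₀ _ hlt)
    exact ⟨r, hr, fun y hy => h (by rwa [dist_eq_norm])⟩
  have hcenter : x₀ ∈ Metric.closedBall x₀ (max r (8 / (κ * r))) :=
    Metric.mem_closedBall_self (hr.le.trans (le_max_left _ _))
  obtain ⟨p, -, hp⟩ := LowerSemicontinuousOn.exists_isMinOn ⟨x₀, hcenter⟩
    (isCompact_closedBall x₀ _) (hlsc.lowerSemicontinuousOn _)
  have hp₀ : ψ p ≤ v₀ := hv₀ ▸ hp hcenter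
  have hmin : ∀ y, ψ p ≤ ψ y := by
    intro y
    by_cases hy : ψ y ≤ v₀
    · refine hp ?_
      rw [Metric.mem_closedBall, dist_eq_norm]
      exact hψ.norm_sub_le_of_le hκ hr hv₀.le hball hy
    · exact hp₀.trans (not_le.1 hy).le
  have hv : ψ p = (ψ p).toReal :=
    (EReal.coe_toReal (ne_top_of_le_ne_top (EReal.coe_ne_top _) hp₀) (hbot p)).symm
  exact ⟨p, _, hv, hψ.add_mul_sq_le_of_forall_le hv hmin⟩

end ConvexUpTo

lemma lowerSemicontinuous_add_coe {α : Type*} [TopologicalSpace α] {f : α → EReal}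
    (hf : LowerSemicontinuous f) {q : α → ℝ} (hq : Continuous q) :
    LowerSemicontinuous fun x => f x + (q x : EReal) :=
  hf.add' (continuous_coe_real_ereal.comp hq).lowerSemicontinuous fun _ =>
    EReal.continuousAt_add (Or.inr (EReal.coe_ne_bot _)) (Or.inr (EReal.coe_ne_top _))

lemma mem_subdiff_of_forall_le {f : E → EReal} {x v : E} {a C : ℝ} (hx : f x = a)
    (h : ∀ y (b : ℝ), f y ≤ b → a + inner ℝ v (y - x) - C * ‖y - x‖ ^ 2 ≤ b) :
    v ∈ subdiff f x := by
  refine ⟨by simp [hx], by simp [hx], fun ε hε => ?_⟩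
  have hlim : Tendsto (fun y => C * ‖y - x‖) (𝓝 x) (𝓝 0) := by
    have : Tendsto (fun y => C * ‖y - x‖) (𝓝 x) (𝓝 (C * ‖x - x‖)) :=
      Continuous.tendsto (by fun_prop) x
    simpa using this
  filter_upwards [hlim.eventually (gt_mem_nhds hε)] with y hy
  rw [hx, ← EReal.coe_add]
  refine coe_le_of_forall_le_coe fun b hb => ?_
  nlinarith [h y b hb, mul_le_mul_of_nonneg_right hy.le (norm_nonneg (y - x))]

end WeakConvexity

section MoreauEnvelope

variable {E : Type*} [NormedAddCommGroup E] [InnerProductSpace ℝ E]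

lemma exists_proximalPoint [FiniteDimensional ℝ E] {f : E → EReal} {ℓ lam : ℝ}
    (hf : ConvexUpTo ℓ f) (hlsc : LowerSemicontinuous f) (hbot : ∀ x, f x ≠ ⊥)
    (hℓ : ℓ < lam⁻¹) {x₀ : E} (hx₀ : f x₀ ≠ ⊤) (x : E) :
    ∃ (p : E) (α : ℝ), f p = α ∧ moreauEnvelope lam f x = α + 1 / (2 * lam) * ‖p - x‖ ^ 2 ∧
      ∀ y (β : ℝ), f y ≤ β → moreauEnvelope lam f x + (lam⁻¹ - ℓ) / 2 * ‖y - p‖ ^ 2 ≤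
        β + 1 / (2 * lam) * ‖y - x‖ ^ 2 := by
  have hκ : 0 < lam⁻¹ - ℓ := sub_pos.2 hℓ
  have hconv : ConvexUpTo (-(lam⁻¹ - ℓ))
      fun y => f y + ((1 / (2 * lam) * ‖y - x‖ ^ 2 : ℝ) : EReal) := by
    convert! hf.add (ConvexUpTo.quadratic (1 / (2 * lam)) x) hbot
      (fun _ => EReal.coe_ne_bot _) using 1
    field_simp; ring
  obtain ⟨p, v, hv, hgrow⟩ := hconv.exists_forall_add_mul_sq_le hκ
    (lowerSemicontinuous_add_coe hlsc (by fun_prop))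
    (fun y => EReal.add_ne_bot_iff.2 ⟨hbot y, EReal.coe_ne_bot _⟩)
    (x₀ := x₀) (EReal.add_ne_top hx₀ (EReal.coe_ne_top _))
  have henv : moreauEnvelope lam f x = v := by
    have hinf : (⨅ y : E, f y + ((1 / (2 * lam) * ‖y - x‖ ^ 2 : ℝ) : EReal)) = (v : EReal) := by
      refine le_antisymm ((iInf_le _ p).trans hv.le) (le_iInf fun y => ?_)
      exact (EReal.coe_le_coe (le_add_of_nonneg_right (by positivity))).trans (hgrow y)
    rw [moreauEnvelope, hinf, EReal.toReal_coe]
  obtain ⟨α, -, hα, -, -⟩ :=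
    exists_coe_eq_add_le_of_add_le_coe (hbot p) (EReal.coe_ne_bot _) hv.le
  refine ⟨p, α, hα, ?_, fun y β hβ => ?_⟩
  · rw [hα] at hv
    rw [henv]
    exact_mod_cast hv.symm
  · rw [henv]
    have hle := (hgrow y).trans (add_le_add_left hβ _)
    exact_mod_cast hle

lemma abs_moreauEnvelope_sub_le {x₀ x p₀ p : E} {e₀ e α₀ α lam κ : ℝ} (hlam : 0 < lam)
    (hκ : 0 < κ) (he₀ : e₀ = α₀ + 1 / (2 * lam) * ‖p₀ - x₀‖ ^ 2)
    (he : e = α + 1 / (2 * lam) * ‖p - x‖ ^ 2)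
    (hup : e ≤ α₀ + 1 / (2 * lam) * ‖p₀ - x‖ ^ 2)
    (hlow : e₀ + κ / 2 * ‖p - p₀‖ ^ 2 ≤ α + 1 / (2 * lam) * ‖p - x₀‖ ^ 2) :
    |e - e₀ - inner ℝ (lam⁻¹ • (x₀ - p₀)) (x - x₀)| ≤
      (1 / (2 * lam) + lam⁻¹ ^ 2 / (2 * κ)) * ‖x - x₀‖ ^ 2 := by
  have hshift : ∀ q : E, 1 / (2 * lam) * ‖q - x‖ ^ 2 = 1 / (2 * lam) * ‖q - x₀‖ ^ 2
      - lam⁻¹ * inner ℝ (q - x₀) (x - x₀) + 1 / (2 * lam) * ‖x - x₀‖ ^ 2 := by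
    intro q
    rw [show q - x = (q - x₀) - (x - x₀) by abel, norm_sub_sq_real (q - x₀)]
    field_simp
  have hslope : inner ℝ (lam⁻¹ • (x₀ - p₀)) (x - x₀) =
      -(lam⁻¹ * inner ℝ (p₀ - x₀) (x - x₀)) := by
    rw [real_inner_smul_left, ← neg_sub p₀ x₀, inner_neg_left, mul_neg]
  have hsplit : inner ℝ (p - x₀) (x - x₀) =
      inner ℝ (p - p₀) (x - x₀) + inner ℝ (p₀ - x₀) (x - x₀) := by
    rw [← inner_add_left, sub_add_sub_cancel]
  have hyoung := neg_sq_div_le_mul_sq_sub_mul hκ (lam⁻¹ * ‖x - x₀‖) ‖p - p₀‖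
  have hcs := mul_le_mul_of_nonneg_left (real_inner_le_norm (p - p₀) (x - x₀))
    (inv_pos.2 hlam).le
  have hq₀ := hshift p₀
  have hq := hshift p
  rw [hsplit, mul_add] at hq
  have hpos₁ : 0 ≤ lam⁻¹ ^ 2 / (2 * κ) * ‖x - x₀‖ ^ 2 := by positivity
  have hpos₂ : 0 ≤ 1 / (2 * lam) * ‖x - x₀‖ ^ 2 := by positivity
  have hpow : (lam⁻¹ * ‖x - x₀‖) ^ 2 / (2 * κ) = lam⁻¹ ^ 2 / (2 * κ) * ‖x - x₀‖ ^ 2 := by ring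
  rw [abs_le, hslope, add_mul]
  constructor <;> linarith

variable [FiniteDimensional ℝ E]

lemma exists_hasGradientAt_moreauEnvelope {f : E → EReal} {ℓ lam : ℝ}
    (hf : ConvexUpTo ℓ f) (hlsc : LowerSemicontinuous f) (hbot : ∀ x, f x ≠ ⊥)
    (hlam : 0 < lam) (hℓ : ℓ < lam⁻¹) {x₀ : E} (hx₀ : f x₀ ≠ ⊤) (x : E) :
    ∃ (p : E) (α : ℝ), f p = α ∧
      HasGradientAt (moreauEnvelope lam f) (lam⁻¹ • (x - p)) x ∧
      ∀ y (β : ℝ), f y ≤ β →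
        α + 1 / (2 * lam) * ‖p - x‖ ^ 2 ≤ β + 1 / (2 * lam) * ‖y - x‖ ^ 2 := by
  choose p α hα henv hgrow using exists_proximalPoint hf hlsc hbot hℓ hx₀
  have hκ : 0 < lam⁻¹ - ℓ := sub_pos.2 hℓ
  have hmin : ∀ x y (β : ℝ), f y ≤ β →
      moreauEnvelope lam f x ≤ β + 1 / (2 * lam) * ‖y - x‖ ^ 2 := fun x y β hβ =>
    (le_add_of_nonneg_right (by positivity)).trans (hgrow x y β hβ)
  refine ⟨p x, α x, hα x, ?_, fun y β hβ => henv x ▸ hmin x y β hβ⟩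
  have hbound : ∀ y, ‖moreauEnvelope lam f y - moreauEnvelope lam f x
      - inner ℝ (lam⁻¹ • (x - p x)) (y - x)‖ ≤
        (1 / (2 * lam) + lam⁻¹ ^ 2 / (2 * (lam⁻¹ - ℓ))) * ‖‖y - x‖ ^ 2‖ := by
    intro y
    rw [Real.norm_eq_abs, Real.norm_of_nonneg (sq_nonneg ‖y - x‖)]
    exact abs_moreauEnvelope_sub_le hlam hκ (henv x) (henv y) (hmin y _ _ (hα x).le)
      (hgrow x _ _ (hα y).le)
  rw [hasGradientAt_iff_isLittleO]
  exact (IsBigO.of_bound _ (Eventually.of_forall hbound)).trans_isLittleO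
    ((isLittleO_norm_pow_id one_lt_two).comp_tendsto (tendsto_sub_nhds_zero_iff.2 tendsto_id))

lemma isCriticalPoint_of_gradient_moreauEnvelope_eq_zero {f : E → EReal} {ℓ lam : ℝ}
    (hf : ConvexUpTo ℓ f) (hlsc : LowerSemicontinuous f) (hbot : ∀ x, f x ≠ ⊥)
    (hlam : 0 < lam) (hℓ : ℓ < lam⁻¹) {x₀ : E} (hx₀ : f x₀ ≠ ⊤)
    (hgrad : gradient (moreauEnvelope lam f) x₀ = 0) : IsCriticalPoint f x₀ := by
  obtain ⟨p, α, hα, hp, hmin⟩ :=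
    exists_hasGradientAt_moreauEnvelope hf hlsc hbot hlam hℓ hx₀ x₀
  obtain rfl : x₀ = p := by
    rw [hp.gradient, smul_eq_zero] at hgrad
    exact sub_eq_zero.1 (hgrad.resolve_left (inv_pos.2 hlam).ne')
  refine mem_subdiff_of_forall_le (C := 1 / (2 * lam)) hα fun y β hβ => ?_
  have := hmin y β hβ
  rw [sub_self, norm_zero] at this
  rw [inner_zero_left]
  linarith

end MoreauEnvelope

section Calculus

variable {E F Z X : Type*} [NormedAddCommGroup E] [NormedSpace ℝ E]
  [NormedAddCommGroup F] [NormedSpace ℝ F] [NormedAddCommGroup Z] [NormedSpace ℝ Z]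
  [NormedAddCommGroup X] [NormedSpace ℝ X]

lemma isLittleO_taylor_two {f : E → F} {x₀ : E} (hf : ContDiffAt ℝ 2 f x₀) :
    (fun x => f x - f x₀ - fderiv ℝ f x₀ (x - x₀)
      - (1 / 2 : ℝ) • fderiv ℝ (fderiv ℝ f) x₀ (x - x₀) (x - x₀)) =o[𝓝 x₀]
      fun x => ‖x - x₀‖ ^ 2 := by
  have hsymm : IsSymmSndFDerivAt ℝ f x₀ := hf.isSymmSndFDerivAt (by simp)
  have hev : ∀ᶠ x in 𝓝 x₀, DifferentiableAt ℝ f x := by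
    filter_upwards [hf.eventually (by simp)] with x hx using hx.differentiableAt (by simp)
  obtain ⟨r, hr, hball⟩ := Metric.eventually_nhds_iff_ball.1 hev
  set B := fderiv ℝ (fderiv ℝ f) x₀
  have hB : HasFDerivAt (fderiv ℝ f) B x₀ :=
    ((hf.fderiv_right (m := 1) (by norm_num)).differentiableAt (by simp)).hasFDerivAt
  have hmvt := (convex_ball x₀ r).isLittleO_pow_succ (n := 1)
    (f := fun x => f x - fderiv ℝ f x₀ (x - x₀) - (1 / 2 : ℝ) • B (x - x₀) (x - x₀))
    (f' := fun x => fderiv ℝ f x - fderiv ℝ f x₀ - B (x - x₀))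
    (Metric.mem_ball_self hr) (fun x hx => ?_) ?_
  · rw [nhdsWithin_eq_nhds.2 (Metric.ball_mem_nhds x₀ hr)] at hmvt
    refine hmvt.congr_left fun x => ?_
    simp only [sub_self, map_zero, smul_zero, sub_zero]
    abel
  · have hshift : HasFDerivAt (fun x => x - x₀) (ContinuousLinearMap.id ℝ E) x :=
      (hasFDerivAt_id x).sub_const x₀
    have hlin := (fderiv ℝ f x₀).hasFDerivAt.comp x hshift
    have hquad := ((B.hasFDerivAt.comp x hshift).clm_apply hshift).const_smul (1 / 2 : ℝ)
    refine HasFDerivAt.hasFDerivWithinAt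
      ((((hball x hx).hasFDerivAt.sub hlin).sub hquad).congr_fderiv ?_)
    ext v
    simp only [sub_apply, ContinuousLinearMap.comp_apply, smul_apply, add_apply,
      ContinuousLinearMap.flip_apply, ContinuousLinearMap.id_apply, Function.comp_apply]
    rw [show B v (x - x₀) = B (x - x₀) v from hsymm v (x - x₀), ← two_smul ℝ, smul_smul]
    norm_num
  · rw [nhdsWithin_eq_nhds.2 (Metric.ball_mem_nhds x₀ hr)]
    simpa using hB.isLittleO.norm_right

lemma exists_implicit_solution [CompleteSpace X] [CompleteSpace Z]
    {Ψ : X × Z → Z} {Ψ' : X × Z →L[ℝ] Z} {x₀ : X} {s₀ : Z}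
    (hΨ : HasStrictFDerivAt Ψ Ψ' (x₀, s₀))
    (h0 : Ψ (x₀, s₀) = 0) (hid : ∀ s, Ψ' (0, s) = s) :
    ∃ σ : X → Z, σ x₀ = s₀ ∧ HasFDerivAt σ (-(Ψ' ∘L .inl ℝ X Z)) x₀ ∧
      ∀ᶠ x in 𝓝 x₀, Ψ (x, σ x) = 0 := by
  have hpart : Ψ' ∘L .inr ℝ X Z = ContinuousLinearMap.id ℝ Z := by
    ext s; simp [hid]
  have hinv : (Ψ' ∘L .inr ℝ X Z).IsInvertible := by
    rw [hpart]; exact ContinuousLinearMap.isInvertible_equiv (f := .refl ℝ Z)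
  refine ⟨hΨ.implicitFunctionOfProdDomain hinv, ?_, ?_, ?_⟩
  · exact (hΨ.eventually_apply_eq_iff_implicitFunctionOfProdDomain hinv).self_of_nhds.mp rfl
  · have := (hΨ.hasStrictFDerivAt_implicitFunctionOfProdDomain hinv).hasFDerivAt
    convert! this using 1
    rw [hpart, ContinuousLinearMap.inverse_id]
    ext; simp
  · simpa [h0] using hΨ.eventually_apply_implicitFunctionOfProdDomain hinv

/-- Parametrize the second argument by `y₀ + b (x - x₀) + ρ s`, for a right inverse `ρ` of the
partial derivative in this argument, and solve for `s`. -/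
lemma exists_implicit_solution_tangent [CompleteSpace X] [FiniteDimensional ℝ Z] {Ψ : X × E → Z}
    {Ψ' : X × E →L[ℝ] Z} {x₀ : X} {y₀ : E} (hΨ : HasStrictFDerivAt Ψ Ψ' (x₀, y₀))
    (h0 : Ψ (x₀, y₀) = 0) (hsurj : Function.Surjective (Ψ' ∘L .inr ℝ X E)) (b : X →L[ℝ] E) :
    ∃ (Y : X → E) (Y' : X →L[ℝ] E), Y x₀ = y₀ ∧ HasFDerivAt Y Y' x₀ ∧
      (∀ ξ, Ψ' (ξ, b ξ) = 0 → Y' ξ = b ξ) ∧ ∀ᶠ x in 𝓝 x₀, Ψ (x, Y x) = 0 := by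
  have : CompleteSpace Z := FiniteDimensional.complete ℝ Z
  obtain ⟨ρ, hρ⟩ := ContinuousLinearMap.exists_rightInverse_of_surjective _
    (LinearMap.range_eq_top.2 hsurj)
  have hρ' : ∀ s, Ψ' (0, ρ s) = s := fun s => DFunLike.congr_fun hρ s
  let i : X × Z →L[ℝ] X × E := (ContinuousLinearMap.fst ℝ X Z).prod (b.coprod ρ)
  have hi : ∀ x s, i (x, s) = (x, b x + ρ s) := fun x s => rfl
  have hbase : (0, y₀ - b x₀) + i (x₀, 0) = (x₀, y₀) := by simp [hi]
  have hcomp : HasStrictFDerivAt (fun q => Ψ ((0, y₀ - b x₀) + i q)) (Ψ' ∘L i) (x₀, 0) :=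
    HasStrictFDerivAt.comp (x₀, 0) (by rwa [hbase]) (i.hasStrictFDerivAt.const_add _)
  obtain ⟨σ, hσ0, hσ, hsol⟩ := exists_implicit_solution hcomp (by rw [hbase, h0])
    (fun s => by simp [hi, hρ'])
  refine ⟨fun x => y₀ - b x₀ + (b x + ρ (σ x)), b + ρ ∘L (-((Ψ' ∘L i) ∘L .inl ℝ X Z)),
    by simp [hσ0], (b.hasFDerivAt.add (ρ.hasFDerivAt.comp x₀ hσ)).const_add _,
    fun ξ hξ => by simp [hi, hξ], ?_⟩
  simpa [hi] using hsol

lemma exists_curve_in_zeroSet [FiniteDimensional ℝ Z] {G : E → Z} {G' : E →L[ℝ] Z} {x u : E}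
    (hG : HasStrictFDerivAt G G' x) (hG0 : G x = 0) (hsurj : Function.Surjective G')
    (hu : G' u = 0) :
    ∃ c : ℝ → E, c 0 = x ∧ HasDerivAt c u 0 ∧ ∀ᶠ t in 𝓝 0, G (c t) = 0 := by
  have hΨ : HasStrictFDerivAt (fun q : ℝ × E => G q.2) (G' ∘L .snd ℝ ℝ E) (0, x) :=
    HasStrictFDerivAt.comp (0, x) hG hasStrictFDerivAt_snd
  obtain ⟨c, c', hc0, hc, htan, hsol⟩ := exists_implicit_solution_tangent hΨ hG0
    (by simpa [ContinuousLinearMap.comp_assoc] using hsurj) (.toSpanSingleton ℝ u)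
  refine ⟨c, hc0, ?_, hsol⟩
  have hc1 : c' 1 = u := by simpa using htan 1 (by simpa using hu)
  simpa [hc1] using hc.hasDerivAt

end Calculus

section LocalEquation

variable {E : Type*} [NormedAddCommGroup E] [InnerProductSpace ℝ E]

/-- A local description of `M` and `f` at `x ∈ M`: near `x`, the set `M` is the regular zero set of
the `C²` map `G`, and `f` agrees on `M` with the `C²` function `φ`. -/
structure IsLocalModel {k : ℕ} (f : E → EReal) (M : Set E) (x : E)
    (G : E → EuclideanSpace ℝ (Fin k)) (φ : E → ℝ) : Prop where
  contDiffAt_constraint : ContDiffAt ℝ 2 G x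
  surjective : Function.Surjective (fderiv ℝ G x)
  eq_zero : G x = 0
  contDiffAt : ContDiffAt ℝ 2 φ x
  mem_iff : ∀ᶠ y in 𝓝 x, y ∈ M ↔ G y = 0
  eq_on : ∀ᶠ y in 𝓝 x, G y = 0 → f y = φ y

lemma exists_isLocalModel {f : E → EReal} {M U : Set E} {x : E} (hx : x ∈ M) (hU : IsOpen U)
    (hxU : x ∈ U) (hM : IsSmoothManifold 2 (M ∩ U)) (hf : IsSmoothAlong 2 f (M ∩ U)) :
    ∃ (k : ℕ) (G : E → EuclideanSpace ℝ (Fin k)) (φ : E → ℝ), IsLocalModel f M x G φ := by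
  obtain ⟨k, W, G, hW, hxW, hG, hsurj, hMW⟩ := hM x ⟨hx, hxU⟩
  obtain ⟨W', φ, hW', hxW', hφ, hfφ⟩ := hf x ⟨hx, hxU⟩
  have hmem : ∀ y ∈ U, y ∈ W → (y ∈ M ↔ G y = 0) := by
    intro y hyU hyW
    have := Set.ext_iff.1 hMW y
    simp only [Set.mem_inter_iff, Set.mem_ofPred_eq, hyU, hyW, and_true, true_and] at this
    exact this
  refine ⟨k, G, φ, hG.contDiffAt (hW.mem_nhds hxW), hsurj, (hmem x hxU hxW).1 hx,
    hφ.contDiffAt (hW'.mem_nhds hxW'), ?_, ?_⟩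
  · filter_upwards [hU.mem_nhds hxU, hW.mem_nhds hxW] with y hyU hyW using hmem y hyU hyW
  · filter_upwards [hU.mem_nhds hxU, hW.mem_nhds hxW, hW'.mem_nhds hxW'] with y hyU hyW hyW' hy
    exact hfφ y ⟨⟨(hmem y hyU hyW).2 hy, hyU⟩, hyW'⟩

lemma inner_le_of_mem_subdiff {f : E → EReal} {c : ℝ → E} {b : ℝ → ℝ} {w c' : E} {b' : ℝ}
    (hw : w ∈ subdiff f (c 0)) (hc : HasDerivAt c c' 0) (hb : HasDerivAt b b' 0)
    (h0 : f (c 0) = b 0) (hle : ∀ᶠ t in 𝓝[>] 0, f (c t) ≤ b t) : inner ℝ w c' ≤ b' := by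
  have hslope : ∀ ε : ℝ, 0 < ε → inner ℝ w c' - ε * ‖c'‖ ≤ b' := by
    intro ε hε
    have hcs := hc.tendsto_slope_zero_right
    refine le_of_tendsto_of_tendsto ((tendsto_const_nhds.inner hcs).sub
      (tendsto_const_nhds.mul hcs.norm)) hb.tendsto_slope_zero_right ?_
    have hsub := hc.continuousAt.tendsto.eventually (hw.2.2 ε hε)
    filter_upwards [hsub.filter_mono nhdsWithin_le_nhds, hle, self_mem_nhdsWithin]
      with t hlow hup ht
    have ht : 0 < t := ht
    have hle := hlow.trans hup
    rw [h0, ← EReal.coe_add, EReal.coe_le_coe_iff] at hle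
    simp only [zero_add, smul_eq_mul]
    calc inner ℝ w (t⁻¹ • (c t - c 0)) - ε * ‖t⁻¹ • (c t - c 0)‖
        = t⁻¹ * (inner ℝ w (c t - c 0) - ε * ‖c t - c 0‖) := by
          rw [norm_smul, real_inner_smul_right, Real.norm_of_nonneg (inv_pos.2 ht).le]; ring
      _ ≤ t⁻¹ * (b t - b 0) :=
          mul_le_mul_of_nonneg_left (le_sub_iff_add_le'.2 hle) (inv_pos.2 ht).le
  refine le_of_forall_Ioo_le_add_mul (Y := ‖c'‖) fun t ht => ?_
  linarith [hslope t ht.1]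

namespace IsLocalModel

variable {k : ℕ} {f : E → EReal} {M : Set E} {x : E} {G : E → EuclideanSpace ℝ (Fin k)}
  {φ : E → ℝ}

lemma apply_self (h : IsLocalModel f M x G φ) : f x = φ x := h.eq_on.self_of_nhds h.eq_zero

lemma hasStrictFDerivAt (h : IsLocalModel f M x G φ) :
    HasStrictFDerivAt G (fderiv ℝ G x) x := h.contDiffAt_constraint.hasStrictFDerivAt (by simp)

lemma hasFDerivAt (h : IsLocalModel f M x G φ) : HasFDerivAt φ (fderiv ℝ φ x) x :=
  (h.contDiffAt.differentiableAt (by simp)).hasFDerivAt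

lemma fderiv_eq_zero_of_mem_tangentConeAt (h : IsLocalModel f M x G φ) {u : E}
    (hu : u ∈ tangentConeAt ℝ M x) : fderiv ℝ G x u = 0 := by
  rcases exists_fun_of_mem_tangentConeAt hu with ⟨ι, l, hl, c, d, hd₀, hds, hcd⟩
  have hlim := (h.hasStrictFDerivAt.hasFDerivAt.hasFDerivWithinAt (s := M)).lim hd₀ hds hcd
  have hxd : Tendsto (fun n => x + d n) l (𝓝 x) := by simpa using tendsto_const_nhds.add hd₀
  refine tendsto_nhds_unique hlim (Tendsto.congr' ?_ tendsto_const_nhds)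
  filter_upwards [hxd.eventually h.mem_iff, hds] with n hiff hmem
  simp [hiff.1 hmem, h.eq_zero]

lemma exists_curve (h : IsLocalModel f M x G φ) {u : E} (hu : fderiv ℝ G x u = 0) :
    ∃ c : ℝ → E, c 0 = x ∧ HasDerivAt c u 0 ∧ HasDerivAt (φ ∘ c) (fderiv ℝ φ x u) 0 ∧
      ∀ᶠ t in 𝓝 0, c t ∈ M ∧ f (c t) = φ (c t) := by
  obtain ⟨c, rfl, hc, hcG⟩ :=
    exists_curve_in_zeroSet h.hasStrictFDerivAt h.eq_zero h.surjective hu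
  refine ⟨c, rfl, hc, h.hasFDerivAt.comp_hasDerivAt 0 hc, ?_⟩
  have hct : Tendsto c (𝓝 0) (𝓝 (c 0)) := hc.continuousAt.tendsto
  filter_upwards [hcG, hct.eventually h.mem_iff, hct.eventually h.eq_on] with t hG hmem heq
    using ⟨hmem.2 hG, heq hG⟩

lemma inner_le_fderiv (h : IsLocalModel f M x G φ) {w a : E} (hw : w ∈ subdiff f x)
    (ha : fderiv ℝ G x a = 0) : inner ℝ w a ≤ fderiv ℝ φ x a := by
  obtain ⟨c, rfl, hc, hφc, hcM⟩ := h.exists_curve ha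
  refine inner_le_of_mem_subdiff hw hc hφc h.apply_self ?_
  exact (hcM.filter_mono nhdsWithin_le_nhds).mono fun t ht => ht.2.le

lemma fderiv_eq_inner (h : IsLocalModel f M x G φ) {w a : E} (hw : w ∈ subdiff f x)
    (ha : fderiv ℝ G x a = 0) : fderiv ℝ φ x a = inner ℝ w a := by
  refine le_antisymm ?_ (h.inner_le_fderiv hw ha)
  have := h.inner_le_fderiv hw (a := -a) (by rw [map_neg, ha, neg_zero])
  rw [inner_neg_right, map_neg] at this
  linarith

/-- Adding to `φ` a linear function of `G` does not change it on `M`. -/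
lemma exists_fderiv_eq (h : IsLocalModel f M x G φ) {w : E} (hw : w ∈ subdiff f x) :
    ∃ φ' : E → ℝ, IsLocalModel f M x G φ' ∧ fderiv ℝ φ' x = innerSL ℝ w := by
  obtain ⟨ρ, hρ⟩ := (fderiv ℝ G x).exists_rightInverse_of_surjective
    (LinearMap.range_eq_top.2 h.surjective)
  have hρ' : ∀ s, fderiv ℝ G x (ρ s) = s := fun s => DFunLike.congr_fun hρ s
  set Λ : EuclideanSpace ℝ (Fin k) →L[ℝ] ℝ := (fderiv ℝ φ x - innerSL ℝ w) ∘L ρ with hΛ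
  have hd : HasFDerivAt (fun y => φ y - Λ (G y)) (fderiv ℝ φ x - Λ ∘L fderiv ℝ G x) x :=
    h.hasFDerivAt.sub (Λ.hasFDerivAt.comp x h.hasStrictFDerivAt.hasFDerivAt)
  refine ⟨fun y => φ y - Λ (G y), ⟨h.contDiffAt_constraint, h.surjective, h.eq_zero,
    h.contDiffAt.sub (Λ.contDiff.contDiffAt.comp x h.contDiffAt_constraint), h.mem_iff, ?_⟩, ?_⟩
  · filter_upwards [h.eq_on] with y hy h0
    rw [hy h0, h0]; simp
  · rw [hd.fderiv]
    ext a
    have := h.fderiv_eq_inner hw (a := a - ρ (fderiv ℝ G x a)) (by simp [hρ'])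
    simp only [map_sub, inner_sub_right] at this
    simp only [hΛ, sub_apply, ContinuousLinearMap.comp_apply,
      innerSL_apply_apply]
    linarith

end IsLocalModel

lemma subderiv_restrictTo_le {k : ℕ} {f : E → EReal} {M : Set E} {x : E}
    {G : E → EuclideanSpace ℝ (Fin k)} {φ : E → ℝ} (h : IsLocalModel f M x G φ) {u : E}
    (hu : fderiv ℝ G x u = 0) : subderiv (restrictTo f M) x u ≤ (fderiv ℝ φ x u : ℝ) := by
  obtain ⟨c, rfl, hc, hφc, hcM⟩ := h.exists_curve hu
  have hx : c 0 ∈ M := h.mem_iff.self_of_nhds.2 h.eq_zero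
  have harc : Tendsto (fun t : ℝ => (t, t⁻¹ • (c (0 + t) - c 0))) (𝓝[>] 0)
      (𝓝[>] 0 ×ˢ 𝓝 u) := tendsto_id.prodMk hc.tendsto_slope_zero_right
  have hlim : Tendsto (fun t : ℝ => ((t⁻¹ • (φ (c (0 + t)) - φ (c 0)) : ℝ) : EReal)) (𝓝[>] 0)
      (𝓝 ((fderiv ℝ φ (c 0) u : ℝ) : EReal)) :=
    (continuous_coe_real_ereal.tendsto _).comp hφc.tendsto_slope_zero_right
  refine (liminf_le_liminf_of_le harc).trans (le_of_eq ?_)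
  rw [← Filter.liminf_comp]
  refine (Filter.liminf_congr ?_).trans hlim.liminf_eq
  filter_upwards [hcM.filter_mono nhdsWithin_le_nhds, self_mem_nhdsWithin] with t hM ht
  have hct : c 0 + t • t⁻¹ • (c t - c 0) = c t := by
    rw [smul_smul, mul_inv_cancel₀ (ne_of_gt ht), one_smul, add_sub_cancel]
  have hrestr : restrictTo f M (c t) = φ (c t) := (if_pos hM.1).trans hM.2
  have hrestr₀ : restrictTo f M (c 0) = φ (c 0) := (if_pos hx).trans h.apply_self
  simp only [Function.comp_apply, zero_add, hct, hrestr, hrestr₀, smul_eq_mul]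
  push_cast
  rfl

lemma le_coe_add_div_of_mul_sub_lt {X D : EReal} {a b s t : ℝ} (hs : 0 < s) (ht : 0 ≤ t)
    (hD : D ≤ 0) (h : (s : EReal) * (X - a - t * D) < b) : X ≤ ((a + b / s : ℝ) : EReal) := by
  have hquot : X - a - t * D ≤ ((b / s : ℝ) : EReal) := by
    generalize X - a - t * D = Y at h
    induction Y with
    | bot => exact bot_le
    | top => simp [EReal.coe_mul_top_of_pos hs] at h
    | coe r =>
      rw [← EReal.coe_mul, EReal.coe_lt_coe_iff] at h
      exact EReal.coe_le_coe ((le_div_iff₀' hs).2 h.le)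
  have hdrop : X - a ≤ X - a - t * D := by
    rw [sub_eq_add_neg (X - a)]
    refine le_add_of_nonneg_right (EReal.neg_nonneg.2 ?_)
    exact mul_nonpos_of_nonneg_of_nonpos (by exact_mod_cast ht) hD
  have hX := hdrop.trans hquot
  rw [sub_eq_add_neg, ← EReal.coe_neg] at hX
  convert! le_coe_sub_of_add_coe_le hX using 2
  ring

lemma tendsto_smul_parabola (u w : E) :
    Tendsto (fun q : ℝ × E => (q.1, u + (q.1 / 2) • q.2)) (𝓝[>] (0 : ℝ) ×ˢ 𝓝 w)
      (𝓝[>] (0 : ℝ) ×ˢ 𝓝 u) := by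
  have hlim : Tendsto (fun q : ℝ × E => u + (q.1 / 2) • q.2) (𝓝 0 ×ˢ 𝓝 w) (𝓝 u) := by
    rw [← nhds_prod_eq]
    have : Tendsto (fun q : ℝ × E => u + (q.1 / 2) • q.2) (𝓝 (0, w))
        (𝓝 (u + ((0 : ℝ) / 2) • w)) := Continuous.tendsto (by fun_prop) (0, w)
    simpa using this
  exact tendsto_fst.prodMk (hlim.mono_left (prod_mono_left _ nhdsWithin_le_nhds))

lemma le_restrictTo {X : Type*} (f : X → EReal) (M : Set X) (y : X) : f y ≤ restrictTo f M y := by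
  rw [restrictTo]
  split_ifs
  exacts [le_rfl, le_top]

lemma IsStrictSaddle.exists_frequently_le {f : E → EReal} {x : E} (h : IsStrictSaddle f x) :
    ∃ (u : E) (a c : ℝ), f x = a ∧ 0 < c ∧ ∃ᶠ q : ℝ × E in 𝓝[>] (0 : ℝ) ×ˢ 𝓝 u,
      f (x + q.1 • q.2) ≤ ((a - c * q.1 ^ 2 : ℝ) : EReal) := by
  obtain ⟨hcrit, M, ⟨hxM, U, hU, hxU, hM, hfM, -⟩, u, huM, hneg⟩ := h
  obtain ⟨k, G, φ, hmod⟩ := exists_isLocalModel hxM hU hxU hM hfM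
  have hsub : subderiv (restrictTo f M) x u ≤ 0 := by
    have hu := hmod.fderiv_eq_zero_of_mem_tangentConeAt huM
    have hle := subderiv_restrictTo_le hmod hu
    rwa [hmod.fderiv_eq_inner hcrit hu, inner_zero_left] at hle
  obtain ⟨w, hw⟩ := iInf_lt_iff.1 hneg
  obtain ⟨b, hwb, hb⟩ := EReal.lt_iff_exists_real_btwn.1 hw
  have hb0 : b < 0 := by exact_mod_cast hb
  have hfreq := frequently_lt_of_liminf_lt (by isBoundedDefault) hwb
  have hpos : ∀ᶠ q : ℝ × E in 𝓝[>] (0 : ℝ) ×ˢ 𝓝 w, 0 < q.1 :=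
    tendsto_fst.eventually self_mem_nhdsWithin
  refine ⟨u, φ x, -b / 2, hmod.apply_self, by linarith, ?_⟩
  refine (tendsto_smul_parabola u w).frequently ((hfreq.and_eventually hpos).mono ?_)
  rintro ⟨t, w'⟩ ⟨hquot, ht : 0 < t⟩
  have hpoint : x + t • (u + (t / 2) • w') = x + t • u + (t ^ 2 / 2) • w' := by module
  have hx : restrictTo f M x = φ x := by rw [restrictTo, if_pos hxM, hmod.apply_self]
  rw [hx] at hquot
  refine (le_restrictTo f M _).trans ?_
  rw [hpoint]
  convert! le_coe_add_div_of_mul_sub_lt (by positivity) ht.le hsub hquot using 2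
  field_simp
  ring

end LocalEquation

section Duality

variable {E E₂ : Type*} [NormedAddCommGroup E] [InnerProductSpace ℝ E]
  [NormedAddCommGroup E₂] [InnerProductSpace ℝ E₂]

lemma norm_mul_le_of_forall_inner_le {z : E} {r c : ℝ} (hr : 0 < r)
    (h : ∀ e : E, ‖e‖ < r → inner ℝ z e ≤ c) : ‖z‖ * r ≤ c := by
  rcases eq_or_ne z 0 with rfl | hz
  · simpa using h 0 (by simpa using hr)
  have hz0 : 0 < ‖z‖ := norm_pos_iff.2 hz
  refine le_of_forall_Ioo_le_add_mul (Y := ‖z‖ * r) fun t ht => ?_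
  have ht1 : 0 < 1 - t := sub_pos.2 ht.2
  have hle := h (((1 - t) * r / ‖z‖) • z) (by
    rw [norm_smul, Real.norm_of_nonneg (by positivity), div_mul_cancel₀ _ hz0.ne']
    linarith [mul_pos ht.1 hr])
  rw [real_inner_smul_right, real_inner_self_eq_norm_sq] at hle
  have : (1 - t) * r / ‖z‖ * ‖z‖ ^ 2 = (1 - t) * r * ‖z‖ := by field_simp
  linarith

/-- A separating functional is not vertical since it is bounded above on a product with a half
line, so it can be normalized to slope `-1` in the last coordinate. -/
lemma exists_add_inner_le_of_convex [CompleteSpace E] {S : Set (E × ℝ)} (hS : Convex ℝ S)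
    {v r C : ℝ} (hr : 0 < r) (hball : Metric.ball 0 r ×ˢ Set.Ioi C ⊆ S)
    (hv : ((0 : E), v) ∉ S) : ∃ z : E, ∀ q ∈ S, v + inner ℝ z q.1 ≤ q.2 := by
  have hopen : Metric.ball (0 : E) r ×ˢ Set.Ioi C ⊆ interior S :=
    interior_maximal hball (Metric.isOpen_ball.prod isOpen_Ioi)
  have hmem : ∀ s > C, ((0 : E), s) ∈ interior S := fun s hs =>
    hopen ⟨Metric.mem_ball_self hr, hs⟩
  obtain ⟨f, hf⟩ := geometric_hahn_banach_open_point hS.interior isOpen_interior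
    fun h => hv (interior_subset h)
  have hle : ∀ q ∈ S, f q ≤ f (0, v) := by
    have hcl : S ⊆ closure (interior S) :=
      subset_closure.trans (hS.closure_interior_eq_closure_of_nonempty_interior
        ⟨_, hmem (C + 1) (lt_add_one C)⟩).ge
    exact fun q hq => closure_minimal (fun q hq => (hf q hq).le)
      (isClosed_le f.continuous continuous_const) (hcl hq)
  set τ := f (0, 1) with hτ
  have hsplit : ∀ e s, f (e, s) = f (e, 0) + s * τ := by
    intro e s
    rw [hτ, ← smul_eq_mul, ← map_smul, ← map_add]; simp
  have hzero : f ((0 : E), (0 : ℝ)) = 0 := map_zero f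
  have hτ0 : τ < 0 := by
    have hlt := hf _ (hmem (max C v + 1) ((le_max_left C v).trans_lt (lt_add_one _)))
    rw [hsplit, hsplit 0 v] at hlt
    have hprod : (max C v + 1 - v) * τ < 0 := by linarith
    exact (pos_iff_neg_of_mul_neg hprod).1 (by linarith [le_max_right C v])
  refine ⟨(InnerProductSpace.toDual ℝ E).symm ((-τ)⁻¹ • (f ∘L .inl ℝ E ℝ)), ?_⟩
  rintro ⟨e, s⟩ hes
  have hfes := hle _ hes
  rw [hsplit, hsplit 0 v, hzero] at hfes
  have hinner : inner ℝ ((InnerProductSpace.toDual ℝ E).symm ((-τ)⁻¹ • (f ∘L .inl ℝ E ℝ))) e =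
      f (e, 0) / -τ := by
    rw [InnerProductSpace.toDual_symm_apply]; simp [div_eq_inv_mul]
  have hdiv : f (e, 0) / -τ ≤ s - v := by
    rw [div_le_iff₀ (neg_pos.2 hτ0)]; linarith
  simp only [hinner]
  linarith

/-- The strict epigraph of the perturbation function `e ↦ inf_y h (a + A y + e) + k y`, whose
slopes at `e = 0` are the Lagrange multipliers of the problem `min_y h (a + A y) + k y`. -/
def perturbationEpigraph (h : E₂ → EReal) (k : E → EReal) (A : E →L[ℝ] E₂) (a : E₂) :
    Set (E₂ × ℝ) :=
  {q | ∃ (y : E) (α β : ℝ), h (a + A y + q.1) ≤ α ∧ k y ≤ β ∧ α + β < q.2}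

lemma convex_perturbationEpigraph {h : E₂ → EReal} {k : E → EReal} (hh : ConvexUpTo 0 h)
    (hk : ConvexUpTo 0 k) (A : E →L[ℝ] E₂) (a : E₂) :
    Convex ℝ (perturbationEpigraph h k A a) := by
  rintro ⟨e₁, s₁⟩ ⟨y₁, α₁, β₁, hα₁, hβ₁, hlt₁⟩ ⟨e₂, s₂⟩ ⟨y₂, α₂, β₂, hα₂, hβ₂, hlt₂⟩ c d hc hd hcd
  have hpoint : a + A (c • y₁ + d • y₂) + (c • e₁ + d • e₂) =
      c • (a + A y₁ + e₁) + d • (a + A y₂ + e₂) := by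
    obtain rfl : d = 1 - c := by linarith
    rw [map_add, map_smul, map_smul]; module
  refine ⟨c • y₁ + d • y₂, c * α₁ + d * α₂, c * β₁ + d * β₂, ?_, ?_, ?_⟩
  · simp only [Prod.smul_mk, Prod.mk_add_mk, hpoint]
    simpa using hh hα₁ hα₂ hc hd hcd
  · simpa using hk hβ₁ hβ₂ hc hd hcd
  · have hpos := convex_Ioi (0 : ℝ) (sub_pos.2 hlt₁) (sub_pos.2 hlt₂) hc hd hcd
    simp only [smul_eq_mul, Set.mem_Ioi, Prod.smul_mk, Prod.mk_add_mk] at hpos ⊢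
    linarith

lemma exists_multiplier [CompleteSpace E₂] {h : E₂ → EReal} {k : E → EReal}
    (hh : ConvexUpTo 0 h) (hk : ConvexUpTo 0 k) (A : E →L[ℝ] E₂) (a : E₂) {v r C : ℝ}
    (hr : 0 < r)
    (hmin : ∀ (y : E) (α β : ℝ), h (a + A y) ≤ α → k y ≤ β → v ≤ α + β)
    (hC : ∀ e : E₂, ‖e‖ < r → ∃ (y : E) (α β : ℝ), h (a + A y + e) ≤ α ∧ k y ≤ β ∧ α + β ≤ C) :
    ∃ z : E₂, ‖z‖ * r ≤ C - v ∧ ∀ (y : E) (u : E₂) (α β : ℝ), h u ≤ α → k y ≤ β →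
      v + inner ℝ z (u - (a + A y)) ≤ α + β := by
  have hball : Metric.ball 0 r ×ˢ Set.Ioi C ⊆ perturbationEpigraph h k A a := by
    rintro ⟨e, s⟩ ⟨he, hs⟩
    obtain ⟨y, α, β, hα, hβ, hle⟩ := hC e (by simpa using he)
    exact ⟨y, α, β, hα, hβ, hle.trans_lt hs⟩
  have hv : ((0 : E₂), v) ∉ perturbationEpigraph h k A a := by
    rintro ⟨y, α, β, hα, hβ, hlt⟩
    exact (hmin y α β (by simpa using hα) hβ).not_gt hlt
  obtain ⟨z, hz⟩ :=
    exists_add_inner_le_of_convex (convex_perturbationEpigraph hh hk A a) hr hball hv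
  refine ⟨z, norm_mul_le_of_forall_inner_le hr fun e he => ?_, fun y u α β hu hy => ?_⟩
  · refine le_of_forall_gt_imp_ge_of_dense fun s hs => ?_
    have := hz (e, s + v) (hball ⟨by simpa using he, by
      simpa using sub_lt_iff_lt_add.1 hs⟩)
    linarith
  · refine le_of_forall_gt_imp_ge_of_dense fun s hs => ?_
    exact hz (u - (a + A y), s) ⟨y, α, β, by simpa using hu, hy, hs⟩

end Duality

section QuadraticForms

variable {E P : Type*} [NormedAddCommGroup E] [InnerProductSpace ℝ E]
  [NormedAddCommGroup P] [NormedSpace ℝ P]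

section Bilinear

variable {ι V W G : Type*} [NormedAddCommGroup V] [NormedSpace ℝ V] [NormedAddCommGroup W]
  [NormedSpace ℝ W] [NormedAddCommGroup G] [NormedSpace ℝ G] {l : Filter ι}
  (B : V →L[ℝ] W →L[ℝ] G) {a : ι → V} {b : ι → W} {g g' : ι → ℝ}

lemma isLittleO_bilin (ha : a =o[l] g) (hb : b =O[l] g') :
    (fun i => B (a i) (b i)) =o[l] fun i => g i * g' i :=
  B.isBoundedBilinearMap.isBigO_comp.trans_isLittleO (ha.norm_left.mul_isBigO hb.norm_left)

lemma isBigO_bilin (ha : a =O[l] g) (hb : b =O[l] g') :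
    (fun i => B (a i) (b i)) =O[l] fun i => g i * g' i :=
  B.isBoundedBilinearMap.isBigO_comp.trans (ha.norm_left.mul hb.norm_left)

end Bilinear

lemma eq_zero_of_forall_linear_quadratic {β q : ℝ} (h : ∀ t : ℝ, 0 ≤ 2 * t * β + t ^ 2 * q) :
    β = 0 := by
  have hdiscrim : discrim q (2 * β) 0 ≤ 0 :=
    discrim_le_zero fun t => (h t).trans_eq (by ring)
  rw [discrim] at hdiscrim
  nlinarith [sq_nonneg β]

lemma exists_isMaxOn_rayleighQuotient [FiniteDimensional ℝ E] {T : Submodule ℝ E}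
    (R W : E →L[ℝ] E →L[ℝ] ℝ) (hpos : ∀ a ∈ T, a ≠ 0 → 0 < R a a) (hT : T ≠ ⊥) :
    ∃ (r : ℝ) (a : E), a ∈ T ∧ a ≠ 0 ∧ W a a = r * R a a ∧ ∀ b ∈ T, W b b ≤ r * R b b := by
  have hcomp : IsCompact (Metric.sphere (0 : E) 1 ∩ T) :=
    (isCompact_sphere 0 1).inter_right T.closed_of_finiteDimensional
  have hnormalize : ∀ a ∈ T, a ≠ 0 → ‖a‖⁻¹ • a ∈ Metric.sphere (0 : E) 1 ∩ T := fun a ha ha0 =>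
    ⟨by rw [mem_sphere_zero_iff_norm, norm_smul, norm_inv, norm_norm,
      inv_mul_cancel₀ (norm_ne_zero_iff.2 ha0)], T.smul_mem _ ha⟩
  have hne : ∀ a ∈ Metric.sphere (0 : E) 1 ∩ (T : Set E), a ≠ 0 := fun a ha =>
    norm_ne_zero_iff.1 (by rw [mem_sphere_zero_iff_norm.1 ha.1]; exact one_ne_zero)
  have hcont : ContinuousOn (fun a => W a a / R a a) (Metric.sphere (0 : E) 1 ∩ T) :=
    ContinuousOn.div (by fun_prop) (by fun_prop) fun a ha => (hpos a ha.2 (hne a ha)).ne'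
  obtain ⟨u, hu, hu0⟩ := T.ne_bot_iff.1 hT
  obtain ⟨a, ha, hmax⟩ := hcomp.exists_isMaxOn ⟨_, hnormalize u hu hu0⟩ hcont
  refine ⟨W a a / R a a, a, ha.2, hne a ha,
    (div_mul_cancel₀ _ (hpos a ha.2 (hne a ha)).ne').symm, fun b hb => ?_⟩
  rcases eq_or_ne b 0 with rfl | hb0
  · simp
  have hle : W (‖b‖⁻¹ • b) (‖b‖⁻¹ • b) / R (‖b‖⁻¹ • b) (‖b‖⁻¹ • b) ≤ W a a / R a a :=
    hmax (hnormalize b hb hb0)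
  have hb1 : ‖b‖⁻¹ ≠ 0 := inv_ne_zero (norm_ne_zero_iff.2 hb0)
  simp only [map_smul, smul_apply, smul_eq_mul] at hle
  rwa [mul_div_mul_left _ _ hb1, mul_div_mul_left _ _ hb1, div_le_iff₀ (hpos b hb hb0)] at hle

/-- The maximizer of the Rayleigh quotient `W a a / R a a` is an eigenvector of the pencil. -/
lemma exists_pencil_eigenvector [FiniteDimensional ℝ E] {T : Submodule ℝ E}
    {R W : E →L[ℝ] E →L[ℝ] ℝ} (hR : ∀ a b, R a b = R b a) (hW : ∀ a b, W a b = W b a)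
    (hpos : ∀ a ∈ T, a ≠ 0 → 0 < R a a) {u : E} (hu : u ∈ T) (hlt : R u u < W u u) :
    ∃ (r : ℝ) (a : E), 1 < r ∧ a ∈ T ∧ a ≠ 0 ∧ ∀ b ∈ T, W a b = r * R a b := by
  have hu0 : u ≠ 0 := by rintro rfl; simp at hlt
  obtain ⟨r, a, ha, ha0, haa, hle⟩ :=
    exists_isMaxOn_rayleighQuotient R W hpos (T.ne_bot_iff.2 ⟨u, hu, hu0⟩)
  refine ⟨r, a, ?_, ha, ha0, fun b hb => ?_⟩
  · by_contra! hr
    nlinarith [hpos u hu hu0, hle u hu]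
  · have hcross : r * R a b - W a b = 0 :=
      eq_zero_of_forall_linear_quadratic (q := r * R b b - W b b) fun t => by
        have hab := hle (a + t • b) (T.add_mem ha (T.smul_mem t hb))
        simp only [map_add, map_smul, add_apply, smul_apply, smul_eq_mul] at hab
        rw [hR b a, hW b a] at hab
        linarith
    linarith

lemma exists_variational_solution (T : Submodule ℝ E) [CompleteSpace T]
    (R : E →L[ℝ] E →L[ℝ] ℝ) {κ : ℝ} (hκ : 0 < κ) (hcoer : ∀ a ∈ T, κ * ‖a‖ ^ 2 ≤ R a a)
    (L : P →L[ℝ] E →L[ℝ] ℝ) :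
    ∃ D : P →L[ℝ] E, ∀ p, D p ∈ T ∧ ∀ b ∈ T, R (D p) b = L p b := by
  have hB : IsCoercive (R.bilinearComp T.subtypeL T.subtypeL) :=
    ⟨κ, hκ, fun a => by simpa [sq, mul_assoc] using hcoer a a.2⟩
  refine ⟨T.subtypeL ∘L hB.continuousLinearEquivOfBilin.symm.toContinuousLinearMap ∘L
    (InnerProductSpace.toDual ℝ T).symm.toContinuousLinearEquiv.toContinuousLinearMap ∘L
    (ContinuousLinearMap.compL ℝ T E ℝ).flip T.subtypeL ∘L L,
    fun p => ⟨Submodule.coe_mem _, fun b hb => ?_⟩⟩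
  have hsol := hB.continuousLinearEquivOfBilin_apply
    (hB.continuousLinearEquivOfBilin.symm ((InnerProductSpace.toDual ℝ T).symm (L p ∘L T.subtypeL)))
    ⟨b, hb⟩
  rw [ContinuousLinearEquiv.apply_symm_apply, InnerProductSpace.toDual_symm_apply] at hsol
  exact hsol.symm

variable {T : Submodule ℝ E} {R : E →L[ℝ] E →L[ℝ] ℝ} {L : P →L[ℝ] E →L[ℝ] ℝ} {D : P →L[ℝ] E}

lemma isLittleO_quadratic_sub (hR : ∀ a b, R a b = R b a) {a b : P → E}
    (ha : a =O[𝓝 0] fun p => ‖p‖) (hb : b =O[𝓝 0] fun p => ‖p‖)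
    (hab : (fun p => a p - b p) =o[𝓝 0] fun p => ‖p‖) :
    (fun p => (1 / 2 * R (a p) (a p) - L p (a p)) - (1 / 2 * R (b p) (b p) - L p (b p)))
      =o[𝓝 0] fun p => ‖p‖ ^ 2 := by
  have hquad := (isLittleO_bilin R hab (ha.add hb)).const_mul_left (1 / 2)
  have hlin := isLittleO_bilin L.flip hab (isBigO_refl id (𝓝 0)).norm_right
  refine (hquad.sub hlin).congr (fun p => ?_) fun p => (sq _).symm
  simp only [map_sub, map_add, sub_apply, ContinuousLinearMap.flip_apply, id]
  rw [hR (b p) (a p)]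
  ring

lemma mul_norm_sub_sq_le_quadratic_sub (hR : ∀ a b, R a b = R b a) {κ : ℝ}
    (hcoer : ∀ a ∈ T, κ * ‖a‖ ^ 2 ≤ R a a) {a c : E} {ψ : E →L[ℝ] ℝ} (ha : a ∈ T) (hc : c ∈ T)
    (hψ : ∀ b ∈ T, R c b = ψ b) :
    κ / 2 * ‖a - c‖ ^ 2 ≤ (1 / 2 * R a a - ψ a) - (1 / 2 * R c c - ψ c) := by
  have hle := hcoer _ (T.sub_mem ha hc)
  simp only [map_sub, sub_apply, hR a c] at hle
  linarith [hψ a ha, hψ c hc]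

lemma isLittleO_minimizer_sub (hR : ∀ a b, R a b = R b a) {κ : ℝ} (hκ : 0 < κ)
    (hcoer : ∀ a ∈ T, κ * ‖a‖ ^ 2 ≤ R a a) (hD : ∀ p, D p ∈ T)
    (hDL : ∀ p, ∀ b ∈ T, R (D p) b = L p b) {δ τ δ' : P → E} {e : P → ℝ}
    (hδ : δ =O[𝓝 0] fun p => ‖p‖) (hτ : ∀ p, τ p ∈ T)
    (hδτ : (fun p => δ p - τ p) =o[𝓝 0] fun p => ‖p‖)
    (hδ' : (fun p => δ' p - D p) =o[𝓝 0] fun p => ‖p‖)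
    (he : e =o[𝓝 0] fun p => ‖p‖ ^ 2)
    (hle : ∀ᶠ p in 𝓝 0, 1 / 2 * R (δ p) (δ p) - L p (δ p) ≤
      1 / 2 * R (δ' p) (δ' p) - L p (δ' p) + e p) :
    (fun p => δ p - D p) =o[𝓝 0] fun p => ‖p‖ := by
  have hDO : (fun p => D p) =O[𝓝 0] fun p => ‖p‖ := (D.isBigO_id (𝓝 0)).norm_right
  have hτO : τ =O[𝓝 0] fun p => ‖p‖ := by simpa using hδ.sub hδτ.isBigO
  have hδ'O : δ' =O[𝓝 0] fun p => ‖p‖ := by simpa using hδ'.isBigO.add hDO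
  have hsq : (fun p => ‖τ p - D p‖ ^ 2) =o[𝓝 0] fun p => ‖p‖ ^ 2 := by
    have hsmall := (he.add (isLittleO_quadratic_sub (L := L) hR hδ'O hDO hδ')).sub
      (isLittleO_quadratic_sub (L := L) hR hδ hτO hδτ)
    refine IsBigO.trans_isLittleO (IsBigO.of_bound (2 / κ) ?_) hsmall
    filter_upwards [hle] with p hp
    have hgap := mul_norm_sub_sq_le_quadratic_sub hR hcoer (hτ p) (hD p) (hDL p)
    rw [Real.norm_of_nonneg (sq_nonneg _), div_mul_eq_mul_div, le_div_iff₀ hκ]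
    refine le_trans ?_ (mul_le_mul_of_nonneg_left (Real.le_norm_self _) zero_le_two)
    linarith
  have hτD : (fun p => τ p - D p) =o[𝓝 0] fun p => ‖p‖ :=
    (IsLittleO.of_pow (n := 2) hsq two_ne_zero).of_norm_left
  simpa using hδτ.add hτD

end QuadraticForms

section Feasibility

variable {E E₂ : Type*} [NormedAddCommGroup E] [InnerProductSpace ℝ E]
  [NormedAddCommGroup E₂] [InnerProductSpace ℝ E₂]

/-- The affine model `F x + ∇F(x) (y - x)` of `F` around `x`, as a function of `y`. -/
noncomputable def linModel (F : E → E₂) (x y : E) : E₂ := F x + fderiv ℝ F x (y - x)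

lemma linModel_self (F : E → E₂) (x : E) : linModel F x x = F x := by simp [linModel]

lemma hasStrictFDerivAt_linModel {F : E → E₂} (hF : ContDiff ℝ 2 F) (x₀ : E) :
    HasStrictFDerivAt (fun q : E × E => linModel F q.1 q.2)
      (fderiv ℝ F x₀ ∘L .snd ℝ E E) (x₀, x₀) := by
  have hF' : ContDiff ℝ 1 (fderiv ℝ F) := hF.fderiv_right (by norm_num)
  have hlin : ContDiff ℝ 1 (fun q : E × E => linModel F q.1 q.2) :=
    ((hF.of_le (by norm_num)).comp contDiff_fst).add
      ((hF'.comp contDiff_fst).clm_apply (contDiff_snd.sub contDiff_fst))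
  refine hlin.contDiffAt.hasStrictFDerivAt' ?_ one_ne_zero
  have hfst : HasFDerivAt (fun q : E × E => q.1) (ContinuousLinearMap.fst ℝ E E) (x₀, x₀) :=
    hasFDerivAt_fst
  have hdF : HasFDerivAt F (fderiv ℝ F x₀) x₀ := (hF.differentiable two_ne_zero x₀).hasFDerivAt
  have hddF : HasFDerivAt (fderiv ℝ F) (fderiv ℝ (fderiv ℝ F) x₀) x₀ :=
    (hF'.differentiable one_ne_zero x₀).hasFDerivAt
  have hsum := (HasFDerivAt.comp (x₀, x₀) (g := F) hdF hfst).add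
    ((HasFDerivAt.comp (x₀, x₀) (g := fderiv ℝ F) hddF hfst).clm_apply (hasFDerivAt_snd.sub hfst))
  refine hsum.congr_fderiv ?_
  ext v <;> simp

/-- The point `v` with `F ((1 - t) x + t y) = (1 - t) v + t u`, for `q = (t, x)`. -/
noncomputable def chordStart (F : E → E₂) (y : E) (u : E₂) (q : ℝ × E) : E₂ :=
  (1 - q.1)⁻¹ • (F ((1 - q.1) • q.2 + q.1 • y) - q.1 • u)

lemma smul_chordStart_add (F : E → E₂) (x y : E) (u : E₂) {t : ℝ} (ht : t ≠ 1) :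
    (1 - t) • chordStart F y u (t, x) + t • u = F ((1 - t) • x + t • y) := by
  simp only [chordStart, smul_smul, mul_inv_cancel₀ (sub_ne_zero.2 ht.symm), one_smul,
    sub_add_cancel]

lemma chordStart_zero (F : E → E₂) (x y : E) (u : E₂) : chordStart F y u (0, x) = F x := by
  simp [chordStart]

/-- The derivative in `t` vanishes because `u` is the value at `y` of the affine model. -/
lemma hasStrictFDerivAt_chordStart {F : E → E₂} (hF : ContDiff ℝ 1 F) (x₀ y : E) :
    HasStrictFDerivAt (chordStart F y (linModel F x₀ y)) (fderiv ℝ F x₀ ∘L .snd ℝ ℝ E)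
      (0, x₀) := by
  set u := linModel F x₀ y with hu
  have hsmooth : ContDiffAt ℝ 1 (chordStart F y u) (0, x₀) :=
    ContDiffAt.smul (ContDiffAt.inv (by fun_prop) (by simp))
      (ContDiff.sub (hF.comp (by fun_prop)) (by fun_prop)).contDiffAt
  refine hsmooth.hasStrictFDerivAt' ?_ one_ne_zero
  have hfst : HasFDerivAt (fun q : ℝ × E => q.1) (.fst ℝ ℝ E) (0, x₀) := hasFDerivAt_fst
  have hseg : HasFDerivAt (fun q : ℝ × E => (1 - q.1) • q.2 + q.1 • y) _ (0, x₀) :=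
    ((hfst.const_sub 1).smul hasFDerivAt_snd).add (hfst.smul_const y)
  have hdF : HasFDerivAt F (fderiv ℝ F x₀) ((1 - ((0 : ℝ), x₀).1) • ((0 : ℝ), x₀).2 +
      ((0 : ℝ), x₀).1 • y) := by
    simpa using (hF.differentiable one_ne_zero x₀).hasFDerivAt
  have hinv : HasFDerivAt (fun q : ℝ × E => (1 - q.1)⁻¹) _ (0, x₀) :=
    (hasDerivAt_inv (x := (1 - ((0 : ℝ), x₀).1)) (by simp)).comp_hasFDerivAt (0, x₀)
      (hfst.const_sub 1)
  refine (hinv.smul ((HasFDerivAt.comp ((0 : ℝ), x₀) hdF hseg).sub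
    (hfst.smul_const u))).congr_fderiv ?_
  ext v
  · simp [hu, linModel]; abel
  · simp

variable {Z₁ Z₂ : Type*} [NormedAddCommGroup Z₁] [NormedSpace ℝ Z₁]
    [NormedAddCommGroup Z₂] [NormedSpace ℝ Z₂]

lemma surjective_prod_of_transversal {A : E →L[ℝ] E₂} {G' : E →L[ℝ] Z₁} {H' : E₂ →L[ℝ] Z₂}
    (hG : Function.Surjective G') (hH : Function.Surjective H')
    (htrans : ∀ v : E₂, ∃ a b, G' a = 0 ∧ H' b = 0 ∧ A a + b = v) :
    Function.Surjective (G'.prod (H' ∘L A)) := by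
  rintro ⟨p, q⟩
  obtain ⟨a₀, rfl⟩ := hG p
  obtain ⟨b₀, hb₀⟩ := hH (q - H' (A a₀))
  obtain ⟨a, b, ha, hb, rfl⟩ := htrans b₀
  rw [map_add, hb, add_zero] at hb₀
  exact ⟨a₀ + a, by simp [ha, hb₀]⟩

lemma exists_feasible_solution {X : Type*} [NormedAddCommGroup X] [NormedSpace ℝ X]
    [CompleteSpace X] [FiniteDimensional ℝ Z₁] [FiniteDimensional ℝ Z₂]
    {G : E → Z₁} {H : E₂ → Z₂} {G' : E →L[ℝ] Z₁} {H' : E₂ →L[ℝ] Z₂} {y₀ : E} {u₀ : E₂} {x₀ : X}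
    {J : X × E → E₂} {J' : X × E →L[ℝ] E₂} (hG : HasStrictFDerivAt G G' y₀) (hG0 : G y₀ = 0)
    (hH : HasStrictFDerivAt H H' u₀) (hH0 : H u₀ = 0) (hJ : HasStrictFDerivAt J J' (x₀, y₀))
    (hJ0 : J (x₀, y₀) = u₀) (hsurj : Function.Surjective (G'.prod (H' ∘L J' ∘L .inr ℝ X E)))
    (b : X →L[ℝ] E) :
    ∃ (Y : X → E) (Y' : X →L[ℝ] E), Y x₀ = y₀ ∧ HasFDerivAt Y Y' x₀ ∧
      (∀ ξ, G' (b ξ) = 0 → H' (J' (ξ, b ξ)) = 0 → Y' ξ = b ξ) ∧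
      ∀ᶠ x in 𝓝 x₀, G (Y x) = 0 ∧ H (J (x, Y x)) = 0 := by
  subst hJ0
  have hΨ : HasStrictFDerivAt (fun q : X × E => (G q.2, H (J q)))
      ((G' ∘L .snd ℝ X E).prod (H' ∘L J')) (x₀, y₀) :=
    (HasStrictFDerivAt.comp (x₀, y₀) hG hasStrictFDerivAt_snd).prodMk (hH.comp (x₀, y₀) hJ)
  obtain ⟨Y, Y', hY0, hY, htan, hsol⟩ := exists_implicit_solution_tangent hΨ
    (Prod.ext hG0 hH0) hsurj b
  exact ⟨Y, Y', hY0, hY, fun ξ hG hH => htan ξ (Prod.ext hG hH),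
    hsol.mono fun x hx => Prod.mk.inj hx⟩

end Feasibility

section Composite

variable {E E₂ : Type*} [NormedAddCommGroup E] [InnerProductSpace ℝ E] [FiniteDimensional ℝ E]
  [NormedAddCommGroup E₂] [InnerProductSpace ℝ E₂] [FiniteDimensional ℝ E₂]

/-- The data of the problem `min h (F x) + m x` around a critical point `x₀`: local models of `m`
and `h` along manifolds `M` and `K`, with the transversality and the sharpness condition of a
composite active manifold, and a step size `η` for which the proximal linear subproblems are
strongly convex. -/
structure CompositeProblem {k j : ℕ} (F : E → E₂) (h : E₂ → EReal) (m : E → EReal) (η μ : ℝ)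
    (x₀ : E) (M : Set E) (K : Set E₂) (G : E → EuclideanSpace ℝ (Fin k))
    (H : E₂ → EuclideanSpace ℝ (Fin j)) (φ : E → ℝ) (χ : E₂ → ℝ) : Prop where
  contDiff : ContDiff ℝ 2 F
  convex_h : ConvexUpTo 0 h
  lsc_h : LowerSemicontinuous h
  ne_bot_h : ∀ u, h u ≠ ⊥
  convex_m : ConvexUpTo μ m
  lsc_m : LowerSemicontinuous m
  ne_bot_m : ∀ x, m x ≠ ⊥
  eta_pos : 0 < η
  mu_lt : μ < η⁻¹
  modelM : IsLocalModel m M x₀ G φ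
  modelK : IsLocalModel h K (F x₀) H χ
  transversal : ∀ v : E₂, ∃ a b, fderiv ℝ G x₀ a = 0 ∧ fderiv ℝ H (F x₀) b = 0 ∧
    fderiv ℝ F x₀ a + b = v
  sharp : ∃ c : ℝ, 0 < c ∧ ∀ᶠ q : E × E₂ in 𝓝 (x₀, F x₀), ¬ (q.1 ∈ M ∧ q.2 ∈ K) →
    ∀ z ∈ subdiff h q.2, ∀ w ∈ subdiff m q.1,
      c ≤ ‖ContinuousLinearMap.adjoint (fderiv ℝ F x₀) z + w‖
  critical : IsCriticalPoint (fun x => h (F x) + m x) x₀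

namespace CompositeProblem

variable {k j : ℕ} {F : E → E₂} {h : E₂ → EReal} {m : E → EReal} {η μ : ℝ}
    {x₀ : E} {M : Set E} {K : Set E₂} {G : E → EuclideanSpace ℝ (Fin k)}
    {H : E₂ → EuclideanSpace ℝ (Fin j)} {φ : E → ℝ} {χ : E₂ → ℝ}

lemma surjective_constraint (P : CompositeProblem F h m η μ x₀ M K G H φ χ) :
    Function.Surjective ((fderiv ℝ G x₀).prod (fderiv ℝ H (F x₀) ∘L fderiv ℝ F x₀)) :=
  surjective_prod_of_transversal P.modelM.surjective P.modelK.surjective P.transversal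

lemma kappa_pos (P : CompositeProblem F h m η μ x₀ M K G H φ χ) : 0 < η⁻¹ - μ :=
  sub_pos.2 P.mu_lt

/-- Points feasible for the linearization at `x` of the constraints, with the value of `F`
perturbed by `e`, as a function of `(e, x - x₀, a)`; they move tangentially to `a`. -/
lemma exists_feasible (P : CompositeProblem F h m η μ x₀ M K G H φ χ) :
    ∃ (Y : E₂ × E × E → E) (Y' : E₂ × E × E →L[ℝ] E), Y (0, x₀, 0) = x₀ ∧
      HasFDerivAt Y Y' (0, x₀, 0) ∧
      (∀ ξ a, fderiv ℝ G x₀ a = 0 → fderiv ℝ H (F x₀) (fderiv ℝ F x₀ a) = 0 →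
        Y' (0, ξ, a) = a) ∧
      ∀ᶠ q in 𝓝 ((0 : E₂), x₀, (0 : E)), G (Y q) = 0 ∧ H (linModel F q.2.1 (Y q) + q.1) = 0 := by
  let base : (E₂ × E × E) × E →L[ℝ] E × E :=
    (ContinuousLinearMap.fst ℝ E E ∘L .snd ℝ E₂ (E × E) ∘L .fst ℝ (E₂ × E × E) E).prod
      (.snd ℝ (E₂ × E × E) E)
  let shift : (E₂ × E × E) × E →L[ℝ] E₂ := .fst ℝ E₂ (E × E) ∘L .fst ℝ (E₂ × E × E) E
  have hJ : HasStrictFDerivAt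
      (fun q : (E₂ × E × E) × E => linModel F q.1.2.1 q.2 + q.1.1)
      ((fderiv ℝ F x₀ ∘L .snd ℝ E E) ∘L base + shift) ((0, x₀, 0), x₀) :=
    (HasStrictFDerivAt.comp ((0, x₀, 0), x₀) (g := fun q : E × E => linModel F q.1 q.2) (f := base)
      (hasStrictFDerivAt_linModel P.contDiff x₀) base.hasStrictFDerivAt).add
      shift.hasStrictFDerivAt
  have hpartial : ((fderiv ℝ F x₀ ∘L .snd ℝ E E) ∘L base + shift) ∘L .inr ℝ (E₂ × E × E) E =
      fderiv ℝ F x₀ := by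
    ext; simp [base, shift]
  obtain ⟨Y, Y', hY0, hY, htan, hsol⟩ := exists_feasible_solution P.modelM.hasStrictFDerivAt
    P.modelM.eq_zero P.modelK.hasStrictFDerivAt P.modelK.eq_zero hJ (by simp [linModel_self])
    (by rw [hpartial]; exact P.surjective_constraint) (.snd ℝ E E ∘L .snd ℝ E₂ (E × E))
  refine ⟨Y, Y', hY0, hY, fun ξ a ha hb => ?_, hsol⟩
  simpa using htan (0, ξ, a) (by simpa using ha) (by simpa [base, shift] using hb)

lemma exists_chord_curve (P : CompositeProblem F h m η μ x₀ M K G H φ χ) (y : E) :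
    ∃ (Y : ℝ → E) (V : ℝ → E₂), Y 0 = x₀ ∧ V 0 = F x₀ ∧ HasDerivAt Y 0 0 ∧ HasDerivAt V 0 0 ∧
      ∀ᶠ t in 𝓝 0, m (Y t) = φ (Y t) ∧ h (V t) = χ (V t) ∧
        (1 - t) • V t + t • linModel F x₀ y = F ((1 - t) • Y t + t • y) := by
  have hJ := hasStrictFDerivAt_chordStart (P.contDiff.of_le one_le_two) x₀ y
  have hpartial : (fderiv ℝ F x₀ ∘L .snd ℝ ℝ E) ∘L .inr ℝ ℝ E = fderiv ℝ F x₀ := by ext; simp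
  obtain ⟨Y, Y', hY0, hY, htan, hsol⟩ := exists_feasible_solution P.modelM.hasStrictFDerivAt
    P.modelM.eq_zero P.modelK.hasStrictFDerivAt P.modelK.eq_zero hJ (chordStart_zero F x₀ y _)
    (by rw [hpartial]; exact P.surjective_constraint) 0
  obtain rfl : Y' = 0 := by ext; simpa using htan 1 (by simp) (by simp)
  have hYd : HasDerivAt Y 0 0 := by simpa using hY.hasDerivAt
  set V : ℝ → E₂ := fun t => chordStart F y (linModel F x₀ y) (t, Y t) with hV
  have hV0 : V 0 = F x₀ := by rw [hV]; simp only [hY0, chordStart_zero]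
  have hVd : HasDerivAt V 0 0 := by
    have hJ0 : HasFDerivAt (chordStart F y (linModel F x₀ y)) (fderiv ℝ F x₀ ∘L .snd ℝ ℝ E)
        (0, Y 0) := hY0 ▸ hJ.hasFDerivAt
    simpa [hV, Function.comp_def] using hJ0.comp_hasDerivAt (0 : ℝ) ((hasDerivAt_id 0).prodMk hYd)
  have hYt : Tendsto Y (𝓝 0) (𝓝 x₀) := hY0 ▸ hYd.continuousAt.tendsto
  have hVt : Tendsto V (𝓝 0) (𝓝 (F x₀)) := hV0 ▸ hVd.continuousAt.tendsto
  refine ⟨Y, V, hY0, hV0, hYd, hVd, ?_⟩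
  filter_upwards [hsol, hYt.eventually P.modelM.eq_on, hVt.eventually P.modelK.eq_on,
    eventually_ne_nhds zero_ne_one] with t ht hm hh ht1
    using ⟨hm ht.1, hh ht.2, smul_chordStart_add F (Y t) y _ ht1⟩

lemma add_le_on_chord (P : CompositeProblem F h m η μ x₀ M K G H φ χ) {x y : E} {v u : E₂}
    {a b α β t : ℝ} (hv : h v ≤ a) (hx : m x ≤ b) (hu : h u ≤ α) (hy : m y ≤ β)
    (ht : t ∈ Set.Ioo (0 : ℝ) 1) (hF : F ((1 - t) • x + t • y) = (1 - t) • v + t • u) :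
    h (F ((1 - t) • x + t • y)) + m ((1 - t) • x + t • y) ≤
      (((1 - t) * (a + b) + t * (α + β) + μ / 2 * ((1 - t) * t) * ‖x - y‖ ^ 2 : ℝ) : EReal) := by
  have hm := P.convex_m hx hy (sub_nonneg.2 ht.2.le) ht.1.le (by ring)
  have hh := P.convex_h hv hu (sub_nonneg.2 ht.2.le) ht.1.le (by ring)
  rw [← hF] at hh
  refine (add_le_add hh hm).trans_eq ?_
  rw [← EReal.coe_add]
  ring_nf

/-- Criticality is tested along `(1 - t) Y t + t y`, where `Y` is chosen such that `F` maps this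
curve to a convex combination of the affine model at `y` with points of `K`. -/
lemma model_minimal (P : CompositeProblem F h m η μ x₀ M K G H φ χ) {y : E} {α β : ℝ}
    (hα : h (linModel F x₀ y) ≤ α) (hβ : m y ≤ β) :
    χ (F x₀) + φ x₀ ≤ α + β + μ / 2 * ‖y - x₀‖ ^ 2 := by
  obtain ⟨Y, V, rfl, hV0, hY, hV, hev⟩ := P.exists_chord_curve y
  have hφ : HasDerivAt (fun t => φ (Y t)) 0 0 := by
    simpa [Function.comp_def] using P.modelM.hasFDerivAt.comp_hasDerivAt 0 hY
  have hχ : HasDerivAt (fun t => χ (V t)) 0 0 := by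
    have hdχ := P.modelK.hasFDerivAt
    rw [← hV0] at hdχ
    simpa [Function.comp_def] using hdχ.comp_hasDerivAt 0 hV
  have hid : HasDerivAt (fun t : ℝ => t) 1 0 := hasDerivAt_id 0
  have hX : HasDerivAt (fun t => (1 - t) • Y t + t • y) _ 0 :=
    ((hid.const_sub 1).smul hY).add (hid.smul_const y)
  have hbound : HasDerivAt (fun t => (1 - t) * (χ (V t) + φ (Y t)) + t * (α + β)
      + μ / 2 * ((1 - t) * t) * ‖Y t - y‖ ^ 2) _ 0 :=
    (((hid.const_sub 1).mul (hχ.add hφ)).add (hid.mul_const (α + β))).add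
      ((((hid.const_sub 1).mul hid).const_mul (μ / 2)).mul (hY.sub_const y).norm_sq)
  have hle : ∀ᶠ t : ℝ in 𝓝[>] 0, h (F ((1 - t) • Y t + t • y)) + m ((1 - t) • Y t + t • y) ≤
      (((1 - t) * (χ (V t) + φ (Y t)) + t * (α + β)
        + μ / 2 * ((1 - t) * t) * ‖Y t - y‖ ^ 2 : ℝ) : EReal) := by
    filter_upwards [hev.filter_mono nhdsWithin_le_nhds, Ioo_mem_nhdsGT (zero_lt_one' ℝ)]
      with t ⟨hm, hh, hF⟩ ht using P.add_le_on_chord hh.le hm.le hα hβ ht hF.symm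
  have hcrit : (0 : E) ∈ subdiff (fun x => h (F x) + m x) ((1 - (0 : ℝ)) • Y 0 + (0 : ℝ) • y) := by
    simpa [IsCriticalPoint] using P.critical
  have hderiv := inner_le_of_mem_subdiff hcrit hX hbound
    (by simp [P.modelM.apply_self, P.modelK.apply_self, hV0, add_comm]) hle
  simp only [inner_zero_left, inner_zero_right, Pi.add_apply, Pi.mul_apply, hV0,
    norm_sub_rev (Y 0)] at hderiv
  linarith

end CompositeProblem

end Composite

section Duality

variable {E E₂ : Type*} [NormedAddCommGroup E] [InnerProductSpace ℝ E]
  [NormedAddCommGroup E₂] [InnerProductSpace ℝ E₂]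

lemma ConvexUpTo.mono {f : E → EReal} {ℓ ℓ' : ℝ} (hf : ConvexUpTo ℓ f) (hℓ : ℓ ≤ ℓ') :
    ConvexUpTo ℓ' f := fun _ _ _ _ _ _ hx hy hs ht hst =>
  (hf hx hy hs ht hst).trans (EReal.coe_le_coe (by gcongr))

lemma linModel_eq_add (F : E → E₂) (x y : E) :
    linModel F x y = (F x - fderiv ℝ F x x) + fderiv ℝ F x y := by
  rw [linModel, map_sub]; abel

lemma linModel_sub (F : E → E₂) (x y y' : E) :
    linModel F x y - linModel F x y' = fderiv ℝ F x (y - y') := by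
  simp only [linModel_eq_add, map_sub]; abel

variable {F : E → E₂} {h : E₂ → EReal} {m : E → EReal} {η μ : ℝ}

lemma exists_minimizer_linModel [FiniteDimensional ℝ E] (hh : ConvexUpTo 0 h)
    (hhlsc : LowerSemicontinuous h) (hhbot : ∀ u, h u ≠ ⊥) (hm : ConvexUpTo μ m)
    (hmlsc : LowerSemicontinuous m) (hmbot : ∀ y, m y ≠ ⊥) (hμ : μ < η⁻¹) {x c y₁ : E}
    (hhy₁ : h (linModel F x y₁) ≠ ⊤) (hmy₁ : m y₁ ≠ ⊤) :
    ∃ (y : E) (α β : ℝ), h (linModel F x y) = α ∧ m y = β ∧ ∀ (y' : E) (α' β' : ℝ),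
      h (linModel F x y') ≤ α' → m y' ≤ β' →
      α + β + 1 / (2 * η) * ‖y - c‖ ^ 2 + (η⁻¹ - μ) / 2 * ‖y' - y‖ ^ 2 ≤
        α' + β' + 1 / (2 * η) * ‖y' - c‖ ^ 2 := by
  have hmc : ConvexUpTo (-(η⁻¹ - μ))
      fun y => m y + ((1 / (2 * η) * ‖y - c‖ ^ 2 : ℝ) : EReal) := by
    convert! hm.add (.quadratic (1 / (2 * η)) c) hmbot (fun _ => EReal.coe_ne_bot _) using 1
    field_simp; ring
  have hmcbot : ∀ y, m y + ((1 / (2 * η) * ‖y - c‖ ^ 2 : ℝ) : EReal) ≠ ⊥ := fun y =>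
    EReal.add_ne_bot_iff.2 ⟨hmbot y, EReal.coe_ne_bot _⟩
  have hhx : ConvexUpTo 0 fun y => h (linModel F x y) := by
    simp only [linModel_eq_add]
    exact hh.comp_affine _ _
  have hconv := hhx.add hmc (fun y => hhbot _) hmcbot
  rw [zero_add] at hconv
  have hlsc : LowerSemicontinuous fun y => h (linModel F x y) +
      (m y + ((1 / (2 * η) * ‖y - c‖ ^ 2 : ℝ) : EReal)) :=
    (hhlsc.comp (by unfold linModel; fun_prop)).add' (lowerSemicontinuous_add_coe hmlsc
      (by fun_prop)) fun y => EReal.continuousAt_add (.inr (hmcbot y)) (.inl (hhbot _))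
  obtain ⟨y, v, hv, hgrow⟩ := hconv.exists_forall_add_mul_sq_le (sub_pos.2 hμ) hlsc
    (fun y => EReal.add_ne_bot_iff.2 ⟨hhbot _, hmcbot y⟩)
    (EReal.add_ne_top hhy₁ (EReal.add_ne_top hmy₁ (EReal.coe_ne_top _)))
  obtain ⟨α, b, hα, hb, hαb⟩ := exists_coe_eq_add_le_of_add_le_coe (hhbot _) (hmcbot y) hv.le
  obtain ⟨β, q, hβ, hq, hβq⟩ :=
    exists_coe_eq_add_le_of_add_le_coe (hmbot y) (EReal.coe_ne_bot _) hb.le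
  refine ⟨y, α, β, hα, hβ, fun y' α' β' hα' hβ' => ?_⟩
  have hle : h (linModel F x y') + (m y' + ((1 / (2 * η) * ‖y' - c‖ ^ 2 : ℝ) : EReal)) ≤
      ((α' + (β' + 1 / (2 * η) * ‖y' - c‖ ^ 2) : ℝ) : EReal) := by
    rw [EReal.coe_add, EReal.coe_add]; gcongr
  linarith [EReal.coe_le_coe_iff.1 ((hgrow y').trans hle), EReal.coe_injective hq]

lemma exists_multiplier_linModel [CompleteSpace E₂] (hh : ConvexUpTo 0 h) (hm : ConvexUpTo μ m)
    (hmbot : ∀ y, m y ≠ ⊥) (F : E → E₂) (x c : E) {ρ v r C : ℝ} (hμ : μ ≤ 2 * ρ) (hr : 0 < r)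
    (hmin : ∀ (y : E) (α β : ℝ), h (linModel F x y) ≤ α → m y ≤ β →
      v ≤ α + β + ρ * ‖y - c‖ ^ 2)
    (hC : ∀ e : E₂, ‖e‖ < r → ∃ (y : E) (α β : ℝ), h (linModel F x y + e) ≤ α ∧ m y ≤ β ∧
      α + β + ρ * ‖y - c‖ ^ 2 ≤ C) :
    ∃ z : E₂, ‖z‖ * r ≤ C - v ∧ ∀ (y : E) (u : E₂) (α β : ℝ), h u ≤ α → m y ≤ β →
      v + inner ℝ z (u - linModel F x y) ≤ α + β + ρ * ‖y - c‖ ^ 2 := by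
  have hmc : ConvexUpTo 0 fun y => m y + ((ρ * ‖y - c‖ ^ 2 : ℝ) : EReal) :=
    (hm.add (.quadratic ρ c) hmbot fun _ => EReal.coe_ne_bot _).mono (by linarith)
  have hle : ∀ {y : E} {β : ℝ}, m y ≤ β →
      m y + ((ρ * ‖y - c‖ ^ 2 : ℝ) : EReal) ≤ ((β + ρ * ‖y - c‖ ^ 2 : ℝ) : EReal) := fun hβ => by
    rw [EReal.coe_add]; gcongr
  simp only [linModel_eq_add] at hmin hC ⊢
  obtain ⟨z, hzr, hz⟩ := exists_multiplier hh hmc (fderiv ℝ F x) (F x - fderiv ℝ F x x) (v := v)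
    hr (fun y α b hα hb => by
      linarith [hmin y α _ hα (le_coe_sub_of_add_coe_le hb)])
    (fun e he => by
      obtain ⟨y, α, β, hα, hβ, hC⟩ := hC e he
      exact ⟨y, α, _, hα, hle hβ, by linarith⟩)
  exact ⟨z, hzr, fun y u α β hu hy => by linarith [hz y u α _ hu (hle hy)]⟩

/-- A primal-dual solution of the subproblem
`min_y h (linModel F x y) + m y + (2 η)⁻¹ ‖y - c‖ ^ 2`, with model centre `x` and proximal centre
`c`: `y` is the minimizer, `z` the multiplier, and `α`, `β` are the values of `h` and `m`. For the
proximal linear map `c = x`. Moving `c` along `x₀ + t v` with `x` fixed at `x₀` makes the solutions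
move in an arbitrary direction tangent to the active manifolds, which gives the trial directions
for the curvature of `f`. -/
structure IsPrimalDual (F : E → E₂) (h : E₂ → EReal) (m : E → EReal) (η μ : ℝ) (x c y : E)
    (z : E₂) (α β : ℝ) : Prop where
  h_eq : h (linModel F x y) = α
  m_eq : m y = β
  growth : ∀ (y' : E) (α' β' : ℝ), h (linModel F x y') ≤ α' → m y' ≤ β' →
    α + β + 1 / (2 * η) * ‖y - c‖ ^ 2 + (η⁻¹ - μ) / 2 * ‖y' - y‖ ^ 2 ≤
      α' + β' + 1 / (2 * η) * ‖y' - c‖ ^ 2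
  h_le : ∀ (u : E₂) (α' : ℝ), h u ≤ α' → α + inner ℝ z (u - linModel F x y) ≤ α'
  m_le : ∀ (y' : E) (β' : ℝ), m y' ≤ β' → β - inner ℝ z (fderiv ℝ F x (y' - y))
    - η⁻¹ * inner ℝ (y - c) (y' - y) - 1 / (2 * η) * ‖y' - y‖ ^ 2 ≤ β'

lemma exists_isPrimalDual [FiniteDimensional ℝ E] [CompleteSpace E₂] (hh : ConvexUpTo 0 h)
    (hhlsc : LowerSemicontinuous h) (hhbot : ∀ u, h u ≠ ⊥) (hm : ConvexUpTo μ m)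
    (hmlsc : LowerSemicontinuous m) (hmbot : ∀ y, m y ≠ ⊥) (hη : 0 < η) (hμ : μ < η⁻¹) {x c : E}
    {r C : ℝ} (hr : 0 < r)
    (hC : ∀ e : E₂, ‖e‖ < r → ∃ (y : E) (α β : ℝ), h (linModel F x y + e) ≤ α ∧ m y ≤ β ∧
      α + β + 1 / (2 * η) * ‖y - c‖ ^ 2 ≤ C) :
    ∃ (y : E) (z : E₂) (α β : ℝ), IsPrimalDual F h m η μ x c y z α β ∧
      ‖z‖ * r ≤ C - (α + β + 1 / (2 * η) * ‖y - c‖ ^ 2) := by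
  obtain ⟨y₁, α₁, β₁, hα₁, hβ₁, -⟩ := hC 0 (by simpa using hr)
  rw [add_zero] at hα₁
  obtain ⟨y, α, β, hα, hβ, hgrowth⟩ := exists_minimizer_linModel (F := F) (c := c) hh hhlsc hhbot
    hm hmlsc hmbot hμ (ne_top_of_le_ne_top (EReal.coe_ne_top _) hα₁)
    (ne_top_of_le_ne_top (EReal.coe_ne_top _) hβ₁)
  have hη2 : 2 * (1 / (2 * η)) = η⁻¹ := by field_simp
  obtain ⟨z, hzr, hz⟩ := exists_multiplier_linModel hh hm hmbot F x c (by rw [hη2]; exact hμ.le) hr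
    (fun y' α' β' hα' hβ' => le_trans (le_add_of_nonneg_right
      (mul_nonneg (half_pos (sub_pos.2 hμ)).le (sq_nonneg _))) (hgrowth y' α' β' hα' hβ')) hC
  refine ⟨y, z, α, β, ⟨hα, hβ, hgrowth, fun u α' hu => ?_, fun y' β' hy' => ?_⟩, hzr⟩
  · linarith [hz y u α' β hu hβ.le]
  · have hsq : ‖y' - c‖ ^ 2 = ‖y' - y‖ ^ 2 + 2 * inner ℝ (y - c) (y' - y) + ‖y - c‖ ^ 2 := by
      rw [← sub_add_sub_cancel y' y c, norm_add_sq_real, real_inner_comm]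
    have hle := hz y' (linModel F x y) α β' hα.le hy'
    rw [linModel_sub, ← neg_sub y' y, map_neg, inner_neg_right, hsq] at hle
    rw [← hη2]
    linarith

end Duality

namespace CompositeProblem

variable {E E₂ : Type*} [NormedAddCommGroup E] [InnerProductSpace ℝ E] [FiniteDimensional ℝ E]
  [NormedAddCommGroup E₂] [InnerProductSpace ℝ E₂] [FiniteDimensional ℝ E₂]
  {k j : ℕ} {F : E → E₂} {h : E₂ → EReal} {m : E → EReal} {η μ : ℝ}
  {x₀ : E} {M : Set E} {K : Set E₂} {G : E → EuclideanSpace ℝ (Fin k)}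
  {H : E₂ → EuclideanSpace ℝ (Fin j)} {φ : E → ℝ} {χ : E₂ → ℝ}

lemma continuous_fderiv (P : CompositeProblem F h m η μ x₀ M K G H φ χ) :
    Continuous (fderiv ℝ F) := P.contDiff.continuous_fderiv two_ne_zero

lemma continuous_linModel (P : CompositeProblem F h m η μ x₀ M K G H φ χ) :
    Continuous fun q : E × E => linModel F q.1 q.2 :=
  (P.contDiff.continuous.comp continuous_fst).add
    ((P.continuous_fderiv.comp continuous_fst).clm_apply (continuous_snd.sub continuous_fst))

lemma exists_bounded_feasible (P : CompositeProblem F h m η μ x₀ M K G H φ χ) :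
    ∃ r > 0, ∀ x, ‖x - x₀‖ < r → ∀ e : E₂, ‖e‖ < r → ∃ (y : E) (α β : ℝ),
      h (linModel F x y + e) ≤ α ∧ m y ≤ β ∧ α + β ≤ χ (F x₀) + φ x₀ + 2 ∧ ‖y - x₀‖ ≤ 1 := by
  obtain ⟨Y, Y', hY0, hY, -, hsol⟩ := P.exists_feasible
  have hYc : Tendsto Y (𝓝 (0, x₀, 0)) (𝓝 x₀) := by
    simpa only [hY0] using hY.continuousAt.tendsto
  have hcentre : Tendsto (fun q : E₂ × E × E => q.2.1) (𝓝 (0, x₀, 0)) (𝓝 x₀) :=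
    Continuous.tendsto' (by fun_prop) _ _ rfl
  have hVc : Tendsto (fun q : E₂ × E × E => linModel F q.2.1 (Y q) + q.1) (𝓝 (0, x₀, 0))
      (𝓝 (F x₀)) := by
    simpa [linModel_self] using ((P.continuous_linModel.tendsto (x₀, x₀)).comp
      (hcentre.prodMk_nhds hYc)).add (continuous_fst.tendsto ((0 : E₂), x₀, (0 : E)))
  have hφ := (P.modelM.hasFDerivAt.continuousAt.tendsto.comp hYc).eventually
    (gt_mem_nhds (lt_add_one _))
  have hχ := (P.modelK.hasFDerivAt.continuousAt.tendsto.comp hVc).eventually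
    (gt_mem_nhds (lt_add_one _))
  have hball := hYc.eventually (Metric.closedBall_mem_nhds x₀ one_pos)
  obtain ⟨r, hr, hr'⟩ := Metric.eventually_nhds_iff.1 (hsol.and ((hYc.eventually P.modelM.eq_on).and
    ((hVc.eventually P.modelK.eq_on).and (hφ.and (hχ.and hball)))))
  refine ⟨r, hr, fun x hx e he => ?_⟩
  obtain ⟨⟨hGY, hHV⟩, hmY, hhV, hφlt, hχlt, hdist⟩ := hr' (y := (e, x, 0)) (by
    simp [dist_eq_norm, hx, he])
  refine ⟨Y (e, x, 0), _, _, (hhV hHV).le, (hmY hGY).le, ?_, by simpa [dist_eq_norm] using hdist⟩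
  simp only [Function.comp_apply] at hφlt hχlt
  linarith

lemma exists_base_multiplier (P : CompositeProblem F h m η μ x₀ M K G H φ χ) :
    ∃ z₀ : E₂, (∀ (u : E₂) (α : ℝ), h u ≤ α → χ (F x₀) + inner ℝ z₀ (u - F x₀) ≤ α) ∧
      ∀ (y : E) (β : ℝ), m y ≤ β →
        φ x₀ - inner ℝ z₀ (fderiv ℝ F x₀ (y - x₀)) - μ / 2 * ‖y - x₀‖ ^ 2 ≤ β := by
  obtain ⟨r, hr, hfeas⟩ := P.exists_bounded_feasible
  obtain ⟨z, -, hz⟩ := exists_multiplier_linModel P.convex_h P.convex_m P.ne_bot_m F x₀ x₀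
    (C := χ (F x₀) + φ x₀ + 2 + |μ / 2|) (mul_div_cancel₀ μ two_ne_zero).ge hr
    (fun y α β hα hβ => P.model_minimal hα hβ)
    (fun e he => by
      obtain ⟨y, α, β, hα, hβ, hle, hy⟩ := hfeas x₀ (by simpa using hr) e he
      have hsq : μ / 2 * ‖y - x₀‖ ^ 2 ≤ |μ / 2| :=
        (mul_le_mul_of_nonneg_right (le_abs_self _) (sq_nonneg _)).trans
          (mul_le_of_le_one_right (abs_nonneg _) (pow_le_one₀ (norm_nonneg _) hy))
      exact ⟨y, α, β, hα, hβ, by linarith⟩)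
  refine ⟨z, fun u α hα => ?_, fun y β hβ => ?_⟩
  · have hle := hz x₀ u α (φ x₀) hα P.modelM.apply_self.le
    rw [linModel_self, sub_self, norm_zero] at hle
    linarith
  · have hle := hz y (F x₀) (χ (F x₀)) β P.modelK.apply_self.le hβ
    rw [← linModel_self F x₀, linModel_sub, ← neg_sub y x₀, map_neg, inner_neg_right,
      linModel_self] at hle
    linarith

end CompositeProblem

section LowerBound

variable {E E₂ : Type*} [NormedAddCommGroup E] [InnerProductSpace ℝ E]
  [NormedAddCommGroup E₂] [InnerProductSpace ℝ E₂] {F : E → E₂} {h : E₂ → EReal}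
  {m : E → EReal} {η μ a b : ℝ} {x₀ : E} {z₀ : E₂}

lemma add_inner_linModel_le (hz₀ : ∀ (u : E₂) (α : ℝ), h u ≤ α → a + inner ℝ z₀ (u - F x₀) ≤ α)
    (hw₀ : ∀ (y : E) (β : ℝ), m y ≤ β →
      b - inner ℝ z₀ (fderiv ℝ F x₀ (y - x₀)) - μ / 2 * ‖y - x₀‖ ^ 2 ≤ β)
    {x y : E} {α β : ℝ} (hα : h (linModel F x y) ≤ α) (hβ : m y ≤ β) :
    a + b + inner ℝ z₀ (linModel F x x₀ - F x₀)
      + inner ℝ z₀ ((fderiv ℝ F x - fderiv ℝ F x₀) (y - x₀)) - μ / 2 * ‖y - x₀‖ ^ 2 ≤ α + β := by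
  have hα' := hz₀ _ _ hα
  have hβ' := hw₀ _ _ hβ
  rw [← sub_add_sub_cancel _ (linModel F x x₀), linModel_sub, inner_add_right] at hα'
  rw [sub_apply, inner_sub_right z₀ (fderiv ℝ F x (y - x₀))]
  linarith

lemma mul_norm_sq_sub_le_add_proximal_term
    (hz₀ : ∀ (u : E₂) (α : ℝ), h u ≤ α → a + inner ℝ z₀ (u - F x₀) ≤ α)
    (hw₀ : ∀ (y : E) (β : ℝ), m y ≤ β →
      b - inner ℝ z₀ (fderiv ℝ F x₀ (y - x₀)) - μ / 2 * ‖y - x₀‖ ^ 2 ≤ β)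
    (hη : 0 < η) {x c y : E} {α β : ℝ} (hα : h (linModel F x y) ≤ α) (hβ : m y ≤ β) :
    (η⁻¹ - μ) / 2 * ‖y - x₀‖ ^ 2
      - (‖z₀‖ * ‖fderiv ℝ F x - fderiv ℝ F x₀‖ + η⁻¹ * ‖c - x₀‖) * ‖y - x₀‖
      + (a + b + inner ℝ z₀ (linModel F x x₀ - F x₀)) ≤ α + β + 1 / (2 * η) * ‖y - c‖ ^ 2 := by
  have hval := add_inner_linModel_le hz₀ hw₀ hα hβ
  have hslope : -(‖z₀‖ * (‖fderiv ℝ F x - fderiv ℝ F x₀‖ * ‖y - x₀‖)) ≤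
      inner ℝ z₀ ((fderiv ℝ F x - fderiv ℝ F x₀) (y - x₀)) :=
    (neg_le_neg (mul_le_mul_of_nonneg_left (ContinuousLinearMap.le_opNorm _ _)
      (norm_nonneg z₀))).trans (abs_le.1 (abs_real_inner_le_norm _ _)).1
  have hprox : η⁻¹ / 2 * ‖y - x₀‖ ^ 2 - η⁻¹ * (‖c - x₀‖ * ‖y - x₀‖) ≤
      1 / (2 * η) * ‖y - c‖ ^ 2 := by
    have hsq : ‖y - x₀‖ ^ 2 - 2 * (‖c - x₀‖ * ‖y - x₀‖) ≤ ‖y - c‖ ^ 2 := by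
      rw [← sub_sub_sub_cancel_right y c x₀, norm_sub_sq_real (y - x₀)]
      linarith [sq_nonneg ‖c - x₀‖, real_inner_le_norm (y - x₀) (c - x₀)]
    refine le_of_eq_of_le ?_ (mul_le_mul_of_nonneg_left hsq (one_div_pos.2 (by positivity)).le)
    field_simp
  linarith

lemma sub_le_add_proximal_term
    (hz₀ : ∀ (u : E₂) (α : ℝ), h u ≤ α → a + inner ℝ z₀ (u - F x₀) ≤ α)
    (hw₀ : ∀ (y : E) (β : ℝ), m y ≤ β →
      b - inner ℝ z₀ (fderiv ℝ F x₀ (y - x₀)) - μ / 2 * ‖y - x₀‖ ^ 2 ≤ β)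
    (hη : 0 < η) (hμ : μ < η⁻¹) {x c y : E} {α β : ℝ} (hα : h (linModel F x y) ≤ α) (hβ : m y ≤ β)
    (hlin : ‖linModel F x x₀ - F x₀‖ ≤ 1) (hdF : ‖fderiv ℝ F x - fderiv ℝ F x₀‖ ≤ 1)
    (hc : ‖c - x₀‖ ≤ 1) :
    a + b - ‖z₀‖ - (‖z₀‖ + η⁻¹) ^ 2 / (2 * (η⁻¹ - μ)) ≤
      α + β + 1 / (2 * η) * ‖y - c‖ ^ 2 := by
  have hval := mul_norm_sq_sub_le_add_proximal_term (c := c) hz₀ hw₀ hη hα hβ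
  have hshift : -‖z₀‖ ≤ inner ℝ z₀ (linModel F x x₀ - F x₀) :=
    (neg_le_neg (mul_le_of_le_one_right (norm_nonneg z₀) hlin)).trans
      (abs_le.1 (abs_real_inner_le_norm _ _)).1
  have hslope : (‖z₀‖ * ‖fderiv ℝ F x - fderiv ℝ F x₀‖ + η⁻¹ * ‖c - x₀‖) * ‖y - x₀‖ ≤
      (‖z₀‖ + η⁻¹) * ‖y - x₀‖ := by
    gcongr
    · exact mul_le_of_le_one_right (norm_nonneg z₀) hdF
    · exact mul_le_of_le_one_right (by positivity) hc
  linarith [neg_sq_div_le_mul_sq_sub_mul (sub_pos.2 hμ) (‖z₀‖ + η⁻¹) ‖y - x₀‖]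

end LowerBound

namespace CompositeProblem

variable {E E₂ : Type*} [NormedAddCommGroup E] [InnerProductSpace ℝ E] [FiniteDimensional ℝ E]
  [NormedAddCommGroup E₂] [InnerProductSpace ℝ E₂] [FiniteDimensional ℝ E₂]
  {k j : ℕ} {F : E → E₂} {h : E₂ → EReal} {m : E → EReal} {η μ : ℝ}
  {x₀ : E} {M : Set E} {K : Set E₂} {G : E → EuclideanSpace ℝ (Fin k)}
  {H : E₂ → EuclideanSpace ℝ (Fin j)} {φ : E → ℝ} {χ : E₂ → ℝ}

lemma exists_primalDual (P : CompositeProblem F h m η μ x₀ M K G H φ χ) :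
    ∃ Z : ℝ, ∀ᶠ p : E × E in 𝓝 0, ∃ (y : E) (z : E₂) (α β : ℝ),
      IsPrimalDual F h m η μ (x₀ + p.1) (x₀ + p.2) y z α β ∧ ‖z‖ ≤ Z := by
  obtain ⟨r, hr, hfeas⟩ := P.exists_bounded_feasible
  obtain ⟨z₀, hz₀, hw₀⟩ := P.exists_base_multiplier
  have hη := P.eta_pos
  set C : ℝ := χ (F x₀) + φ x₀ + 2 + 1 / (2 * η) * 2 ^ 2
  set V : ℝ := χ (F x₀) + φ x₀ - ‖z₀‖ - (‖z₀‖ + η⁻¹) ^ 2 / (2 * (η⁻¹ - μ))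
  refine ⟨(C - V) / r, ?_⟩
  have hlin : Continuous fun p : E × E => ‖linModel F (x₀ + p.1) x₀ - F x₀‖ :=
    ((P.continuous_linModel.comp (f := fun p : E × E => (x₀ + p.1, x₀)) (by fun_prop)).sub
      continuous_const).norm
  have hdF : Continuous fun p : E × E => ‖fderiv ℝ F (x₀ + p.1) - fderiv ℝ F x₀‖ :=
    ((P.continuous_fderiv.comp (f := fun p : E × E => x₀ + p.1) (by fun_prop)).sub
      continuous_const).norm
  filter_upwards [(hlin.tendsto' 0 0 (by simp [linModel])).eventually (gt_mem_nhds one_pos),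
    (hdF.tendsto' 0 0 (by simp)).eventually (gt_mem_nhds one_pos),
    Metric.ball_mem_nhds (0 : E × E) (lt_min one_pos hr)] with p hlinp hdFp hp
  rw [mem_ball_zero_iff, lt_min_iff] at hp
  have hp₂ : ‖p.2‖ ≤ 1 := (norm_snd_le p).trans hp.1.le
  obtain ⟨y, z, α, β, hpd, hzr⟩ := exists_isPrimalDual (x := x₀ + p.1) (c := x₀ + p.2) (C := C)
    P.convex_h P.lsc_h P.ne_bot_h P.convex_m P.lsc_m P.ne_bot_m hη P.mu_lt hr fun e he => by
      obtain ⟨y, α, β, hα, hβ, hle, hy⟩ :=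
        hfeas (x₀ + p.1) (by simpa using (norm_fst_le p).trans_lt hp.2) e he
      have hdist : ‖y - (x₀ + p.2)‖ ≤ 2 := by
        rw [← sub_sub]
        exact (norm_sub_le _ _).trans (by linarith)
      exact ⟨y, α, β, hα, hβ, by simp only [C]; gcongr⟩
  refine ⟨y, z, α, β, hpd, (le_div_iff₀ hr).2 (hzr.trans (sub_le_sub_left ?_ C))⟩
  exact sub_le_add_proximal_term hz₀ hw₀ hη P.mu_lt hpd.h_eq.le hpd.m_eq.le hlinp.le hdFp.le
    (by simpa using hp₂)

end CompositeProblem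

section Expansion

variable {X Y ι : Type*} [NormedAddCommGroup X] {l : Filter ι} {g : ι → ℝ}

lemma tendsto_const_add_of_isBigO (x₀ : X) {d : ι → X} (hg : Tendsto g l (𝓝 0)) (hd : d =O[l] g) :
    Tendsto (fun i => x₀ + d i) l (𝓝 x₀) := by
  simpa using tendsto_const_nhds.add (hd.trans_tendsto hg)

lemma isLittleO_sq_self (hg : Tendsto g l (𝓝 0)) : (fun i => g i ^ 2) =o[l] g := by
  simpa [sq] using (isBigO_refl g l).mul_isLittleO ((isLittleO_one_iff ℝ).2 hg)

variable [NormedSpace ℝ X] [NormedAddCommGroup Y] [NormedSpace ℝ Y]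

lemma isLittleO_taylor_two_comp {f : X → Y} {x₀ : X} (hf : ContDiffAt ℝ 2 f x₀) {d : ι → X}
    (hg : Tendsto g l (𝓝 0)) (hd : d =O[l] g) :
    (fun i => f (x₀ + d i) - f x₀ - fderiv ℝ f x₀ (d i)
      - (1 / 2 : ℝ) • fderiv ℝ (fderiv ℝ f) x₀ (d i) (d i)) =o[l] fun i => g i ^ 2 := by
  have htaylor := (isLittleO_taylor_two hf).comp_tendsto (tendsto_const_add_of_isBigO x₀ hg hd)
  simp only [Function.comp_def, add_sub_cancel_left] at htaylor
  exact htaylor.trans_isBigO (hd.norm_left.pow 2)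

lemma isLittleO_fderiv_sub {F : X → Y} {x₀ : X} (hF : DifferentiableAt ℝ (fderiv ℝ F) x₀)
    {ξ : ι → X} (hg : Tendsto g l (𝓝 0)) (hξ : ξ =O[l] g) :
    (fun i => fderiv ℝ F (x₀ + ξ i) - fderiv ℝ F x₀ - fderiv ℝ (fderiv ℝ F) x₀ (ξ i))
      =o[l] g := by
  have hderiv := hF.hasFDerivAt.isLittleO.comp_tendsto (tendsto_const_add_of_isBigO x₀ hg hξ)
  simp only [Function.comp_def, add_sub_cancel_left] at hderiv
  exact hderiv.trans_isBigO hξ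

variable {E E₂ : Type*} [NormedAddCommGroup E] [InnerProductSpace ℝ E]
  [NormedAddCommGroup E₂] [InnerProductSpace ℝ E₂] {F : E → E₂} {φ : E → ℝ} {χ : E₂ → ℝ} {x₀ : E}
  {z₀ : E₂} {ξ γ d : ι → E}

lemma isLittleO_linModel (hF : ContDiff ℝ 2 F) (hg : Tendsto g l (𝓝 0)) (hξ : ξ =O[l] g)
    (hd : d =O[l] g) :
    (fun i => linModel F (x₀ + ξ i) (x₀ + d i) - F x₀ - fderiv ℝ F x₀ (d i)
      - fderiv ℝ (fderiv ℝ F) x₀ (ξ i) (d i)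
      + (1 / 2 : ℝ) • fderiv ℝ (fderiv ℝ F) x₀ (ξ i) (ξ i)) =o[l] fun i => g i ^ 2 := by
  have hdF : DifferentiableAt ℝ (fderiv ℝ F) x₀ :=
    (hF.fderiv_right (m := 1) (by norm_num)).differentiable one_ne_zero x₀
  have hslope := isLittleO_bilin (ContinuousLinearMap.id ℝ (E →L[ℝ] E₂))
    (isLittleO_fderiv_sub hdF hg hξ) (hd.sub hξ)
  simp only [← sq] at hslope
  refine ((isLittleO_taylor_two_comp (x₀ := x₀) hF.contDiffAt hg hξ).add hslope).congr_left
    fun i => ?_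
  simp only [linModel, add_sub_add_left_eq_sub, ContinuousLinearMap.id_apply, sub_apply, map_sub]
  module

lemma isBigO_linModel (hF : ContDiff ℝ 2 F) (hg : Tendsto g l (𝓝 0)) (hξ : ξ =O[l] g)
    (hd : d =O[l] g) :
    (fun i => linModel F (x₀ + ξ i) (x₀ + d i) - F x₀ - fderiv ℝ F x₀ (d i))
      =O[l] fun i => g i ^ 2 := by
  have hξd := isBigO_bilin (fderiv ℝ (fderiv ℝ F) x₀) hξ hd
  have hξξ := (isBigO_bilin (fderiv ℝ (fderiv ℝ F) x₀) hξ hξ).const_smul_left (1 / 2 : ℝ)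
  simp only [← sq] at hξd hξξ
  refine (((isLittleO_linModel (x₀ := x₀) hF hg hξ hd).isBigO.add hξd).sub hξξ).congr_left
    fun i => ?_
  simp only [Pi.smul_apply]
  abel

/-- The real inner product as a continuous bilinear map: `innerSL ℝ`, whose type mentions the
trivial conjugation of `ℝ`, retyped. -/
noncomputable def realInnerCLM (E : Type*) [NormedAddCommGroup E] [InnerProductSpace ℝ E] :
    E →L[ℝ] E →L[ℝ] ℝ := innerSL ℝ

/-- The Hessian at `x₀` of the Lagrangian `φ + χ ∘ (linear part of F) + (2 η)⁻¹ ‖·‖ ^ 2` of the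
proximal linear subproblem. The curvature of `F` is absent because the subproblem linearizes it. -/
noncomputable def lagrangianHessian (F : E → E₂) (φ : E → ℝ) (χ : E₂ → ℝ) (η : ℝ) (x₀ : E) :
    E →L[ℝ] E →L[ℝ] ℝ :=
  fderiv ℝ (fderiv ℝ φ) x₀
    + (fderiv ℝ (fderiv ℝ χ) (F x₀)).bilinearComp (fderiv ℝ F x₀) (fderiv ℝ F x₀)
    + η⁻¹ • realInnerCLM E

lemma lagrangianHessian_apply (F : E → E₂) (φ : E → ℝ) (χ : E₂ → ℝ) (η : ℝ) (x₀ a b : E) :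
    lagrangianHessian F φ χ η x₀ a b = fderiv ℝ (fderiv ℝ φ) x₀ a b
      + fderiv ℝ (fderiv ℝ χ) (F x₀) (fderiv ℝ F x₀ a) (fderiv ℝ F x₀ b)
      + η⁻¹ * inner ℝ a b := rfl

lemma lagrangianHessian_symm {η : ℝ} (hφ : ContDiffAt ℝ 2 φ x₀) (hχ : ContDiffAt ℝ 2 χ (F x₀))
    (a b : E) : lagrangianHessian F φ χ η x₀ a b = lagrangianHessian F φ χ η x₀ b a := by
  rw [lagrangianHessian_apply, lagrangianHessian_apply, real_inner_comm,
    (hφ.isSymmSndFDerivAt (by simp)).eq, (hχ.isSymmSndFDerivAt (by simp)).eq]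

/-- How the linear part of the proximal linear subproblem depends on the displacement `(ξ, γ)` of
the model centre and the proximal centre from `x₀`. -/
noncomputable def centreForm (F : E → E₂) (z₀ : E₂) (η : ℝ) (x₀ : E) :
    E × E →L[ℝ] E →L[ℝ] ℝ :=
  η⁻¹ • (realInnerCLM E ∘L .snd ℝ E E)
    - ContinuousLinearMap.compL ℝ E E₂ ℝ (innerSL ℝ z₀) ∘L fderiv ℝ (fderiv ℝ F) x₀ ∘L .fst ℝ E E

lemma centreForm_apply (F : E → E₂) (z₀ : E₂) (η : ℝ) (x₀ : E) (p : E × E) (d : E) :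
    centreForm F z₀ η x₀ p d =
      η⁻¹ * inner ℝ p.2 d - inner ℝ z₀ (fderiv ℝ (fderiv ℝ F) x₀ p.1 d) := rfl

lemma isLittleO_comp_linModel (hF : ContDiff ℝ 2 F) (hχ : ContDiffAt ℝ 2 χ (F x₀))
    (hg : Tendsto g l (𝓝 0)) (hξ : ξ =O[l] g) (hd : d =O[l] g) :
    (fun i => χ (linModel F (x₀ + ξ i) (x₀ + d i)) - χ (F x₀)
      - fderiv ℝ χ (F x₀) (fderiv ℝ F x₀ (d i) + fderiv ℝ (fderiv ℝ F) x₀ (ξ i) (d i)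
        - (1 / 2 : ℝ) • fderiv ℝ (fderiv ℝ F) x₀ (ξ i) (ξ i))
      - 1 / 2 * fderiv ℝ (fderiv ℝ χ) (F x₀) (fderiv ℝ F x₀ (d i)) (fderiv ℝ F x₀ (d i)))
      =o[l] fun i => g i ^ 2 := by
  set A := fderiv ℝ F x₀
  set u : ι → E₂ := fun i => linModel F (x₀ + ξ i) (x₀ + d i) - F x₀ with hu
  have hAd : (fun i => A (d i)) =O[l] g := (A.isBigO_comp d l).trans hd
  have huA : (fun i => u i - A (d i)) =o[l] g :=
    (isBigO_linModel hF hg hξ hd).trans_isLittleO (isLittleO_sq_self hg)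
  have hug : u =O[l] g := by simpa using huA.isBigO.add hAd
  have hlin := ((fderiv ℝ χ (F x₀)).isBigO_comp _ l).trans_isLittleO
    (isLittleO_linModel (x₀ := x₀) hF hg hξ hd)
  have hleft := isLittleO_bilin (fderiv ℝ (fderiv ℝ χ) (F x₀)) huA hug
  have hright := isLittleO_bilin (fderiv ℝ (fderiv ℝ χ) (F x₀)).flip huA hAd
  simp only [← sq] at hleft hright
  refine (((isLittleO_taylor_two_comp hχ hg hug).add hlin).add
    ((hleft.add hright).const_mul_left (1 / 2))).congr_left fun i => ?_
  rw [show F x₀ + u i = linModel F (x₀ + ξ i) (x₀ + d i) from add_sub_cancel _ _]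
  simp only [hu, map_add, map_sub, map_smul, sub_apply, ContinuousLinearMap.flip_apply,
    smul_eq_mul]
  ring

/-- The objective of the subproblem with model centre `x₀ + ξ` and proximal centre `x₀ + γ`, at the
point `x₀ + d`, with `m` and `h` replaced by the smooth functions `φ` and `χ` representing them on
the active manifolds. -/
noncomputable def smoothObjective (F : E → E₂) (φ : E → ℝ) (χ : E₂ → ℝ) (η : ℝ) (x₀ ξ γ d : E) :
    ℝ :=
  φ (x₀ + d) + χ (linModel F (x₀ + ξ) (x₀ + d)) + 1 / (2 * η) * ‖d - γ‖ ^ 2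

/-- The second-order expansion of `smoothObjective` at `x₀`, when `z₀` is the gradient of `χ` at
`F x₀` and the first-order terms of `φ` and `χ ∘ F` cancel. -/
noncomputable def quadraticObjective (F : E → E₂) (φ : E → ℝ) (χ : E₂ → ℝ) (z₀ : E₂) (η : ℝ)
    (x₀ ξ γ d : E) : ℝ :=
  χ (F x₀) + φ x₀ + (1 / 2 * lagrangianHessian F φ χ η x₀ d d - centreForm F z₀ η x₀ (ξ, γ) d)
    + (1 / (2 * η) * ‖γ‖ ^ 2 - 1 / 2 * inner ℝ z₀ (fderiv ℝ (fderiv ℝ F) x₀ ξ ξ))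

lemma isLittleO_smoothObjective_sub {η : ℝ} (hF : ContDiff ℝ 2 F) (hφ : ContDiffAt ℝ 2 φ x₀)
    (hχ : ContDiffAt ℝ 2 χ (F x₀)) (hφ' : fderiv ℝ φ x₀ = -(innerSL ℝ z₀ ∘L fderiv ℝ F x₀))
    (hχ' : fderiv ℝ χ (F x₀) = innerSL ℝ z₀) (hg : Tendsto g l (𝓝 0)) (hξ : ξ =O[l] g)
    (hd : d =O[l] g) :
    (fun i => smoothObjective F φ χ η x₀ (ξ i) (γ i) (d i)
      - quadraticObjective F φ χ z₀ η x₀ (ξ i) (γ i) (d i)) =o[l] fun i => g i ^ 2 := by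
  refine ((isLittleO_taylor_two_comp hφ hg hd).add
    (isLittleO_comp_linModel hF hχ hg hξ hd)).congr_left fun i => ?_
  rw [quadraticObjective, hφ', hχ', lagrangianHessian_apply, centreForm_apply, smoothObjective,
    norm_sub_sq_real, real_inner_self_eq_norm_sq, real_inner_comm (d i) (γ i),
    show 1 / (2 * η) = 1 / 2 * η⁻¹ by rw [one_div, mul_inv, one_div]]
  simp only [neg_apply, ContinuousLinearMap.comp_apply, innerSL_apply_apply, inner_add_right,
    inner_sub_right, inner_smul_right, smul_eq_mul]
  ring

end Expansion

lemma le_mul_of_mul_sq_le {κ a b n D : ℝ} (hκ : 0 < κ) (ha : 0 ≤ a) (hb : 0 ≤ b) (hn : 0 ≤ n)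
    (h : κ * D ^ 2 ≤ a * n ^ 2 + b * (n * D)) : D ≤ ((a + b) / κ + 1) * n := by
  by_contra! hlt
  have hab : 0 ≤ (a + b) / κ * n := by positivity
  have hnD : n ≤ D := by linarith
  have hD : 0 < D := by linarith
  have hlt' : (a + b) * n < κ * D := by
    rw [← mul_div_cancel₀ (a + b) hκ.ne', mul_assoc]
    exact mul_lt_mul_of_pos_left (by linarith) hκ
  have han : a * n * n ≤ a * n * D := by gcongr
  linarith [mul_lt_mul_of_pos_right hlt' hD]

section SolutionMap

variable {E E₂ : Type*} [NormedAddCommGroup E] [NormedAddCommGroup E₂]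

lemma isBigO_fst_norm (l : Filter (E × E₂)) : (fun p : E × E₂ => p.1) =O[l] fun p => ‖p‖ :=
  isBigO_fst_prod'.norm_right

lemma isBigO_snd_norm (l : Filter (E × E₂)) : (fun p : E × E₂ => p.2) =O[l] fun p => ‖p‖ :=
  isBigO_snd_prod'.norm_right

variable [InnerProductSpace ℝ E] [InnerProductSpace ℝ E₂]
  {F : E → E₂} {h : E₂ → EReal} {m : E → EReal} {η μ : ℝ} {x₀ : E}

section Optimality

variable {x c y : E} {z : E₂} {α β : ℝ}

lemma IsPrimalDual.mem_subdiff_h (hpd : IsPrimalDual F h m η μ x c y z α β) :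
    z ∈ subdiff h (linModel F x y) :=
  mem_subdiff_of_forall_le (C := 0) hpd.h_eq fun u a ha => by simpa using hpd.h_le u a ha

variable [CompleteSpace E] [CompleteSpace E₂]

lemma IsPrimalDual.mem_subdiff_m (hpd : IsPrimalDual F h m η μ x c y z α β) :
    -(ContinuousLinearMap.adjoint (fderiv ℝ F x) z) - η⁻¹ • (y - c) ∈ subdiff m y :=
  mem_subdiff_of_forall_le (C := 1 / (2 * η)) hpd.m_eq fun y' b hb => by
    rw [inner_sub_left, inner_neg_left, ContinuousLinearMap.adjoint_inner_left,
      real_inner_smul_left]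
    linarith [hpd.m_le y' b hb]

lemma norm_adjoint_add_le (A B : E →L[ℝ] E₂) (z : E₂) (w : E) :
    ‖ContinuousLinearMap.adjoint A z + (-(ContinuousLinearMap.adjoint B z) - w)‖ ≤
      ‖B - A‖ * ‖z‖ + ‖w‖ := by
  have hsplit : ContinuousLinearMap.adjoint A z + (-(ContinuousLinearMap.adjoint B z) - w) =
      -(ContinuousLinearMap.adjoint (B - A) z + w) := by
    rw [map_sub, sub_apply]; abel
  rw [hsplit, norm_neg]
  refine (norm_add_le _ _).trans (add_le_add_left ?_ _)
  exact (ContinuousLinearMap.le_opNorm _ z).trans_eq (by rw [LinearIsometryEquiv.norm_map])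

end Optimality

variable [FiniteDimensional ℝ E] [FiniteDimensional ℝ E₂] {k j : ℕ} {M : Set E} {K : Set E₂}
  {G : E → EuclideanSpace ℝ (Fin k)} {H : E₂ → EuclideanSpace ℝ (Fin j)} {φ : E → ℝ} {χ : E₂ → ℝ}

lemma CompositeProblem.exists_competitor (P : CompositeProblem F h m η μ x₀ M K G H φ χ)
    {X : Type*} [NormedAddCommGroup X] [NormedSpace ℝ X] (Ξ D : X →L[ℝ] E)
    (hDG : ∀ q, fderiv ℝ G x₀ (D q) = 0)
    (hDH : ∀ q, fderiv ℝ H (F x₀) (fderiv ℝ F x₀ (D q)) = 0) :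
    ∃ d : X → E, (fun q => d q - D q) =o[𝓝 0] (fun q => ‖q‖) ∧ ∀ᶠ q in 𝓝 0,
      m (x₀ + d q) = φ (x₀ + d q) ∧
      h (linModel F (x₀ + Ξ q) (x₀ + d q)) = χ (linModel F (x₀ + Ξ q) (x₀ + d q)) := by
  obtain ⟨Y, Y', hY0, hY, htan, hsol⟩ := P.exists_feasible
  let shift : X →L[ℝ] E₂ × E × E := (0 : X →L[ℝ] E₂).prod (Ξ.prod D)
  set centre : X → E₂ × E × E := fun q => (0, x₀, 0) + shift q with hcentre
  have hcentre0 : centre 0 = (0, x₀, 0) := by simp [hcentre]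
  have hcentre' : HasFDerivAt centre shift 0 := shift.hasFDerivAt.const_add _
  have hD : Y' ∘L shift = D := by
    ext q
    exact htan (Ξ q) (D q) (hDG q) (hDH q)
  have hYd : HasFDerivAt (Y ∘ centre) D 0 := hD ▸ (hcentre0 ▸ hY).comp 0 hcentre'
  have hcentret : Tendsto centre (𝓝 0) (𝓝 (0, x₀, 0)) := hcentre0 ▸ hcentre'.continuousAt.tendsto
  have hY0' : Y (centre 0) = x₀ := hcentre0 ▸ hY0
  have hYt : Tendsto (Y ∘ centre) (𝓝 0) (𝓝 x₀) := by
    simpa only [Function.comp_apply, hY0'] using hYd.continuousAt.tendsto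
  have hVt := (P.continuous_linModel.tendsto (x₀, x₀)).comp
    ((Continuous.tendsto' (f := fun q => x₀ + Ξ q) (by fun_prop) 0 x₀ (by simp)).prodMk_nhds hYt)
  simp only [linModel_self] at hVt
  refine ⟨fun q => Y (centre q) - x₀, ?_, ?_⟩
  · simpa [hY0'] using hYd.isLittleO.norm_right
  · filter_upwards [hcentret.eventually hsol, hYt.eventually P.modelM.eq_on,
      hVt.eventually P.modelK.eq_on] with q ⟨hGq, hHq⟩ hm hh
    rw [add_sub_cancel]
    exact ⟨hm hGq, hh (by simpa [hcentre, shift] using hHq)⟩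

/-- A choice of primal-dual solutions of all subproblems with centres `x₀ + p.1`, `x₀ + p.2` near a
critical point, with multipliers bounded and the local models normalized: `z₀` is a multiplier at
`x₀`, and `φ`, `χ` have the subgradients belonging to `z₀` as their gradients. -/
structure SolutionFamily (F : E → E₂) (h : E₂ → EReal) (m : E → EReal) (η μ : ℝ)
    (x₀ : E) (M : Set E) (K : Set E₂) (G : E → EuclideanSpace ℝ (Fin k))
    (H : E₂ → EuclideanSpace ℝ (Fin j)) (φ : E → ℝ) (χ : E₂ → ℝ) (z₀ : E₂)
    (y : E × E → E) (z : E × E → E₂) (α β : E × E → ℝ) : Prop where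
  problem : CompositeProblem F h m η μ x₀ M K G H φ χ
  base_h : ∀ (u : E₂) (a : ℝ), h u ≤ a → χ (F x₀) + inner ℝ z₀ (u - F x₀) ≤ a
  base_m : ∀ (y : E) (b : ℝ), m y ≤ b →
    φ x₀ - inner ℝ z₀ (fderiv ℝ F x₀ (y - x₀)) - μ / 2 * ‖y - x₀‖ ^ 2 ≤ b
  fderiv_m : fderiv ℝ φ x₀ = -(innerSL ℝ z₀ ∘L fderiv ℝ F x₀)
  fderiv_h : fderiv ℝ χ (F x₀) = innerSL ℝ z₀
  primalDual : ∀ᶠ p : E × E in 𝓝 0,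
    IsPrimalDual F h m η μ (x₀ + p.1) (x₀ + p.2) (y p) (z p) (α p) (β p)
  bounded : ∃ Z : ℝ, ∀ᶠ p in 𝓝 0, ‖z p‖ ≤ Z

lemma CompositeProblem.exists_solutionFamily
    (P : CompositeProblem F h m η μ x₀ M K G H φ χ) :
    ∃ φ' χ' z₀ y z α β, SolutionFamily F h m η μ x₀ M K G H φ' χ' z₀ y z α β := by
  obtain ⟨z₀, hz₀, hw₀⟩ := P.exists_base_multiplier
  have hz₀' : z₀ ∈ subdiff h (F x₀) :=
    mem_subdiff_of_forall_le (C := 0) P.modelK.apply_self fun u a ha => by simpa using hz₀ u a ha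
  have hw₀' : -(ContinuousLinearMap.adjoint (fderiv ℝ F x₀) z₀) ∈ subdiff m x₀ :=
    mem_subdiff_of_forall_le (C := μ / 2) P.modelM.apply_self fun y b hb => by
      rw [inner_neg_left, ContinuousLinearMap.adjoint_inner_left]
      simpa [sub_eq_add_neg] using hw₀ y b hb
  obtain ⟨φ', hφ', hφ'd⟩ := P.modelM.exists_fderiv_eq hw₀'
  obtain ⟨χ', hχ', hχ'd⟩ := P.modelK.exists_fderiv_eq hz₀'
  have hφφ' : φ' x₀ = φ x₀ := EReal.coe_injective (hφ'.apply_self.symm.trans P.modelM.apply_self)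
  have hχχ' : χ' (F x₀) = χ (F x₀) :=
    EReal.coe_injective (hχ'.apply_self.symm.trans P.modelK.apply_self)
  obtain ⟨Z, hZ⟩ := P.exists_primalDual
  obtain ⟨y, hy⟩ := hZ.choice
  obtain ⟨z, hz⟩ := hy.choice
  obtain ⟨α, hα⟩ := hz.choice
  obtain ⟨β, hβ⟩ := hα.choice
  refine ⟨φ', χ', z₀, y, z, α, β, { P with modelM := hφ', modelK := hχ' }, by rwa [hχχ'],
    by rwa [hφφ'], ?_, hχ'd, hβ.mono fun _ => And.left, Z, hβ.mono fun _ => And.right⟩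
  rw [hφ'd]
  ext a
  simp [ContinuousLinearMap.adjoint_inner_left]

namespace SolutionFamily

variable {z₀ : E₂} {y : E × E → E} {z : E × E → E₂} {α β : E × E → ℝ}

lemma eventually_growth (S : SolutionFamily F h m η μ x₀ M K G H φ χ z₀ y z α β) {d : E × E → E}
    (hd : ∀ᶠ p : E × E in 𝓝 0, m (x₀ + d p) = φ (x₀ + d p) ∧
      h (linModel F (x₀ + p.1) (x₀ + d p)) = χ (linModel F (x₀ + p.1) (x₀ + d p))) :
    ∀ᶠ p : E × E in 𝓝 0, α p + β p + 1 / (2 * η) * ‖y p - (x₀ + p.2)‖ ^ 2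
      + (η⁻¹ - μ) / 2 * ‖x₀ + d p - y p‖ ^ 2 ≤ smoothObjective F φ χ η x₀ p.1 p.2 (d p) := by
  filter_upwards [hd, S.primalDual] with p hdp hpd
  have hgrowth := hpd.growth _ _ _ hdp.2.le hdp.1.le
  rw [add_sub_add_left_eq_sub] at hgrowth
  rwa [smoothObjective, add_comm (φ _)]

lemma isLittleO_smoothObjective_sub (S : SolutionFamily F h m η μ x₀ M K G H φ χ z₀ y z α β)
    {ι : Type*} {l : Filter ι} {ξ γ d : ι → E} {g : ι → ℝ} (hg : Tendsto g l (𝓝 0))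
    (hξ : ξ =O[l] g) (hd : d =O[l] g) :
    (fun i => smoothObjective F φ χ η x₀ (ξ i) (γ i) (d i)
      - quadraticObjective F φ χ z₀ η x₀ (ξ i) (γ i) (d i)) =o[l] fun i => g i ^ 2 :=
  _root_.isLittleO_smoothObjective_sub S.problem.contDiff S.problem.modelM.contDiffAt
    S.problem.modelK.contDiffAt S.fderiv_m S.fderiv_h hg hξ hd

lemma isBigO_smoothObjective_sub (S : SolutionFamily F h m η μ x₀ M K G H φ χ z₀ y z α β)
    {d : E × E → E} (hd : d =O[𝓝 0] fun p => ‖p‖) :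
    (fun p : E × E => smoothObjective F φ χ η x₀ p.1 p.2 (d p) - (χ (F x₀) + φ x₀))
      =O[𝓝 0] fun p => ‖p‖ ^ 2 := by
  have hrem := (S.isLittleO_smoothObjective_sub (γ := fun p : E × E => p.2) tendsto_norm_zero
    (isBigO_fst_norm (𝓝 0)) hd).isBigO
  have hquad := (isBigO_bilin (lagrangianHessian F φ χ η x₀) hd hd).const_mul_left (1 / 2)
  have hlin := isBigO_bilin (centreForm F z₀ η x₀)
    ((isBigO_fst_norm (𝓝 0)).prod_left (isBigO_snd_norm (𝓝 0))) hd
  have hprox := ((isBigO_snd_norm (𝓝 (0 : E × E))).norm_left.pow 2).const_mul_left (1 / (2 * η))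
  have hcurv := (((innerSL ℝ z₀).isBigO_comp _ _).trans (isBigO_bilin (fderiv ℝ (fderiv ℝ F) x₀)
    (isBigO_fst_norm (𝓝 (0 : E × E))) (isBigO_fst_norm (𝓝 0)))).const_mul_left (1 / 2)
  simp only [← sq] at hquad hlin hcurv
  refine (hrem.add ((hquad.sub hlin).add (hprox.sub hcurv))).congr_left fun p => ?_
  simp only [quadraticObjective, innerSL_apply_apply]
  ring

/-- Strong convexity bounds `‖y p - x₀‖ ^ 2` by the excess of a feasible competitor over the affine
minorant given by `z₀`, which is of second order. -/
lemma isBigO_sub (S : SolutionFamily F h m η μ x₀ M K G H φ χ z₀ y z α β) :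
    (fun p => y p - x₀) =O[𝓝 0] fun p => ‖p‖ := by
  have P := S.problem
  obtain ⟨d, hd, hdv⟩ := P.exists_competitor (.fst ℝ E E) 0 (by simp) (by simp)
  have hdO : d =O[𝓝 0] fun p => ‖p‖ := by simpa using hd.isBigO
  have hshift : (fun p : E × E => inner ℝ z₀ (linModel F (x₀ + p.1) x₀ - F x₀)) =O[𝓝 0]
      fun p => ‖p‖ ^ 2 := by
    simpa using ((innerSL ℝ z₀).isBigO_comp _ _).trans
      (isBigO_linModel P.contDiff (x₀ := x₀) (d := fun _ : E × E => (0 : E))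
        tendsto_norm_zero (isBigO_fst_norm (𝓝 0)) (isBigO_zero _ _))
  have hdF : (fun p : E × E => fderiv ℝ F (x₀ + p.1) - fderiv ℝ F x₀) =O[𝓝 0]
      fun p => ‖p‖ := by
    have hdiff : DifferentiableAt ℝ (fderiv ℝ F) x₀ :=
      (P.contDiff.fderiv_right (m := 1) (by norm_num)).differentiable one_ne_zero x₀
    simpa using (isLittleO_fderiv_sub hdiff tendsto_norm_zero
      (isBigO_fst_norm (𝓝 (0 : E × E)))).isBigO.add
      (((fderiv ℝ (fderiv ℝ F) x₀).isBigO_comp _ _).trans (isBigO_fst_norm (𝓝 0)))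
  have hslope : (fun p : E × E => ‖z₀‖ * ‖fderiv ℝ F (x₀ + p.1) - fderiv ℝ F x₀‖
      + η⁻¹ * ‖x₀ + p.2 - x₀‖) =O[𝓝 0] fun p => ‖p‖ := by
    simpa only [add_sub_cancel_left] using
      (hdF.norm_left.const_mul_left ‖z₀‖).add ((isBigO_snd_norm (𝓝 0)).norm_left.const_mul_left η⁻¹)
  obtain ⟨C, hC, hgap⟩ := ((S.isBigO_smoothObjective_sub hdO).sub hshift).exists_pos
  obtain ⟨C', hC', hslope⟩ := hslope.exists_pos
  refine IsBigO.of_bound ((C + C') / ((η⁻¹ - μ) / 2) + 1) ?_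
  filter_upwards [hgap.bound, hslope.bound, S.eventually_growth hdv, S.primalDual]
    with p hgap hslope hgrowth hpd
  have hlow := mul_norm_sq_sub_le_add_proximal_term (c := x₀ + p.2) S.base_h S.base_m P.eta_pos
    hpd.h_eq.le hpd.m_eq.le
  rw [Real.norm_of_nonneg (sq_nonneg ‖p‖)] at hgap
  rw [norm_norm] at hslope ⊢
  have hκ := half_pos P.kappa_pos
  refine le_mul_of_mul_sq_le hκ hC.le hC'.le (norm_nonneg p) ?_
  have hslopeD := mul_le_mul_of_nonneg_right ((le_abs_self _).trans hslope) (norm_nonneg (y p - x₀))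
  have hdist : 0 ≤ (η⁻¹ - μ) / 2 * ‖x₀ + d p - y p‖ ^ 2 := by positivity
  linarith [(abs_le.1 hgap).2]

lemma tendsto_solution (S : SolutionFamily F h m η μ x₀ M K G H φ χ z₀ y z α β) :
    Tendsto y (𝓝 0) (𝓝 x₀) := by
  simpa using (S.isBigO_sub.trans_tendsto tendsto_norm_zero).add_const x₀

lemma tendsto_model (S : SolutionFamily F h m η μ x₀ M K G H φ χ z₀ y z α β) :
    Tendsto (fun p => linModel F (x₀ + p.1) (y p)) (𝓝 0) (𝓝 (F x₀)) := by
  have hcentre : Tendsto (fun p : E × E => x₀ + p.1) (𝓝 0) (𝓝 x₀) :=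
    Continuous.tendsto' (by fun_prop) _ _ (by simp)
  simpa [Function.comp_def, linModel_self] using
    (S.problem.continuous_linModel.tendsto (x₀, x₀)).comp
      (hcentre.prodMk_nhds S.tendsto_solution)

lemma tendsto_optimality_bound (S : SolutionFamily F h m η μ x₀ M K G H φ χ z₀ y z α β) (Z : ℝ) :
    Tendsto (fun p : E × E => ‖fderiv ℝ F (x₀ + p.1) - fderiv ℝ F x₀‖ * Z
      + ‖η⁻¹ • (y p - (x₀ + p.2))‖) (𝓝 0) (𝓝 0) := by
  have hdF : Tendsto (fun p : E × E => fderiv ℝ F (x₀ + p.1)) (𝓝 0) (𝓝 (fderiv ℝ F x₀)) :=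
    (S.problem.continuous_fderiv.comp (by fun_prop : Continuous fun p : E × E => x₀ + p.1)).tendsto'
      _ _ (by simp)
  have hcentre : Tendsto (fun p : E × E => x₀ + p.2) (𝓝 0) (𝓝 x₀) :=
    Continuous.tendsto' (by fun_prop) _ _ (by simp)
  simpa using ((hdF.sub_const (fderiv ℝ F x₀)).norm.mul_const Z).add
    ((S.tendsto_solution.sub hcentre).const_smul η⁻¹).norm

lemma eventually_mem (S : SolutionFamily F h m η μ x₀ M K G H φ χ z₀ y z α β) :
    ∀ᶠ p in 𝓝 0, y p ∈ M ∧ linModel F (x₀ + p.1) (y p) ∈ K := by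
  obtain ⟨c, hc, hsharp⟩ := S.problem.sharp
  obtain ⟨Z, hZ⟩ := S.bounded
  filter_upwards [(S.tendsto_solution.prodMk_nhds S.tendsto_model).eventually hsharp, hZ,
    S.primalDual, (S.tendsto_optimality_bound Z).eventually (gt_mem_nhds hc)]
    with p hsharp hZ hpd hsmall
  by_contra hnot
  have hle := (hsharp hnot _ hpd.mem_subdiff_h _ hpd.mem_subdiff_m).trans
    (norm_adjoint_add_le _ _ _ _)
  exact absurd hsmall (not_lt.2 (hle.trans (by gcongr)))

lemma eventually_active (S : SolutionFamily F h m η μ x₀ M K G H φ χ z₀ y z α β) :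
    ∀ᶠ p in 𝓝 0, (G (y p) = 0 ∧ H (linModel F (x₀ + p.1) (y p)) = 0) ∧ β p = φ (y p) ∧
      α p = χ (linModel F (x₀ + p.1) (y p)) := by
  have P := S.problem
  filter_upwards [S.eventually_mem, S.primalDual,
    S.tendsto_solution.eventually (P.modelM.mem_iff.and P.modelM.eq_on),
    S.tendsto_model.eventually (P.modelK.mem_iff.and P.modelK.eq_on)]
    with p ⟨hM, hK⟩ hpd ⟨hmemM, hm⟩ ⟨hmemK, hh⟩
  have hG := hmemM.1 hM
  have hH := hmemK.1 hK
  exact ⟨⟨hG, hH⟩, EReal.coe_injective (hpd.m_eq.symm.trans (hm hG)),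
    EReal.coe_injective (hpd.h_eq.symm.trans (hh hH))⟩

end SolutionFamily

end SolutionMap

section Asymptotic

variable {X Z ι : Type*} [NormedAddCommGroup X] [NormedSpace ℝ X] {l : Filter ι} {g : ι → ℝ}

lemma tendsto_inv_smul_of_isLittleO {d : ι → X} {a : X} (hd : (fun i => d i - g i • a) =o[l] g)
    (hg : ∀ᶠ i in l, g i ≠ 0) : Tendsto (fun i => (g i)⁻¹ • d i) l (𝓝 a) := by
  have hrem : Tendsto (fun i => (g i)⁻¹ • (d i - g i • a)) l (𝓝 0) := by
    rw [tendsto_zero_iff_norm_tendsto_zero]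
    refine (tendsto_zero_iff_norm_tendsto_zero.1 hd.norm_left.tendsto_div_nhds_zero).congr
      fun i => ?_
    rw [norm_smul, norm_inv, norm_div, norm_norm, div_eq_inv_mul]
  refine (by simpa using hrem.add_const a : Tendsto _ l (𝓝 a)).congr' ?_
  filter_upwards [hg] with i hi
  rw [smul_sub, inv_smul_smul₀ hi, sub_add_cancel]

lemma tendsto_div_sq_of_homogeneous {q : X → ℝ} (hq : Continuous q)
    (hhom : ∀ (t : ℝ) (v : X), q (t • v) = t ^ 2 * q v) {d : ι → X} {a : X}
    (hd : (fun i => d i - g i • a) =o[l] g) (hg : ∀ᶠ i in l, g i ≠ 0) :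
    Tendsto (fun i => q (d i) / g i ^ 2) l (𝓝 (q a)) := by
  refine ((hq.tendsto a).comp (tendsto_inv_smul_of_isLittleO hd hg)).congr fun i => ?_
  rw [Function.comp_apply, hhom, inv_pow, ← div_eq_inv_mul]

lemma nonpos_of_homogeneous_of_eventually_le [l.NeBot] {q : X → ℝ} (hq : Continuous q)
    (hhom : ∀ (t : ℝ) (v : X), q (t • v) = t ^ 2 * q v) {d : ι → X} {a : X} {e : ι → ℝ}
    (hd : (fun i => d i - g i • a) =o[l] g) (hg : ∀ᶠ i in l, g i ≠ 0)
    (he : e =o[l] fun i => g i ^ 2) (hle : ∀ᶠ i in l, q (d i) ≤ e i) : q a ≤ 0 := by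
  refine le_of_tendsto_of_tendsto (tendsto_div_sq_of_homogeneous hq hhom hd hg)
    he.tendsto_div_nhds_zero ?_
  filter_upwards [hle] with i hi
  gcongr

variable [NormedAddCommGroup Z] [NormedSpace ℝ Z]

lemma isLittleO_derivative_of_eventually_eq_zero {G : X → Z} {G' : X →L[ℝ] Z} {x₀ : X}
    (hG : HasFDerivAt G G' x₀) (hG₀ : G x₀ = 0) {v : ι → X} (hv : Tendsto v l (𝓝 x₀))
    (hvg : (fun i => v i - x₀) =O[l] g) (hzero : ∀ᶠ i in l, G (v i) = 0) :
    (fun i => G' (v i - x₀)) =o[l] g := by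
  refine ((hG.isLittleO.comp_tendsto hv).trans_isBigO hvg).neg_left.congr' ?_ .rfl
  filter_upwards [hzero] with i hi
  simp [hi, hG₀]

lemma exists_mem_ker_isLittleO_sub [CompleteSpace X] [FiniteDimensional ℝ Z] {A : X →L[ℝ] Z}
    (hA : Function.Surjective A) {δ : ι → X} (hδ : (fun i => A (δ i)) =o[l] g) :
    ∃ τ : ι → X, (∀ i, τ i ∈ A.ker) ∧ (fun i => δ i - τ i) =o[l] g := by
  obtain ⟨ρ, hρ⟩ := A.exists_rightInverse_of_surjective (LinearMap.range_eq_top.2 hA)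
  refine ⟨fun i => δ i - ρ (A (δ i)), fun i => ?_, ?_⟩
  · have hρ' : A (ρ (A (δ i))) = A (δ i) := DFunLike.congr_fun hρ _
    simp [hρ']
  · simpa using (ρ.isBigO_comp _ _).trans_isLittleO hδ

end Asymptotic

section ConstraintKernel

variable {E E₂ : Type*} [NormedAddCommGroup E] [InnerProductSpace ℝ E]
  [NormedAddCommGroup E₂] [InnerProductSpace ℝ E₂] {k j : ℕ} {F : E → E₂} {x₀ : E}
  {G : E → EuclideanSpace ℝ (Fin k)} {H : E₂ → EuclideanSpace ℝ (Fin j)}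

/-- The tangent space at `x₀` of `M ∩ F ⁻¹' K`, where `G` and `H` are local equations of `M` and
`K`. -/
noncomputable def constraintKernel (F : E → E₂) (G : E → EuclideanSpace ℝ (Fin k))
    (H : E₂ → EuclideanSpace ℝ (Fin j)) (x₀ : E) : Submodule ℝ E :=
  ((fderiv ℝ G x₀).prod (fderiv ℝ H (F x₀) ∘L fderiv ℝ F x₀)).ker

lemma mem_constraintKernel {a : E} : a ∈ constraintKernel F G H x₀ ↔
    fderiv ℝ G x₀ a = 0 ∧ fderiv ℝ H (F x₀) (fderiv ℝ F x₀ a) = 0 := by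
  simp [constraintKernel]

end ConstraintKernel

namespace SolutionFamily

variable {E E₂ : Type*} [NormedAddCommGroup E] [InnerProductSpace ℝ E] [FiniteDimensional ℝ E]
  [NormedAddCommGroup E₂] [InnerProductSpace ℝ E₂] [FiniteDimensional ℝ E₂]
  {k j : ℕ} {F : E → E₂} {h : E₂ → EReal} {m : E → EReal} {η μ : ℝ}
  {x₀ : E} {M : Set E} {K : Set E₂} {G : E → EuclideanSpace ℝ (Fin k)}
  {H : E₂ → EuclideanSpace ℝ (Fin j)} {φ : E → ℝ} {χ : E₂ → ℝ}
  {z₀ : E₂} {y : E × E → E} {z : E × E → E₂} {α β : E × E → ℝ}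

lemma coercive (S : SolutionFamily F h m η μ x₀ M K G H φ χ z₀ y z α β) {a : E}
    (ha : a ∈ constraintKernel F G H x₀) :
    (η⁻¹ - μ) * ‖a‖ ^ 2 ≤ lagrangianHessian F φ χ η x₀ a a := by
  set R := lagrangianHessian F φ χ η x₀
  obtain ⟨haG, haH⟩ := mem_constraintKernel.1 ha
  obtain ⟨d, hd, hdv⟩ := S.problem.exists_competitor (0 : ℝ →L[ℝ] E)
    (ContinuousLinearMap.toSpanSingleton ℝ a) (by simp [haG]) (by simp [haH])
  have hd : (fun t : ℝ => d t - t • a) =o[𝓝[>] 0] fun t : ℝ => t := by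
    simpa using (hd.mono (nhdsWithin_le_nhds (s := Set.Ioi 0))).of_norm_right
  have hdO : d =O[𝓝[>] 0] fun t : ℝ => t := by
    have hta : (fun t : ℝ => t • a) =O[𝓝[>] 0] fun t : ℝ => t :=
      IsBigO.of_bound ‖a‖ (Eventually.of_forall fun t => by rw [norm_smul, mul_comm])
    simpa using hd.isBigO.add hta
  have hexp := S.isLittleO_smoothObjective_sub (ξ := fun _ => 0) (γ := fun _ => 0)
    (tendsto_nhdsWithin_of_tendsto_nhds tendsto_id) (isBigO_zero _ _) hdO
  suffices hlim : (η⁻¹ - μ) / 2 * ‖a‖ ^ 2 - 1 / 2 * R a a ≤ 0 by linarith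
  refine nonpos_of_homogeneous_of_eventually_le
    (q := fun v => (η⁻¹ - μ) / 2 * ‖v‖ ^ 2 - 1 / 2 * R v v) (by fun_prop) (fun t v => ?_) hd
    (eventually_mem_nhdsWithin.mono fun _ ht => ne_of_gt ht) hexp ?_
  · simp only [norm_smul, mul_pow, Real.norm_eq_abs, sq_abs, map_smul, smul_apply, smul_eq_mul]
    ring
  · filter_upwards [hdv.filter_mono nhdsWithin_le_nhds] with t ht
    have hlow := mul_norm_sq_sub_le_add_proximal_term (c := x₀) S.base_h S.base_m
      S.problem.eta_pos ht.2.le ht.1.le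
    simp only [zero_apply, add_zero, sub_self, inner_zero_right, linModel_self,
      add_sub_cancel_left, norm_zero, mul_zero, zero_mul, sub_zero] at hlow
    simp only [smoothObjective, quadraticObjective, Prod.mk_zero_zero, map_zero, zero_apply,
      inner_zero_right, norm_zero, sub_zero, add_zero]
    linarith

lemma isLittleO_constraint (S : SolutionFamily F h m η μ x₀ M K G H φ χ z₀ y z α β) :
    (fun p => (fderiv ℝ G x₀).prod (fderiv ℝ H (F x₀) ∘L fderiv ℝ F x₀) (y p - x₀))
      =o[𝓝 0] fun p => ‖p‖ := by
  have P := S.problem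
  have hG : (fun p => fderiv ℝ G x₀ (y p - x₀)) =o[𝓝 0] fun p => ‖p‖ :=
    isLittleO_derivative_of_eventually_eq_zero P.modelM.hasStrictFDerivAt.hasFDerivAt
      P.modelM.eq_zero S.tendsto_solution S.isBigO_sub (S.eventually_active.mono fun _ hp => hp.1.1)
  have hlin : (fun p => linModel F (x₀ + p.1) (y p) - F x₀ - fderiv ℝ F x₀ (y p - x₀))
      =o[𝓝 0] fun p => ‖p‖ := by
    simpa using (isBigO_linModel P.contDiff (x₀ := x₀) tendsto_norm_zero
      (isBigO_fst_norm (𝓝 (0 : E × E))) S.isBigO_sub).trans_isLittleO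
      (isLittleO_sq_self tendsto_norm_zero)
  have hmodel : (fun p => linModel F (x₀ + p.1) (y p) - F x₀) =O[𝓝 0] fun p => ‖p‖ := by
    simpa using hlin.isBigO.add (((fderiv ℝ F x₀).isBigO_comp _ _).trans S.isBigO_sub)
  have hH : (fun p => fderiv ℝ H (F x₀) (fderiv ℝ F x₀ (y p - x₀))) =o[𝓝 0] fun p => ‖p‖ := by
    have hHmodel := isLittleO_derivative_of_eventually_eq_zero
      P.modelK.hasStrictFDerivAt.hasFDerivAt P.modelK.eq_zero S.tendsto_model hmodel
      (S.eventually_active.mono fun _ hp => hp.1.2)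
    simpa using hHmodel.sub (((fderiv ℝ H (F x₀)).isBigO_comp _ _).trans_isLittleO hlin)
  exact hG.prod_left hH

lemma isLittleO_solution (S : SolutionFamily F h m η μ x₀ M K G H φ χ z₀ y z α β)
    (D : E × E →L[ℝ] E) (hD : ∀ p, D p ∈ constraintKernel F G H x₀ ∧
      ∀ b ∈ constraintKernel F G H x₀,
        lagrangianHessian F φ χ η x₀ (D p) b = centreForm F z₀ η x₀ p b) :
    (fun p => y p - x₀ - D p) =o[𝓝 0] fun p => ‖p‖ := by
  have P := S.problem
  obtain ⟨d, hd, hdv⟩ := P.exists_competitor (.fst ℝ E E) D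
    (fun q => (mem_constraintKernel.1 (hD q).1).1) (fun q => (mem_constraintKernel.1 (hD q).1).2)
  have hdO : d =O[𝓝 0] fun p => ‖p‖ := by
    simpa using hd.isBigO.add (D.isBigO_id (𝓝 0)).norm_right
  have hexp {δ : E × E → E} (hδ : δ =O[𝓝 0] fun p => ‖p‖) :=
    S.isLittleO_smoothObjective_sub (γ := fun p : E × E => p.2) tendsto_norm_zero
      (isBigO_fst_norm (𝓝 0)) hδ
  obtain ⟨τ, hτ, hδτ⟩ := exists_mem_ker_isLittleO_sub P.surjective_constraint S.isLittleO_constraint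
  refine isLittleO_minimizer_sub
    (lagrangianHessian_symm P.modelM.contDiffAt P.modelK.contDiffAt) P.kappa_pos
    (fun a ha => S.coercive ha) (fun p => (hD p).1) (fun p => (hD p).2) S.isBigO_sub hτ hδτ hd
    ((hexp hdO).sub (hexp S.isBigO_sub)) ?_
  filter_upwards [S.eventually_active, S.eventually_growth hdv] with p ⟨_, hβ, hα⟩ hgrowth
  have hκ := P.kappa_pos
  have hdist : 0 ≤ (η⁻¹ - μ) / 2 * ‖x₀ + d p - y p‖ ^ 2 := by positivity
  have hvalue : smoothObjective F φ χ η x₀ p.1 p.2 (y p - x₀) =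
      α p + β p + 1 / (2 * η) * ‖y p - (x₀ + p.2)‖ ^ 2 := by
    rw [smoothObjective, add_sub_cancel, hα, hβ, sub_sub, add_comm (φ _)]
  rw [hvalue]
  simp only [quadraticObjective]
  linarith

end SolutionFamily

section SecondDifference

variable {E E₂ : Type*} [NormedAddCommGroup E] [NormedSpace ℝ E] [NormedAddCommGroup E₂]
  [NormedSpace ℝ E₂] {F : E → E₂} {x₀ : E}

lemma isLittleO_smul_sub_smul {X : Type*} [NormedAddCommGroup X] [NormedSpace ℝ X] {ι : Type*}
    {l : Filter ι} (g : ι → ℝ) {w : ι → X} {u : X} (hw : Tendsto w l (𝓝 u)) :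
    (fun i => g i • w i - g i • u) =o[l] g := by
  simpa [smul_sub] using
    (isBigO_refl g l).smul_isLittleO ((isLittleO_one_iff ℝ).2 (tendsto_sub_nhds_zero_iff.2 hw))

lemma tendsto_second_difference (hF : ContDiffAt ℝ 2 F x₀) (u : E) :
    Tendsto (fun q : ℝ × E => (q.1 ^ 2)⁻¹ •
      (F (x₀ + q.1 • q.2) - F x₀ - fderiv ℝ F x₀ (q.1 • q.2))) (𝓝[≠] 0 ×ˢ 𝓝 u)
      (𝓝 ((1 / 2 : ℝ) • fderiv ℝ (fderiv ℝ F) x₀ u u)) := by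
  have hg : Tendsto (fun q : ℝ × E => q.1) (𝓝[≠] 0 ×ˢ 𝓝 u) (𝓝 0) :=
    tendsto_fst.mono_right nhdsWithin_le_nhds
  have hgw : (fun q : ℝ × E => q.1 • q.2) =O[𝓝[≠] 0 ×ˢ 𝓝 u] fun q => q.1 := by
    simpa using (isBigO_refl (fun q : ℝ × E => q.1) _).smul (tendsto_snd.isBigO_one ℝ)
  have hquad : Tendsto (fun q : ℝ × E => (1 / 2 : ℝ) • fderiv ℝ (fderiv ℝ F) x₀ q.2 q.2)
      (𝓝[≠] 0 ×ˢ 𝓝 u) (𝓝 ((1 / 2 : ℝ) • fderiv ℝ (fderiv ℝ F) x₀ u u)) :=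
    Continuous.tendsto (f := fun w : E => (1 / 2 : ℝ) • fderiv ℝ (fderiv ℝ F) x₀ w w)
      (by fun_prop) u |>.comp tendsto_snd
  refine tendsto_inv_smul_of_isLittleO (((isLittleO_taylor_two_comp hF hg hgw).add
    (isLittleO_smul_sub_smul (fun q : ℝ × E => q.1 ^ 2) hquad)).congr_left fun q => ?_)
    ((tendsto_fst.eventually eventually_mem_nhdsWithin).mono fun q hq => pow_ne_zero 2 hq)
  simp only [map_smul, smul_apply]
  module

end SecondDifference

section Instability

variable {E E₂ : Type*} [NormedAddCommGroup E] [InnerProductSpace ℝ E]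
  [NormedAddCommGroup E₂] [InnerProductSpace ℝ E₂]
  {k j : ℕ} {F : E → E₂} {h : E₂ → EReal} {m : E → EReal} {η μ : ℝ}
  {x₀ : E} {M : Set E} {K : Set E₂} {G : E → EuclideanSpace ℝ (Fin k)}
  {H : E₂ → EuclideanSpace ℝ (Fin j)} {φ : E → ℝ} {χ : E₂ → ℝ}

namespace IsPrimalDual

lemma growth_of_objective_le {x c y : E} {z : E₂} {α β : ℝ}
    (hpd : IsPrimalDual F h m η μ x c y z α β) (hh : ∀ u, h u ≠ ⊥) (hm : ∀ x, m x ≠ ⊥)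
    {w : E} {a : ℝ}
    (hw : h (linModel F x w) + m w + ((1 / (2 * η) * ‖w - c‖ ^ 2 : ℝ) : EReal) ≤ a) :
    α + β + 1 / (2 * η) * ‖y - c‖ ^ 2 + (η⁻¹ - μ) / 2 * ‖w - y‖ ^ 2 ≤ a := by
  obtain ⟨_, _, hhm, hprox, hle⟩ := exists_coe_eq_add_le_of_add_le_coe
    (EReal.add_ne_bot_iff.2 ⟨hh _, hm _⟩) (EReal.coe_ne_bot _) hw
  obtain ⟨α', β', hα', hβ', hle'⟩ := exists_coe_eq_add_le_of_add_le_coe (hh _) (hm _) hhm.le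
  have hgrowth := hpd.growth w α' β' hα'.le hβ'.le
  have hprox' := EReal.coe_injective hprox
  linarith

lemma proxLinMap_eq {x y : E} {z : E₂} {α β : ℝ} (hpd : IsPrimalDual F h m η μ x x y z α β)
    (hκ : 0 < η⁻¹ - μ) (hh : ∀ u, h u ≠ ⊥) (hm : ∀ x, m x ≠ ⊥) : proxLinMap η h F m x = y := by
  let obj : E → EReal := fun w =>
    h (linModel F x w) + m w + ((1 / (2 * η) * ‖w - x‖ ^ 2 : ℝ) : EReal)
  have hy : obj y = ((α + β + 1 / (2 * η) * ‖y - x‖ ^ 2 : ℝ) : EReal) := by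
    simp only [obj, hpd.h_eq, hpd.m_eq, EReal.coe_add]
  have hmin : ∀ w, obj (proxLinMap η h F m x) ≤ obj w := by
    refine Classical.epsilon_spec (p := fun y' => ∀ w, obj y' ≤ obj w) ⟨y, fun w => ?_⟩
    rw [hy]
    refine coe_le_of_forall_le_coe fun a ha => ?_
    have hgrowth := hpd.growth_of_objective_le hh hm ha
    have hdist : 0 ≤ (η⁻¹ - μ) / 2 * ‖w - y‖ ^ 2 := by positivity
    linarith
  have hgrowth := hpd.growth_of_objective_le hh hm ((hmin y).trans hy.le)
  by_contra hne
  have hnorm := norm_pos_iff.2 (sub_ne_zero.2 hne)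
  have hdist : 0 < (η⁻¹ - μ) / 2 * ‖proxLinMap η h F m x - y‖ ^ 2 := by positivity
  linarith

lemma add_inner_sub_linModel_le {x c y : E} {z : E₂} {α β : ℝ}
    (hpd : IsPrimalDual F h m η μ x c y z α β) (hh : ∀ u, h u ≠ ⊥) (hm : ∀ x, m x ≠ ⊥)
    {w : E} {a : ℝ} (hw : h (F w) + m w ≤ a) :
    α + β + inner ℝ z (F w - linModel F x w) - η⁻¹ * inner ℝ (y - c) (w - y)
      - 1 / (2 * η) * ‖w - y‖ ^ 2 ≤ a := by
  obtain ⟨α', β', hα', hβ', hle⟩ := exists_coe_eq_add_le_of_add_le_coe (hh _) (hm _) hw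
  have hhle := hpd.h_le _ _ hα'.le
  have hmle := hpd.m_le _ _ hβ'.le
  have hmodel : F w - linModel F x y = F w - linModel F x w + fderiv ℝ F x (w - y) := by
    rw [← linModel_sub]
    abel
  rw [hmodel, inner_add_right] at hhle
  linarith

end IsPrimalDual

end Instability

section Multiplier

variable {E E₂ : Type*} [NormedAddCommGroup E] [InnerProductSpace ℝ E] [FiniteDimensional ℝ E]
  [NormedAddCommGroup E₂] [InnerProductSpace ℝ E₂] [FiniteDimensional ℝ E₂]
  {k j : ℕ} {F : E → E₂} {h : E₂ → EReal} {m : E → EReal} {η μ : ℝ}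
  {x₀ : E} {M : Set E} {K : Set E₂} {G : E → EuclideanSpace ℝ (Fin k)}
  {H : E₂ → EuclideanSpace ℝ (Fin j)} {φ : E → ℝ} {χ : E₂ → ℝ}

namespace SolutionFamily

variable {z₀ : E₂} {y : E × E → E} {z : E × E → E₂} {α β : E × E → ℝ}

lemma tendsto_value_h (S : SolutionFamily F h m η μ x₀ M K G H φ χ z₀ y z α β) :
    Tendsto α (𝓝 0) (𝓝 (χ (F x₀))) :=
  (S.problem.modelK.contDiffAt.continuousAt.tendsto.comp S.tendsto_model).congr'
    (S.eventually_active.mono fun _ hp => hp.2.2.symm)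

lemma tendsto_value_m (S : SolutionFamily F h m η μ x₀ M K G H φ χ z₀ y z α β) :
    Tendsto β (𝓝 0) (𝓝 (φ x₀)) :=
  (S.problem.modelM.contDiffAt.continuousAt.tendsto.comp S.tendsto_solution).congr'
    (S.eventually_active.mono fun _ hp => hp.2.1.symm)

lemma mem_subdiff_h_of_tendsto (S : SolutionFamily F h m η μ x₀ M K G H φ χ z₀ y z α β)
    {l : Filter (E × E)} [l.NeBot] (hl : l ≤ 𝓝 0) {z' : E₂} (hz' : Tendsto z l (𝓝 z')) :
    z' ∈ subdiff h (F x₀) := by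
  refine mem_subdiff_of_forall_le (C := 0) S.problem.modelK.apply_self fun u a ha => ?_
  have hlim := (S.tendsto_value_h.mono_left hl).add
    (hz'.inner (𝕜 := ℝ) ((S.tendsto_model.mono_left hl).const_sub u))
  simpa using le_of_tendsto hlim ((S.primalDual.filter_mono hl).mono fun p hp => hp.h_le u a ha)

lemma mem_subdiff_m_of_tendsto (S : SolutionFamily F h m η μ x₀ M K G H φ χ z₀ y z α β)
    {l : Filter (E × E)} [l.NeBot] (hl : l ≤ 𝓝 0) {z' : E₂} (hz' : Tendsto z l (𝓝 z')) :
    -(ContinuousLinearMap.adjoint (fderiv ℝ F x₀) z') ∈ subdiff m x₀ := by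
  refine mem_subdiff_of_forall_le (C := 1 / (2 * η)) S.problem.modelM.apply_self fun w b hb => ?_
  have hy := S.tendsto_solution.mono_left hl
  have hw := hy.const_sub w
  have hA : Tendsto (fun p : E × E => fderiv ℝ F (x₀ + p.1)) l (𝓝 (fderiv ℝ F x₀)) :=
    ((S.problem.continuous_fderiv.comp
      (continuous_const.add continuous_fst)).tendsto' 0 _ (by simp)).mono_left hl
  have hAw : Tendsto (fun p : E × E => fderiv ℝ F (x₀ + p.1) (w - y p)) l
      (𝓝 (fderiv ℝ F x₀ (w - x₀))) :=
    (isBoundedBilinearMap_apply.continuous.tendsto (fderiv ℝ F x₀, w - x₀)).comp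
      (hA.prodMk_nhds hw)
  have hc : Tendsto (fun p : E × E => x₀ + p.2) l (𝓝 x₀) :=
    (Continuous.tendsto' (by fun_prop) 0 _ (by simp)).mono_left hl
  have hlim := (((S.tendsto_value_m.mono_left hl).sub (hz'.inner (𝕜 := ℝ) hAw)).sub
    (((hy.sub hc).inner (𝕜 := ℝ) hw).const_mul η⁻¹)).sub ((hw.norm.pow 2).const_mul (1 / (2 * η)))
  have hle := le_of_tendsto hlim ((S.primalDual.filter_mono hl).mono fun p hp => hp.m_le w b hb)
  rw [inner_neg_left, ContinuousLinearMap.adjoint_inner_left]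
  simpa [sub_eq_add_neg] using hle

/-- The first-order conditions determine a multiplier on the range of `∇F x₀` restricted to the
tangent space of `M` and on the tangent space of `K`; transversality says that these span. -/
lemma multiplier_unique (S : SolutionFamily F h m η μ x₀ M K G H φ χ z₀ y z α β) {z' : E₂}
    (hzh : z' ∈ subdiff h (F x₀))
    (hzm : -(ContinuousLinearMap.adjoint (fderiv ℝ F x₀) z') ∈ subdiff m x₀) : z' = z₀ := by
  have P := S.problem
  refine ext_inner_right ℝ fun v => ?_
  obtain ⟨a, b, ha, hb, rfl⟩ := P.transversal v
  have hK := P.modelK.fderiv_eq_inner hzh hb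
  have hM := P.modelM.fderiv_eq_inner hzm ha
  rw [S.fderiv_h, innerSL_apply_apply] at hK
  rw [S.fderiv_m, inner_neg_left, ContinuousLinearMap.adjoint_inner_left] at hM
  simp only [neg_apply, ContinuousLinearMap.comp_apply, innerSL_apply_apply, neg_inj] at hM
  rw [inner_add_right, inner_add_right, hM, hK]

lemma tendsto_multiplier (S : SolutionFamily F h m η μ x₀ M K G H φ χ z₀ y z α β) :
    Tendsto z (𝓝 0) (𝓝 z₀) := by
  obtain ⟨Z, hZ⟩ := S.bounded
  refine (isCompact_closedBall (0 : E₂) Z).tendsto_nhds_of_unique_mapClusterPt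
    (hZ.mono fun p hp => mem_closedBall_zero_iff.2 hp) fun z' _ hz' => ?_
  obtain ⟨U, hU, hzU⟩ := mapClusterPt_iff_ultrafilter.1 hz'
  exact S.multiplier_unique (S.mem_subdiff_h_of_tendsto hU hzU) (S.mem_subdiff_m_of_tendsto hU hzU)

lemma hasFDerivAt_proxLinMap (S : SolutionFamily F h m η μ x₀ M K G H φ χ z₀ y z α β)
    (D : E × E →L[ℝ] E) (hD : ∀ p, D p ∈ constraintKernel F G H x₀ ∧
      ∀ b ∈ constraintKernel F G H x₀,
        lagrangianHessian F φ χ η x₀ (D p) b = centreForm F z₀ η x₀ p b) :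
    HasFDerivAt (proxLinMap η h F m) (D ∘L (ContinuousLinearMap.id ℝ E).prod (.id ℝ E)) x₀ := by
  have P := S.problem
  have hdiag : Tendsto (fun x : E => (x - x₀, x - x₀)) (𝓝 x₀) (𝓝 0) :=
    Continuous.tendsto' (by fun_prop) _ _ (by simp)
  have heq : ∀ᶠ x in 𝓝 x₀, proxLinMap η h F m x = y (x - x₀, x - x₀) := by
    filter_upwards [hdiag.eventually S.primalDual] with x hx
    simp only [add_sub_cancel] at hx
    exact hx.proxLinMap_eq P.kappa_pos P.ne_bot_h P.ne_bot_m
  have hy₀ : y 0 = x₀ := by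
    obtain ⟨C, hC⟩ := S.isBigO_sub.bound
    simpa [sub_eq_zero] using hC.self_of_nhds
  have hfix : proxLinMap η h F m x₀ = x₀ := by
    rw [heq.self_of_nhds, sub_self]
    exact hy₀
  have hsol := (S.isLittleO_solution D hD).comp_tendsto hdiag
  refine .of_isLittleO ((hsol.congr' ?_ .rfl).trans_isBigO (.of_bound 1 (.of_forall fun x => ?_)))
  · filter_upwards [heq] with x hx
    simp [hx, hfix]
  · simp [Prod.norm_def]

end SolutionFamily

end Multiplier

namespace SolutionFamily

variable {E E₂ : Type*} [NormedAddCommGroup E] [InnerProductSpace ℝ E] [FiniteDimensional ℝ E]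
  [NormedAddCommGroup E₂] [InnerProductSpace ℝ E₂] [FiniteDimensional ℝ E₂]
  {k j : ℕ} {F : E → E₂} {h : E₂ → EReal} {m : E → EReal} {η μ : ℝ}
  {x₀ : E} {M : Set E} {K : Set E₂} {G : E → EuclideanSpace ℝ (Fin k)}
  {H : E₂ → EuclideanSpace ℝ (Fin j)} {φ : E → ℝ} {χ : E₂ → ℝ}
  {z₀ : E₂} {y : E × E → E} {z : E × E → E₂} {α β : E × E → ℝ}

lemma eq_of_forall_lagrangianHessian_eq
    (S : SolutionFamily F h m η μ x₀ M K G H φ χ z₀ y z α β) {a b : E}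
    (ha : a ∈ constraintKernel F G H x₀) (hb : b ∈ constraintKernel F G H x₀)
    (hab : ∀ w ∈ constraintKernel F G H x₀,
      lagrangianHessian F φ χ η x₀ a w = lagrangianHessian F φ χ η x₀ b w) : a = b := by
  have hmem := Submodule.sub_mem _ ha hb
  have hcoer := S.coercive hmem
  rw [map_sub (lagrangianHessian F φ χ η x₀) a b, sub_apply, hab _ hmem, sub_self] at hcoer
  by_contra hne
  have hnorm := norm_pos_iff.2 (sub_ne_zero.2 hne)
  have hκ := S.problem.kappa_pos
  have hpos : 0 < (η⁻¹ - μ) * ‖a - b‖ ^ 2 := by positivity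
  linarith

section Derivative

variable {D : E × E →L[ℝ] E}

lemma isLittleO_displacement (S : SolutionFamily F h m η μ x₀ M K G H φ χ z₀ y z α β)
    (hD : ∀ p, D p ∈ constraintKernel F G H x₀ ∧ ∀ b ∈ constraintKernel F G H x₀,
      lagrangianHessian F φ χ η x₀ (D p) b = centreForm F z₀ η x₀ p b) (p : E × E) :
    (fun t : ℝ => y (t • p) - x₀ - t • D p) =o[𝓝 0] fun t => t := by
  have ht : Tendsto (fun t : ℝ => t • p) (𝓝 0) (𝓝 0) :=
    Continuous.tendsto' (by fun_prop) _ _ (zero_smul ℝ p)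
  have hp : (fun t : ℝ => t • p) =O[𝓝 0] fun t : ℝ => t :=
    .of_bound ‖p‖ (.of_forall fun t => by rw [norm_smul, mul_comm])
  refine (((S.isLittleO_solution D hD).comp_tendsto ht).congr_left fun t => ?_).trans_isBigO
    hp.norm_left
  rw [Function.comp_apply, map_smul]

lemma tendsto_value_quotient (S : SolutionFamily F h m η μ x₀ M K G H φ χ z₀ y z α β)
    (hD : ∀ p, D p ∈ constraintKernel F G H x₀ ∧ ∀ b ∈ constraintKernel F G H x₀,
      lagrangianHessian F φ χ η x₀ (D p) b = centreForm F z₀ η x₀ p b) (v : E) :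
    Tendsto (fun t : ℝ => (α (t • (0, v)) + β (t • (0, v)) - (χ (F x₀) + φ x₀)) / t ^ 2) (𝓝[≠] 0)
      (𝓝 (1 / 2 * lagrangianHessian F φ χ η x₀ (D (0, v)) (D (0, v))
        - 1 / (2 * η) * ‖D (0, v)‖ ^ 2)) := by
  set R := lagrangianHessian F φ χ η x₀
  set δ : ℝ → E := fun t => y (t • (0, v)) - x₀ with hδdef
  have hδ : (fun t : ℝ => δ t - t • D (0, v)) =o[𝓝[≠] 0] fun t => t :=
    (S.isLittleO_displacement hD (0, v)).mono nhdsWithin_le_nhds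
  have hδO : δ =O[𝓝[≠] 0] fun t : ℝ => t := by
    have htD : (fun t : ℝ => t • D (0, v)) =O[𝓝[≠] 0] fun t : ℝ => t :=
      .of_bound ‖D (0, v)‖ (.of_forall fun t => by rw [norm_smul, mul_comm])
    simpa using hδ.isBigO.add htD
  have hexp := (S.isLittleO_smoothObjective_sub (ξ := fun _ => 0) (γ := fun _ => 0)
    (tendsto_nhdsWithin_of_tendsto_nhds tendsto_id) (isBigO_zero _ _) hδO).tendsto_div_nhds_zero
  have hquad := tendsto_div_sq_of_homogeneous
    (q := fun a => 1 / 2 * R a a - 1 / (2 * η) * ‖a‖ ^ 2) (by fun_prop) (fun t a => by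
      simp only [norm_smul, mul_pow, Real.norm_eq_abs, sq_abs, map_smul, smul_apply, smul_eq_mul]
      ring) hδ eventually_mem_nhdsWithin
  have hp : Tendsto (fun t : ℝ => t • ((0 : E), v)) (𝓝[≠] 0) (𝓝 0) :=
    (Continuous.tendsto' (f := fun t : ℝ => t • ((0 : E), v)) (by fun_prop) 0 0
      (zero_smul ℝ _)).mono_left nhdsWithin_le_nhds
  have hlim := hexp.add hquad
  rw [zero_add] at hlim
  refine hlim.congr' ?_
  filter_upwards [hp.eventually S.eventually_active] with t ⟨_, hβ, hα⟩
  simp only [Prod.smul_mk, smul_zero, add_zero, id] at hα hβ hδdef ⊢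
  rw [hα, hβ, ← add_div, smoothObjective, quadraticObjective]
  simp only [hδdef, add_sub_cancel, add_zero, sub_zero, Prod.mk_zero_zero, map_zero, zero_apply,
    inner_zero_right, norm_zero]
  congr 1
  ring

lemma tendsto_prox_quotient (S : SolutionFamily F h m η μ x₀ M K G H φ χ z₀ y z α β)
    (hD : ∀ p, D p ∈ constraintKernel F G H x₀ ∧ ∀ b ∈ constraintKernel F G H x₀,
      lagrangianHessian F φ χ η x₀ (D p) b = centreForm F z₀ η x₀ p b) (u v : E) :
    Tendsto (fun q : ℝ × E => (η⁻¹ * inner ℝ (y (q.1 • (0, v)) - x₀ - q.1 • v)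
        (q.1 • q.2 - (y (q.1 • (0, v)) - x₀))
        + 1 / (2 * η) * ‖q.1 • q.2 - (y (q.1 • (0, v)) - x₀)‖ ^ 2) / q.1 ^ 2) (𝓝[≠] 0 ×ˢ 𝓝 u)
      (𝓝 (η⁻¹ * inner ℝ (D (0, v) - v) (u - D (0, v)) + 1 / (2 * η) * ‖u - D (0, v)‖ ^ 2)) := by
  have hfst : Tendsto (fun q : ℝ × E => q.1) (𝓝[≠] 0 ×ˢ 𝓝 u) (𝓝[≠] 0) := tendsto_fst
  have hδ := (S.isLittleO_displacement hD (0, v)).comp_tendsto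
    (hfst.mono_right nhdsWithin_le_nhds)
  have hw := isLittleO_smul_sub_smul (l := 𝓝[≠] 0 ×ˢ 𝓝 u) (fun q : ℝ × E => q.1) tendsto_snd
  have hpair : (fun q : ℝ × E =>
      (y (q.1 • (0, v)) - x₀ - q.1 • v, q.1 • q.2 - (y (q.1 • (0, v)) - x₀))
        - q.1 • (D (0, v) - v, u - D (0, v))) =o[𝓝[≠] 0 ×ˢ 𝓝 u] fun q => q.1 := by
    refine (hδ.prod_left (hw.sub hδ)).congr_left fun q => ?_
    simp only [Function.comp_apply, Prod.smul_mk, Prod.mk_sub_mk, smul_sub]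
    congr 1 <;> abel
  exact tendsto_div_sq_of_homogeneous
    (q := fun a : E × E => η⁻¹ * inner ℝ a.1 a.2 + 1 / (2 * η) * ‖a.2‖ ^ 2) (by fun_prop)
    (fun t a => by
      simp only [Prod.smul_fst, Prod.smul_snd, norm_smul, mul_pow, Real.norm_eq_abs, sq_abs,
        real_inner_smul_left, real_inner_smul_right]
      ring) hpair (hfst.eventually eventually_mem_nhdsWithin)

lemma decrease_le (S : SolutionFamily F h m η μ x₀ M K G H φ χ z₀ y z α β)
    (hD : ∀ p, D p ∈ constraintKernel F G H x₀ ∧ ∀ b ∈ constraintKernel F G H x₀,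
      lagrangianHessian F φ χ η x₀ (D p) b = centreForm F z₀ η x₀ p b) {u : E} {c : ℝ}
    (hfreq : ∃ᶠ q : ℝ × E in 𝓝[>] (0 : ℝ) ×ˢ 𝓝 u, h (F (x₀ + q.1 • q.2)) + m (x₀ + q.1 • q.2)
      ≤ ((χ (F x₀) + φ x₀ - c * q.1 ^ 2 : ℝ) : EReal)) (v : E) :
    1 / 2 * lagrangianHessian F φ χ η x₀ (D (0, v)) (D (0, v))
      - 1 / (2 * η) * ‖D (0, v)‖ ^ 2
      + 1 / 2 * inner ℝ z₀ (fderiv ℝ (fderiv ℝ F) x₀ u u)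
      - (η⁻¹ * inner ℝ (D (0, v) - v) (u - D (0, v))
        + 1 / (2 * η) * ‖u - D (0, v)‖ ^ 2) ≤ -c := by
  have P := S.problem
  set l : Filter (ℝ × E) := 𝓝[>] 0 ×ˢ 𝓝 u
  have hl : l ≤ 𝓝[≠] 0 ×ˢ 𝓝 u :=
    Filter.prod_mono_left _ (nhdsWithin_mono _ fun _ ht => ne_of_gt ht)
  have hpos : ∀ᶠ q : ℝ × E in l, 0 < q.1 := tendsto_fst.eventually eventually_mem_nhdsWithin
  have hfst : Tendsto (fun q : ℝ × E => q.1) l (𝓝[≠] 0) := tendsto_fst.mono_left hl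
  have hp : Tendsto (fun q : ℝ × E => q.1 • ((0 : E), v)) l (𝓝 0) :=
    (Continuous.tendsto' (f := fun t : ℝ => t • ((0 : E), v)) (by fun_prop) 0 0
      (zero_smul ℝ _)).comp (hfst.mono_right nhdsWithin_le_nhds)
  have hz := (S.tendsto_multiplier.comp hp).inner (𝕜 := ℝ)
    ((tendsto_second_difference (P.contDiff.contDiffAt (x := x₀)) u).mono_left hl)
  have hlim := (((S.tendsto_value_quotient hD v).comp hfst).add hz).sub
    ((S.tendsto_prox_quotient hD u v).mono_left hl)
  rw [real_inner_smul_right] at hlim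
  refine le_of_tendsto_of_frequently hlim ((hfreq.and_eventually
    (hpos.and (hp.eventually S.primalDual))).mono ?_)
  rintro ⟨t, w⟩ ⟨hle, ht, hpd⟩
  simp only [Prod.smul_mk, smul_zero, add_zero, Function.comp_apply] at hle ht hpd ⊢
  have hlow := hpd.add_inner_sub_linModel_le P.ne_bot_h P.ne_bot_m hle
  simp only [linModel, add_sub_cancel_left, ← sub_sub] at hlow
  rw [real_inner_smul_right, ← div_eq_inv_mul, ← add_div, ← sub_div, div_le_iff₀ (by positivity),
    show t • w - (y (0, t • v) - x₀) = x₀ + t • w - y (0, t • v) by abel]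
  simp only [← sub_sub] at hlow ⊢
  linarith

/-- Were `u` not tangent, moving the proximal centre along a normal direction would leave the
subproblem's solution fixed and make the decrease unbounded. -/
lemma mem_constraintKernel_of_decrease (S : SolutionFamily F h m η μ x₀ M K G H φ χ z₀ y z α β)
    (hD : ∀ p, D p ∈ constraintKernel F G H x₀ ∧ ∀ b ∈ constraintKernel F G H x₀,
      lagrangianHessian F φ χ η x₀ (D p) b = centreForm F z₀ η x₀ p b) {u : E} {c : ℝ}
    (hc : 0 < c)
    (hfreq : ∃ᶠ q : ℝ × E in 𝓝[>] (0 : ℝ) ×ˢ 𝓝 u, h (F (x₀ + q.1 • q.2)) + m (x₀ + q.1 • q.2)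
      ≤ ((χ (F x₀) + φ x₀ - c * q.1 ^ 2 : ℝ) : EReal)) : u ∈ constraintKernel F G H x₀ := by
  rw [← (constraintKernel F G H x₀).orthogonal_orthogonal, Submodule.mem_orthogonal]
  intro v hv
  have hDv : ∀ s : ℝ, D (0, s • v) = 0 := fun s => by
    refine S.eq_of_forall_lagrangianHessian_eq (hD _).1 (zero_mem _) fun w hw => ?_
    rw [(hD _).2 w hw, centreForm_apply]
    simp [inner_smul_left, Submodule.inner_left_of_mem_orthogonal hw hv]
  by_contra hne
  set A := 1 / 2 * inner ℝ z₀ (fderiv ℝ (fderiv ℝ F) x₀ u u) - 1 / (2 * η) * ‖u‖ ^ 2 with hA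
  have hη := S.problem.eta_pos.ne'
  have hdec := S.decrease_le hD hfreq ((-A * η * (inner ℝ v u)⁻¹) • v)
  simp only [hDv, map_zero, norm_zero, zero_sub, sub_zero, inner_neg_left, inner_smul_left,
    conj_trivial, inv_mul_cancel_right₀ hne, mul_neg,
    show η⁻¹ * (-A * η) = -A by field_simp] at hdec
  linarith

lemma lagrangianHessian_lt_of_decrease (S : SolutionFamily F h m η μ x₀ M K G H φ χ z₀ y z α β)
    (hD : ∀ p, D p ∈ constraintKernel F G H x₀ ∧ ∀ b ∈ constraintKernel F G H x₀,
      lagrangianHessian F φ χ η x₀ (D p) b = centreForm F z₀ η x₀ p b) {u : E} {c : ℝ}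
    (hc : 0 < c)
    (hfreq : ∃ᶠ q : ℝ × E in 𝓝[>] (0 : ℝ) ×ˢ 𝓝 u, h (F (x₀ + q.1 • q.2)) + m (x₀ + q.1 • q.2)
      ≤ ((χ (F x₀) + φ x₀ - c * q.1 ^ 2 : ℝ) : EReal)) :
    lagrangianHessian F φ χ η x₀ u u < centreForm F z₀ η x₀ (u, u) u := by
  have hη := S.problem.eta_pos.ne'
  set v := η • (InnerProductSpace.toDual ℝ E).symm (lagrangianHessian F φ χ η x₀ u)
  have hv : D (0, v) = u := by
    refine S.eq_of_forall_lagrangianHessian_eq (hD _).1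
      (S.mem_constraintKernel_of_decrease hD hc hfreq) fun w hw => ?_
    rw [(hD _).2 w hw, centreForm_apply]
    simp [v, inner_smul_left, hη]
  have hdec := S.decrease_le hD hfreq v
  rw [hv, sub_self, inner_zero_right, norm_zero] at hdec
  rw [centreForm_apply, real_inner_self_eq_norm_sq]
  have hhalf : 1 / (2 * η) * ‖u‖ ^ 2 = 1 / 2 * (η⁻¹ * ‖u‖ ^ 2) := by field_simp
  linarith

end Derivative

lemma one_lt_lambdaMax (S : SolutionFamily F h m η μ x₀ M K G H φ χ z₀ y z α β) {u : E} {c : ℝ}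
    (hc : 0 < c)
    (hfreq : ∃ᶠ q : ℝ × E in 𝓝[>] (0 : ℝ) ×ˢ 𝓝 u, h (F (x₀ + q.1 • q.2)) + m (x₀ + q.1 • q.2)
      ≤ ((χ (F x₀) + φ x₀ - c * q.1 ^ 2 : ℝ) : EReal)) :
    1 < lambdaMax (fderiv ℝ (proxLinMap η h F m) x₀) := by
  have P := S.problem
  obtain ⟨D, hD⟩ := exists_variational_solution (constraintKernel F G H x₀)
    (lagrangianHessian F φ χ η x₀) P.kappa_pos (fun a ha => S.coercive ha) (centreForm F z₀ η x₀)
  have hpos : ∀ a ∈ constraintKernel F G H x₀, a ≠ 0 →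
      0 < lagrangianHessian F φ χ η x₀ a a := fun a ha ha0 =>
    (mul_pos P.kappa_pos (pow_pos (norm_pos_iff.2 ha0) 2)).trans_le (S.coercive ha)
  have hsymm (a b : E) : centreForm F z₀ η x₀ (a, a) b = centreForm F z₀ η x₀ (b, b) a := by
    rw [centreForm_apply, centreForm_apply, real_inner_comm,
      (P.contDiff.contDiffAt.isSymmSndFDerivAt (x := x₀) (by simp)).eq]
  obtain ⟨r, a, hr, haT, ha0, hra⟩ := exists_pencil_eigenvector
    (W := centreForm F z₀ η x₀ ∘L (ContinuousLinearMap.id ℝ E).prod (.id ℝ E))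
    (lagrangianHessian_symm P.modelM.contDiffAt P.modelK.contDiffAt) hsymm hpos
    (S.mem_constraintKernel_of_decrease hD hc hfreq)
    (S.lagrangianHessian_lt_of_decrease hD hc hfreq)
  have hDa : D (a, a) = r • a := by
    refine S.eq_of_forall_lagrangianHessian_eq (hD _).1 (Submodule.smul_mem _ _ haT) fun w hw => ?_
    rw [(hD _).2 w hw, map_smul, smul_apply, smul_eq_mul, ← hra w hw]
    rfl
  rw [(S.hasFDerivAt_proxLinMap D hD).fderiv]
  exact hr.trans_le (le_csSup (Module.End.finite_hasEigenvalue _).bddAbove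
    (Module.End.hasEigenvalue_of_hasEigenvector (x := a)
      ⟨Module.End.mem_eigenspace_iff.2 hDa, ha0⟩))

end SolutionFamily

section ProximalLinear

variable {E E₂ : Type*} [NormedAddCommGroup E] [InnerProductSpace ℝ E] [FiniteDimensional ℝ E]
  [NormedAddCommGroup E₂] [InnerProductSpace ℝ E₂] [FiniteDimensional ℝ E₂]
  {F : E → E₂} {h : E₂ → EReal} {m f : E → EReal} {η μ ℓ lam : ℝ} {x₀ : E}

lemma AdmitsCompositeActiveManifold.exists_compositeProblem
    (hact : AdmitsCompositeActiveManifold 2 h F m x₀)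
    (hcrit : IsCriticalPoint (fun x => h (F x) + m x) x₀) (hη : 0 < η) (hF : ContDiff ℝ 2 F)
    (hh : ∀ u, h u ≠ ⊥) (hhl : LowerSemicontinuous h) (hhc : ExtConvex h)
    (hm : ∀ x, m x ≠ ⊥) (hml : LowerSemicontinuous m) (hmc : WeaklyConvex μ m)
    (hημ : η * μ < 1) :
    ∃ (k j : ℕ) (M : Set E) (K : Set E₂) (G : E → EuclideanSpace ℝ (Fin k))
      (H : E₂ → EuclideanSpace ℝ (Fin j)) (φ : E → ℝ) (χ : E₂ → ℝ),
      CompositeProblem F h m η μ x₀ M K G H φ χ := by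
  obtain ⟨M, K, hxM, hxK, U, V, hU, hxU, hV, hxV, ⟨hM, hmM⟩, ⟨hK, hhK⟩, htrans, c, hc,
    hsharp⟩ := hact
  obtain ⟨k, G, φ, hG⟩ := exists_isLocalModel hxM hU hxU hM hmM
  obtain ⟨j, H, χ, hH⟩ := exists_isLocalModel hxK hV hxV hK hhK
  exact ⟨k, j, M, K, G, H, φ, χ,
    { contDiff := hF
      convex_h := hhc.convexUpTo
      lsc_h := hhl
      ne_bot_h := hh
      convex_m := hmc.convexUpTo
      lsc_m := hml
      ne_bot_m := hm
      eta_pos := hη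
      mu_lt := by rwa [← one_div, lt_div_iff₀' hη]
      modelM := hG
      modelK := hH
      transversal := fun v => by
        obtain ⟨a, ha, b, hb, hab⟩ := htrans v
        exact ⟨a, b, hG.fderiv_eq_zero_of_mem_tangentConeAt ha,
          hH.fderiv_eq_zero_of_mem_tangentConeAt hb, hab⟩
      sharp := ⟨c, hc, by
        filter_upwards [prod_mem_nhds (hU.mem_nhds hxU) (hV.mem_nhds hxV)] with q hq
        exact hsharp q.1 hq.1 q.2 hq.2⟩
      critical := hcrit }⟩

lemma CompositeProblem.one_lt_lambdaMax_proxLinMap {k j : ℕ} {M : Set E} {K : Set E₂}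
    {G : E → EuclideanSpace ℝ (Fin k)} {H : E₂ → EuclideanSpace ℝ (Fin j)} {φ : E → ℝ}
    {χ : E₂ → ℝ} (P : CompositeProblem F h m η μ x₀ M K G H φ χ)
    (hsaddle : IsStrictSaddle (fun x => h (F x) + m x) x₀) :
    1 < lambdaMax (fderiv ℝ (proxLinMap η h F m) x₀) := by
  obtain ⟨u, a, c, hval, hc, hfreq⟩ := hsaddle.exists_frequently_le
  obtain ⟨φ', χ', z₀, y, z, α, β, S⟩ := P.exists_solutionFamily
  have ha : a = χ' (F x₀) + φ' x₀ := EReal.coe_injective <| by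
    rw [← hval, S.problem.modelM.apply_self, S.problem.modelK.apply_self, EReal.coe_add]
  exact S.one_lt_lambdaMax hc (ha ▸ hfreq)

theorem isLocalMin_of_lambdaMax_proxLinMap_le_one (hlam : 0 < lam) (hℓ : ℓ < lam⁻¹) (hη : 0 < η)
    (hf : ∀ x, f x = h (F x) + m x) (hF : ContDiff ℝ 2 F)
    (hh : ∀ u, h u ≠ ⊥) (hhl : LowerSemicontinuous h) (hhc : ExtConvex h)
    (hm : ∀ x, m x ≠ ⊥) (hml : LowerSemicontinuous m) (hmc : WeaklyConvex μ m)
    (hημ : η * μ < 1) (hfc : WeaklyConvex ℓ f)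
    (hsaddle : IsCriticalPoint f x₀ → IsLocalMin f x₀ ∨ IsStrictSaddle f x₀)
    (hact : AdmitsCompositeActiveManifold 2 h F m x₀)
    (hgrad : gradient (moreauEnvelope lam f) x₀ = 0)
    (hmax : lambdaMax (fderiv ℝ (proxLinMap η h F m) x₀) ≤ 1) : IsLocalMin f x₀ := by
  obtain rfl : f = fun x => h (F x) + m x := funext hf
  have hlsc : LowerSemicontinuous fun x => h (F x) + m x :=
    (hhl.comp hF.continuous).add' hml fun x =>
      EReal.continuousAt_add (Or.inr (hm x)) (Or.inl (hh _))
  have hfin : h (F x₀) + m x₀ ≠ ⊤ := by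
    obtain ⟨M, K, hxM, hxK, U, V, -, hxU, -, hxV, ⟨-, hmM⟩, ⟨-, hhK⟩, -⟩ := hact
    obtain ⟨W, φ, -, hxW, -, hφ⟩ := hmM x₀ ⟨hxM, hxU⟩
    obtain ⟨W', χ, -, hxW', -, hχ⟩ := hhK (F x₀) ⟨hxK, hxV⟩
    rw [hφ x₀ ⟨⟨hxM, hxU⟩, hxW⟩, hχ (F x₀) ⟨⟨hxK, hxV⟩, hxW'⟩]
    exact EReal.coe_ne_top (χ (F x₀) + φ x₀)
  have hcrit := isCriticalPoint_of_gradient_moreauEnvelope_eq_zero hfc.convexUpTo hlsc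
    (fun x => EReal.add_ne_bot_iff.2 ⟨hh _, hm x⟩) hlam hℓ hfin hgrad
  obtain ⟨k, j, M, K, G, H, φ, χ, P⟩ :=
    hact.exists_compositeProblem hcrit hη hF hh hhl hhc hm hml hmc hημ
  exact (hsaddle hcrit).resolve_right fun hstrict =>
    (P.one_lt_lambdaMax_proxLinMap hstrict).not_ge hmax

end ProximalLinear

section SmoothManifold

variable {E : Type*} [NormedAddCommGroup E] [InnerProductSpace ℝ E] {p : WithTop ℕ∞}
  {M N : Set E} {f : E → EReal}

lemma isSmoothManifold_univ : IsSmoothManifold p (Set.univ : Set E) :=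
  fun _ _ => ⟨0, Set.univ, fun _ => 0, isOpen_univ, trivial, contDiffOn_const,
    fun _ => ⟨0, Subsingleton.elim _ _⟩, by simp⟩

lemma IsSmoothManifold.inter_isOpen (hM : IsSmoothManifold p M) {U : Set E} (hU : IsOpen U) :
    IsSmoothManifold p (M ∩ U) := by
  rintro x ⟨hxM, hxU⟩
  obtain ⟨k, W, G, hW, hxW, hG, hsurj, hMW⟩ := hM x hxM
  refine ⟨k, W ∩ U, G, hW.inter hU, ⟨hxW, hxU⟩, hG.mono Set.inter_subset_left, hsurj, ?_⟩
  rw [← Set.inter_inter_distrib_right, hMW]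
  ext y
  exact and_right_comm

lemma IsSmoothAlong.mono (hf : IsSmoothAlong p f M) (hNM : N ⊆ M) : IsSmoothAlong p f N :=
  fun x hx => by
    obtain ⟨W, φ, hW, hxW, hφ, hfφ⟩ := hf x (hNM hx)
    exact ⟨W, φ, hW, hxW, hφ, fun y hy => hfφ y ⟨hNM hy.1, hy.2⟩⟩

lemma isSmoothAlong_coe {φ : E → ℝ} (hφ : ContDiff ℝ p φ) :
    IsSmoothAlong p (fun x => (φ x : EReal)) N :=
  fun _ _ => ⟨Set.univ, φ, isOpen_univ, trivial, hφ.contDiffOn, fun _ _ => rfl⟩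

lemma IsSmoothAlong.of_coe_add {g : E → ℝ} (hg : ContDiff ℝ p g)
    (hf : IsSmoothAlong p (fun x => (g x : EReal) + f x) M) : IsSmoothAlong p f M := by
  intro x hx
  obtain ⟨W, φ, hW, hxW, hφ, hfφ⟩ := hf x hx
  refine ⟨W, fun y => φ y - g y, hW, hxW, hφ.sub hg.contDiffOn, fun y hy => ?_⟩
  rw [EReal.coe_sub, ← hfφ y hy, EReal.add_sub_cancel_left]

end SmoothManifold

section ProximalGradient

lemma mem_subdiff_coe_iff {v u : ℝ} :
    v ∈ subdiff (fun t : ℝ => (t : EReal)) u ↔ v = 1 := by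
  have hmodel : IsLocalModel (fun t : ℝ => (t : EReal)) Set.univ u
      (fun _ => (0 : EuclideanSpace ℝ (Fin 0))) (fun t => t) :=
    ⟨contDiffAt_const, fun v => ⟨0, Subsingleton.elim _ _⟩, rfl, contDiffAt_id, by simp, by simp⟩
  constructor
  · intro hv
    have hone := hmodel.fderiv_eq_inner hv (a := 1) (Subsingleton.elim _ _)
    simpa using hone.symm
  · rintro rfl
    exact mem_subdiff_of_forall_le (a := u) (C := 0) rfl fun y => by simp

variable {E : Type*} [NormedAddCommGroup E] [InnerProductSpace ℝ E] [CompleteSpace E]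
  {g : E → ℝ} {m : E → EReal}

lemma gradient_add_mem_subdiff {y w : E} (hg : DifferentiableAt ℝ g y) (hw : w ∈ subdiff m y) :
    gradient g y + w ∈ subdiff (fun x => (g x : EReal) + m x) y := by
  obtain ⟨hbot, htop, hsub⟩ := hw
  lift m y to ℝ using ⟨htop, hbot⟩ with b hb
  refine ⟨by simp [← hb], by simp [← hb, ← EReal.coe_add], fun ε hε => ?_⟩
  have hgrad := (hasGradientAt_iff_isLittleO.1 hg.hasGradientAt).def (half_pos hε)
  filter_upwards [hsub _ (half_pos hε), hgrad] with x hmx hgx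
  have hlow : g y + b + (inner ℝ (gradient g y + w) (x - y) - ε * ‖x - y‖) ≤
      g x + (b + (inner ℝ w (x - y) - ε / 2 * ‖x - y‖)) := by
    rw [inner_add_left]
    linarith [(abs_le.1 hgx).1]
  rw [← hb, ← EReal.coe_add, ← EReal.coe_add]
  refine (EReal.coe_le_coe_iff.2 hlow).trans ?_
  rw [EReal.coe_add (g x)]
  gcongr
  rwa [EReal.coe_add]

lemma adjoint_fderiv_one (g : E → ℝ) (x : E) :
    ContinuousLinearMap.adjoint (fderiv ℝ g x) (1 : ℝ) = gradient g x :=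
  ext_inner_right ℝ fun a => by
    rw [ContinuousLinearMap.adjoint_inner_left, inner_gradient_left]
    simp

lemma IsActiveManifold.admitsCompositeActiveManifold {M : Set E} {x₀ : E}
    (hg : ContDiff ℝ 2 g) (hM : IsActiveManifold 2 (fun x => (g x : EReal) + m x) M x₀) :
    AdmitsCompositeActiveManifold 2 (fun t : ℝ => (t : EReal)) g m x₀ := by
  obtain ⟨hxM, U, hU, hxU, hsmooth, hfM, c, hc, hsharp⟩ := hM
  have hcont : Continuous (gradient g) :=
    (InnerProductSpace.toDual ℝ E).symm.continuous.comp (hg.continuous_fderiv (by simp))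
  -- On `U'` the gradient of `g` may be frozen at `x₀` at the price of half the constant `c`.
  set U' := {y | ‖gradient g y - gradient g x₀‖ < c / 2}
  have hU' : IsOpen U' := isOpen_lt (hcont.sub continuous_const).norm continuous_const
  have hxU' : x₀ ∈ U' := by simpa [U'] using hc
  refine ⟨M, Set.univ, hxM, trivial, U ∩ U', Set.univ, hU.inter hU', ⟨hxU, hxU'⟩, isOpen_univ,
    trivial, ⟨?_, ?_⟩, ⟨?_, isSmoothAlong_coe contDiff_id⟩, fun v => ?_, c / 2, half_pos hc, ?_⟩
  · rw [← Set.inter_assoc]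
    exact hsmooth.inter_isOpen hU'
  · exact (hfM.of_coe_add hg).mono (Set.inter_subset_inter_right M Set.inter_subset_left)
  · exact (Set.inter_univ (Set.univ : Set ℝ)).symm ▸ isSmoothManifold_univ
  · exact ⟨0, zero_mem_tangentConeAt (subset_closure hxM), v, by simp [tangentConeAt_univ],
      by simp⟩
  · rintro y ⟨hyU, hyU'⟩ u - hyM z hz w hw
    rw [mem_subdiff_coe_iff.1 hz, adjoint_fderiv_one]
    have hle := hsharp y hyU (fun hy => hyM ⟨hy, trivial⟩) _
      (gradient_add_mem_subdiff (hg.differentiable (by simp) y) hw)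
    have htri := norm_add_le (gradient g x₀ + w) (gradient g y - gradient g x₀)
    rw [add_right_comm, add_sub_cancel] at htri
    linarith [show ‖gradient g y - gradient g x₀‖ < c / 2 from hyU']

lemma proxLinMap_coe_eq_proxGradMap {η : ℝ} (hη : 0 < η) (g : E → ℝ) (m : E → EReal) :
    proxLinMap η (fun t : ℝ => (t : EReal)) g m = proxGradMap η g m := by
  funext x
  have hsquare (y : E) : ((g x + fderiv ℝ g x (y - x) : ℝ) : EReal) + m y
      + ((1 / (2 * η) * ‖y - x‖ ^ 2 : ℝ) : EReal) =
      ((g x - η / 2 * ‖gradient g x‖ ^ 2 : ℝ) : EReal) + (m y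
      + ((1 / (2 * η) * ‖y - (x - η • gradient g x)‖ ^ 2 : ℝ) : EReal)) := by
    rw [add_right_comm, ← EReal.coe_add, add_left_comm, ← EReal.coe_add, add_comm (m y)]
    congr 2
    rw [← sub_add, norm_add_sq_real, inner_smul_right, real_inner_comm, inner_gradient_left,
      norm_smul, Real.norm_of_nonneg hη.le]
    field_simp
    ring
  unfold proxLinMap proxGradMap prox argmin
  congr 1
  funext y
  simp only [hsquare, (EReal.addLECancellable_coe _).add_le_add_iff_left]

lemma proxGradMap_zero (η : ℝ) (m : E → EReal) :
    proxGradMap η (fun _ => (0 : ℝ)) m = prox η m := by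
  funext x
  rw [proxGradMap, gradient_fun_const, smul_zero, sub_zero]

end ProximalGradient

theorem isLocalMin_of_lambdaMax_proxGradMap_le_one {E : Type*} [NormedAddCommGroup E]
    [InnerProductSpace ℝ E] [FiniteDimensional ℝ E] {x₀ : E} {ℓ lam η μ : ℝ} (hlam : 0 < lam)
    (hℓ : ℓ < lam⁻¹) (hη : 0 < η) {g : E → ℝ} {m f : E → EReal}
    (hf : ∀ x, f x = (g x : EReal) + m x) (hg : ContDiff ℝ 2 g)
    (hm : ∀ x, m x ≠ ⊥) (hml : LowerSemicontinuous m) (hmc : WeaklyConvex μ m)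
    (hημ : η * μ < 1) (hfc : WeaklyConvex ℓ f)
    (hsaddle : IsCriticalPoint f x₀ → IsLocalMin f x₀ ∨ IsStrictSaddle f x₀)
    (hact : ∃ M, IsActiveManifold 2 f M x₀)
    (hgrad : gradient (moreauEnvelope lam f) x₀ = 0)
    (hmax : lambdaMax (fderiv ℝ (proxGradMap η g m) x₀) ≤ 1) : IsLocalMin f x₀ := by
  obtain ⟨M, hM⟩ := hact
  rw [funext hf] at hM
  rw [← proxLinMap_coe_eq_proxGradMap hη] at hmax
  exact isLocalMin_of_lambdaMax_proxLinMap_le_one hlam hℓ hη hf hg EReal.coe_ne_bot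
    continuous_coe_real_ereal.lowerSemicontinuous (fun x y a b _ _ _ => by simp) hm hml hmc hημ
    hfc hsaddle (hM.admitsCompositeActiveManifold hg) hgrad hmax

theorem corollary3p6_general {E E₂ : Type*} [NormedAddCommGroup E] [InnerProductSpace ℝ E]
    [FiniteDimensional ℝ E] [NormedAddCommGroup E₂] [InnerProductSpace ℝ E₂]
    [FiniteDimensional ℝ E₂] (x₀ : E) {ℓ lam η : ℝ} (hlam : 0 < lam) (hℓ : ℓ < lam⁻¹)
    (hη : 0 < η) :
    (∀ f : E → EReal,
      (∀ x, f x ≠ ⊥) → LowerSemicontinuous f → WeaklyConvex ℓ f → η * ℓ < 1 →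
      (IsCriticalPoint f x₀ → IsLocalMin f x₀ ∨ IsStrictSaddle f x₀) →
      (∃ M, IsActiveManifold 2 f M x₀) →
      gradient (moreauEnvelope lam f) x₀ = 0 →
      lambdaMax (fderiv ℝ (prox η f) x₀) ≤ 1 →
      IsLocalMin f x₀) ∧
    (∀ (g : E → ℝ) (m f : E → EReal) (μ : ℝ),
      (∀ x, f x = (g x : EReal) + m x) →
      ContDiff ℝ 2 g →
      (∀ x, m x ≠ ⊥) → LowerSemicontinuous m → WeaklyConvex μ m → η * μ < 1 →
      WeaklyConvex ℓ f →
      (IsCriticalPoint f x₀ → IsLocalMin f x₀ ∨ IsStrictSaddle f x₀) →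
      (∃ M, IsActiveManifold 2 f M x₀) →
      gradient (moreauEnvelope lam f) x₀ = 0 →
      lambdaMax (fderiv ℝ (proxGradMap η g m) x₀) ≤ 1 →
      IsLocalMin f x₀) ∧
    (∀ (F : E → E₂) (h : E₂ → EReal) (m f : E → EReal) (μ : ℝ),
      (∀ x, f x = h (F x) + m x) →
      ContDiff ℝ 2 F →
      (∀ u, h u ≠ ⊥) → LowerSemicontinuous h → ExtConvex h →
      (∀ x, m x ≠ ⊥) → LowerSemicontinuous m → WeaklyConvex μ m → η * μ < 1 →
      WeaklyConvex ℓ f →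
      (IsCriticalPoint f x₀ → IsLocalMin f x₀ ∨ IsStrictSaddle f x₀) →
      AdmitsCompositeActiveManifold 2 h F m x₀ →
      gradient (moreauEnvelope lam f) x₀ = 0 →
      lambdaMax (fderiv ℝ (proxLinMap η h F m) x₀) ≤ 1 →
      IsLocalMin f x₀) :=
  ⟨fun _ hbot hlsc hfc hηℓ hsaddle hact hgrad hmax =>
    isLocalMin_of_lambdaMax_proxGradMap_le_one hlam hℓ hη (fun _ => (zero_add _).symm)
      contDiff_const hbot hlsc hfc hηℓ hfc hsaddle hact hgrad (by rwa [proxGradMap_zero]),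
  fun _ _ _ _ hf hg hm hml hmc hημ hfc hsaddle hact hgrad hmax =>
    isLocalMin_of_lambdaMax_proxGradMap_le_one hlam hℓ hη hf hg hm hml hmc hημ hfc hsaddle hact
      hgrad hmax,
  fun _ _ _ _ _ hf hF hh hhl hhc hm hml hmc hημ hfc hsaddle hact hgrad hmax =>
    isLocalMin_of_lambdaMax_proxLinMap_le_one hlam hℓ hη hf hF hh hhl hhc hm hml hmc hημ hfc
      hsaddle hact hgrad hmax⟩

theorem corollary3p6 {d n : ℕ} (x₀ : EuclideanSpace ℝ (Fin d)) (ℓ lam η : ℝ)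
    (hℓ : 0 < ℓ) (hlam : lam ∈ Set.Ioo (0 : ℝ) ℓ⁻¹) (hη : 0 < η) :
    -- proximal point: minimize `f`
    (∀ f : EuclideanSpace ℝ (Fin d) → EReal,
      (∀ x, f x ≠ ⊥) → LowerSemicontinuous f → WeaklyConvex ℓ f → η * ℓ < 1 →
      StrictSaddleProperty f →
      (∃ M, IsActiveManifold 2 f M x₀) →
      ‖gradient (moreauEnvelope lam f) x₀‖ = 0 →
      lambdaMax (fderiv ℝ (prox η f) x₀) ≤ 1 →
      IsLocalMin f x₀) ∧
    -- proximal gradient: minimize `g + m`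
    (∀ (g : EuclideanSpace ℝ (Fin d) → ℝ) (m f : EuclideanSpace ℝ (Fin d) → EReal)
      (β : NNReal) (μ : ℝ),
      (∀ x, f x = (g x : EReal) + m x) →
      ContDiff ℝ 2 g → LipschitzWith β (gradient g) →
      (∀ x, m x ≠ ⊥) → LowerSemicontinuous m → 0 ≤ μ → WeaklyConvex μ m → η * μ < 1 →
      WeaklyConvex ℓ f →
      StrictSaddleProperty f →
      (∃ M, IsActiveManifold 2 f M x₀) →
      ‖gradient (moreauEnvelope lam f) x₀‖ = 0 →
      lambdaMax (fderiv ℝ (proxGradMap η g m) x₀) ≤ 1 →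
      IsLocalMin f x₀) ∧
    -- proximal linear: minimize `h ∘ F + m`
    (∀ (F : EuclideanSpace ℝ (Fin d) → EuclideanSpace ℝ (Fin n))
      (h : EuclideanSpace ℝ (Fin n) → EReal) (m f : EuclideanSpace ℝ (Fin d) → EReal) (μ : ℝ),
      (∀ x, f x = h (F x) + m x) →
      ContDiff ℝ 2 F →
      (∀ u, h u ≠ ⊥) → LowerSemicontinuous h → ExtConvex h →
      (∀ x, m x ≠ ⊥) → LowerSemicontinuous m → 0 ≤ μ → WeaklyConvex μ m → η * μ < 1 →
      WeaklyConvex ℓ f →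
      StrictSaddleProperty f →
      AdmitsCompositeActiveManifold 2 h F m x₀ →
      ‖gradient (moreauEnvelope lam f) x₀‖ = 0 →
      lambdaMax (fderiv ℝ (proxLinMap η h F m) x₀) ≤ 1 →
      IsLocalMin f x₀) := by
  simp only [norm_eq_zero]
  obtain ⟨point, grad, linear⟩ := corollary3p6_general
    (E₂ := EuclideanSpace ℝ (Fin n)) x₀ hlam.1 ((lt_inv_comm₀ hlam.1 hℓ).1 hlam.2) hη
  exact ⟨fun f hbot hlsc hfc hηℓ hs => point f hbot hlsc hfc hηℓ (hs x₀),
    fun g m f _ μ hf hg _ hm hml _ hmc hημ hfc hs =>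
      grad g m f μ hf hg hm hml hmc hημ hfc (hs x₀),
    fun F h m f μ hf hF hh hhl hhc hm hml _ hmc hημ hfc hs =>
      linear F h m f μ hf hF hh hhl hhc hm hml hmc hημ hfc (hs x₀)⟩
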